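/- Fix $\beta>0$ and integers $m\ge n\ge 1$. Let $\mathcal J$ be drawn from the Laguerre $\beta$-ensemble $\mathrm{L}\beta\mathrm{E}_{(m,n)}$, that is, let $\mathcal J=B^{*}B$, where $B$ is the random $n\times n$ upper bidiagonal matrix with diagonal entries $x_1,\dots,x_n$ and superdiagonal entries $y_1,\dots,y_{n-1}$ (all other entries are $0$), all these entries being independent, with $x_j\sim\chi_{\beta(m-j+1)}$ for $1\le j\le n$ and $y_j\sim\chi_{\beta(n-j)}$ for $1\le j\le n-1$; here $\chi_k$ is the chi distribution with $k>0$ degrees of freedom, with density $\frac{2^{1-k/2}}{\Gamma(k/2)}t^{k-1}e^{-t^2/2}$ on $t>0$. Let $l>0$ be a random variable independent of $\mathcal J$ with absolutely continuous distribution $d\nu(l)=F(l)\,dl$. Let $e_1$ be the first standard basis vector of $\mathbb C^n$, let $z_1,\dots,z_n$ be the eigenvalues (with multiplicity) of $\mathcal J_{l,\times}=(I_n+i\,l\,e_1e_1^{*})\mathcal J$, and let $\mathbb C_+=\{z\in\mathbb C:\operatorname{Im}z>0\}$. Then, almost surely, the eigenvalues lie in $$S=\Big\{(z_j)_{j=1}^n\in(\mathbb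 C_+)^n:\ \sum_{j=1}^n\operatorname{Arg}z_j<\tfrac{\pi}{2},\ \ \tan\Big(\sum_{j=1}^n\operatorname{Arg}z_j\Big)\in\operatorname{supp}\nu\Big\},$$ and their joint distribution (as unordered points, i.e. with labels assigned uniformly at random) is given on $S$ by $$\frac1{C_{\beta,n,m}}\,e^{-\sum_{j=1}^n\operatorname{Re}z_j/2}\,\Big|\operatorname{Re}\Big(\prod_{j=1}^n z_j\Big)\Big|^{a\beta/2-\beta/2}\prod_{j,k=1}^n|z_j-\bar z_k|^{\beta/2-1}\prod_{1\le j<k\le n}|z_j-z_k|^2\;\frac{F(l)}{l^{\beta n/2-1}}\;d^2z_1\cdots d^2z_n,$$ where $l=\tan\big(\sum_{j=1}^n\operatorname{Arg}z_j\big)$, $a=m-n+1-2/\beta$, $C_{\beta,n,m}=s_{\beta,n,m}\,2^{n(\beta/2-1)}$, and $$s_{\beta,n,m}=\frac{2^{n(a\beta/2+1+(n-1)\beta/2)}\,\Gamma(\beta/2)^n}{\Gamma(\beta n/2)}\prod_{j=1}^n\frac{\Gamma(1+\beta j/2)\,\Gamma(1+\beta a/2+\beta(j-1)/2)}{\Gamma(1+\beta/2)}.$$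 -/

import Mathlib

open MeasureTheory ProbabilityTheory Polynomial

noncomputable section

namespace LaguerrePerturbation

/-- Real square matrices carry the product (entrywise Borel) σ-algebra. -/
instance matrixMeasurableSpace (n : ℕ) : MeasurableSpace (Matrix (Fin n) (Fin n) ℝ) :=
  inferInstanceAs (MeasurableSpace (Fin n → Fin n → ℝ))

/-- The chi distribution with `k > 0` (not necessarily integer) degrees of freedom:
density `2 ^ (1 - k/2) / Γ(k/2) * t ^ (k - 1) * exp (-t²/2)` on `t > 0`. -/
def chiLaw (k : ℝ) : Measure ℝ :=
  (volume.restrict (Set.Ioi 0)).withDensity fun t =>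
    ENNReal.ofReal (2 ^ (1 - k / 2) / Real.Gamma (k / 2) * t ^ (k - 1) * Real.exp (-t ^ 2 / 2))

/-- The upper bidiagonal matrix with diagonal `x` and superdiagonal `y`. -/
def bidiagonal {n : ℕ} (x : Fin n → ℝ) (y : Fin (n - 1) → ℝ) : Matrix (Fin n) (Fin n) ℝ :=
  Matrix.of fun i j =>
    if i = j then x i
    else if h : (i : ℕ) + 1 = (j : ℕ) then y ⟨i, by omega⟩
    else 0

/-- The joint law of the bidiagonal coefficients: all independent, the `j`-th diagonal one
(counted from `1`) is chi with `β (m - j + 1)` degrees of freedom, and the `j`-th superdiagonal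
one is chi with `β (n - j)` degrees of freedom. The indices `j` below are counted from `0`. -/
def coefficientLaw (β : ℝ) (m n : ℕ) : Measure ((Fin n → ℝ) × (Fin (n - 1) → ℝ)) :=
  (Measure.pi fun j : Fin n => chiLaw (β * ((m : ℝ) - (j : ℕ)))).prod
    (Measure.pi fun j : Fin (n - 1) => chiLaw (β * ((n : ℝ) - ((j : ℕ) + 1))))

/-- The Laguerre `β`-ensemble `LβE_(m,n)` for `m ≥ n`: the law of the random Jacobi matrix
`Bᵀ B`, where `B` is bidiagonal with independent chi-distributed coefficients. -/
def laguerreLaw (β : ℝ) (m n : ℕ) : Measure (Matrix (Fin n) (Fin n) ℝ) :=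
  (coefficientLaw β m n).map fun p => (bidiagonal p.1 p.2).transpose * bidiagonal p.1 p.2

/-- The first standard basis vector `e₁` of `ℂⁿ`. -/
def e₁ (n : ℕ) [NeZero n] : Fin n → ℂ := Pi.single 0 1

/-- The multiplicative perturbation `(I + i l e₁ e₁*) J`. -/
def perturbed {n : ℕ} [NeZero n] (l : ℝ) (J : Matrix (Fin n) (Fin n) ℝ) :
    Matrix (Fin n) (Fin n) ℂ :=
  (1 + (Complex.I * (l : ℂ)) • Matrix.vecMulVec (e₁ n) (star (e₁ n))) * J.map Complex.ofReal

/-- `z` lists the eigenvalues of `A`, each repeated according to its algebraic multiplicity. -/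
def ListsEigenvalues {n : ℕ} (A : Matrix (Fin n) (Fin n) ℂ) (z : Fin n → ℂ) : Prop :=
  A.charpoly.roots = Finset.univ.val.map z

/-- The joint law of the `n` points `z₁, …, zₙ` with a labelling chosen uniformly at random: the
average over all permutations `σ` of the laws of `(z_{σ(1)}, …, z_{σ(n)})`. It depends only on the
random multiset of points. -/
def unorderedLaw {Ω : Type*} [MeasurableSpace Ω] (P : Measure Ω) {n : ℕ} (z : Ω → Fin n → ℂ) :
    Measure (Fin n → ℂ) :=
  (n.factorial : ENNReal)⁻¹ • ∑ σ : Equiv.Perm (Fin n), P.map fun ω j => z ω (σ j)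

/-- The absolutely continuous measure `dν(t) = F(t) dt` on the real line. -/
def densityMeasure (F : ℝ → ℝ) : Measure ℝ :=
  volume.withDensity fun t => ENNReal.ofReal (F t)

/-- The parameter `a = m - n + 1 - 2/β`, for `m ≥ n`. -/
def aParam (β : ℝ) (m n : ℕ) : ℝ := (m : ℝ) - n + 1 - 2 / β

/-- The constant `s_{β,n,m}` (the factor with index `j` below is the one usually indexed by
`j + 1`, with `1 ≤ j + 1 ≤ n`). -/
def sConst (β : ℝ) (m n : ℕ) : ℝ :=
  2 ^ (n * (aParam β m n * β / 2 + 1 + ((n : ℝ) - 1) * β / 2)) * Real.Gamma (β / 2) ^ n /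
      Real.Gamma (β * n / 2) *
    ∏ j : Fin n,
      Real.Gamma (1 + β * ((j : ℕ) + 1) / 2) *
          Real.Gamma (1 + β * aParam β m n / 2 + β * (j : ℕ) / 2) /
        Real.Gamma (1 + β / 2)

/-- The normalization `C_{β,n,m} = s_{β,n,m} 2 ^ (n (β/2 - 1))`. -/
def cConst (β : ℝ) (m n : ℕ) : ℝ := sConst β m n * 2 ^ (n * (β / 2 - 1))

/-- The set of configurations in the open upper half-plane whose arguments add up to an acute
angle with tangent in the support of `ν`. -/
def configurations (n : ℕ) (ν : Measure ℝ) : Set (Fin n → ℂ) :=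
  {z | (∀ j, 0 < (z j).im) ∧ ∑ j, (z j).arg < Real.pi / 2 ∧
    Real.tan (∑ j, (z j).arg) ∈ ν.support}

/-- The claimed joint density, where `l = tan (∑ j, arg (z j))`. -/
def jointDensity (β : ℝ) (m n : ℕ) (F : ℝ → ℝ) (z : Fin n → ℂ) : ℝ :=
  let l := Real.tan (∑ j, (z j).arg)
  (cConst β m n)⁻¹ * Real.exp (-(∑ j, (z j).re) / 2) *
    |(∏ j, z j).re| ^ (aParam β m n * β / 2 - β / 2) *
    (∏ j, ∏ k, ‖z j - starRingEnd ℂ (z k)‖ ^ (β / 2 - 1)) *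
    (∏ j, ∏ k ∈ Finset.Ioi j, ‖z j - z k‖ ^ 2) *
    (F l / l ^ (β * n / 2 - 1))

end LaguerrePerturbation

end

/-
Let `P` be the characteristic polynomial of `J` and `Q` that of `J` without its first row and
column. Then `Q / P` is a Stieltjes continued fraction whose parameters are the squares of the
bidiagonal coefficients, hence independent chi-squared variables, and the `z_j` are the zeros of
`P - i l (X Q - P)`. Comparing constant coefficients, `∏ z_j = (1 + i l) det J`, so that
`l = tan (∑ arg z_j)`; by a Hermite–Biehler argument the zeros lie in the upper half-plane with an
acute total argument, and every such configuration arises from exactly one `(l, P, Q)`. The density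
is therefore obtained from two Jacobians: that of the continued fraction parameters and `l` with
respect to the coefficients of `P - i l (X Q - P)`, and that of these coefficients with respect to
the zeros, which is `∏_{j < k} |z_j - z_k|²`. The factors `|z_j - conj z_k|` enter through the
resultant of `P - i l (X Q - P)` and its conjugate, which reduces to the resultant of `P` and `Q`
and is a monomial in the continued fraction parameters.
-/

noncomputable section

namespace LaguerrePerturbation

/-! ### Interlacing polynomials -/

section Polynomial

variable {K : Type*} [Field K]

theorem eq_nodal_roots_toFinset [DecidableEq K] {f : K[X]} (hf : f.Monic) (hs : f.Splits)
    (hn : f.roots.Nodup) : f = Lagrange.nodal f.roots.toFinset id := by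
  rw [Lagrange.nodal_eq, Finset.prod, Multiset.toFinset_val, hn.dedup]
  exact hs.eq_prod_roots_of_monic hf

theorem eq_sum_eval_div_derivative_mul_nodal_erase [DecidableEq K] {s : Finset K} {f : K[X]}
    (hf : f.degree < s.card) :
    f = ∑ x ∈ s, C (f.eval x / (derivative (Lagrange.nodal s id)).eval x) *
      Lagrange.nodal (s.erase x) id := by
  conv_lhs => rw [Lagrange.eq_interpolate Function.injective_id.injOn hf,
    Lagrange.interpolate_eq_nodalWeight_mul_nodal_div_X_sub_C]
  refine Finset.sum_congr rfl fun x hx => ?_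
  rw [Lagrange.nodal_erase_eq_nodal_div hx, Lagrange.nodalWeight_eq_eval_derivative_nodal hx,
    div_eq_mul_inv, C_mul]
  simp only [id]
  ring

theorem splits_of_aeval_ne_zero {f : ℝ[X]} (h : ∀ z : ℂ, 0 < z.im → aeval z f ≠ 0) :
    f.Splits := by
  refine Splits.of_splits_map_of_injective (i := algebraMap ℝ ℂ) (algebraMap ℝ ℂ).injective
    (IsAlgClosed.splits _) fun z hz => ?_
  have hz0 : aeval z f = 0 := by
    simpa only [IsRoot.def, eval_map_algebraMap] using isRoot_of_mem_roots hz
  rcases lt_trichotomy z.im 0 with him | him | him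
  · refine absurd ?_ (h (starRingEnd ℂ z) (by simpa using him))
    rw [aeval_conj, hz0, map_zero]
  · exact ⟨z.re, Complex.ext rfl him.symm⟩
  · exact absurd hz0 (h z him)

theorem aeval_nodal_ne_zero (s : Finset ℝ) {z : ℂ} (hz : z.im ≠ 0) :
    aeval z (Lagrange.nodal s (id : ℝ → ℝ)) ≠ 0 := by
  rw [Lagrange.nodal_eq, map_prod, Finset.prod_ne_zero_iff]
  intro x _ h
  exact hz (by simpa using congrArg Complex.im h)

end Polynomial

/-- The zeros of `A` are real and simple, those of `B` strictly separate them, and `B` has a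
positive leading coefficient. This is encoded by the positivity of the residues `B x / A' x` of
`B / A`. -/
structure IsInterlacingPair (A B : ℝ[X]) : Prop where
  monic : A.Monic
  splits : A.Splits
  natDegree_ne_zero : A.natDegree ≠ 0
  degree_lt : B.degree < A.degree
  eval_mul_derivative_pos : ∀ x, A.eval x = 0 → 0 < B.eval x * (derivative A).eval x

namespace IsInterlacingPair

variable {A B : ℝ[X]}

theorem nodup_roots (h : IsInterlacingPair A B) : A.roots.Nodup := by
  classical
  refine Multiset.nodup_iff_count_le_one.2 fun x => ?_
  by_contra! hx
  rw [count_roots, one_lt_rootMultiplicity_iff_isRoot h.monic.ne_zero] at hx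
  simpa [hx.2.eq_zero] using h.eval_mul_derivative_pos x hx.1

theorem exists_partialFractions (h : IsInterlacingPair A B) :
    ∃ (s : Finset ℝ) (r : ℝ → ℝ), s.Nonempty ∧ (∀ x ∈ s, 0 < r x) ∧ A = Lagrange.nodal s id ∧
      B = ∑ x ∈ s, C (r x) * Lagrange.nodal (s.erase x) id := by
  have hA : A = Lagrange.nodal A.roots.toFinset id :=
    eq_nodal_roots_toFinset h.monic h.splits h.nodup_roots
  have hcard : A.degree = A.roots.toFinset.card := by
    conv_lhs => rw [hA, Lagrange.degree_nodal]
  refine ⟨A.roots.toFinset, fun x => B.eval x / (derivative A).eval x, ?_, fun x hx => ?_, hA, ?_⟩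
  · rw [← Finset.card_pos, ← natDegree_eq_of_degree_eq_some hcard]
    exact Nat.pos_of_ne_zero h.natDegree_ne_zero
  · have hx0 : A.eval x = 0 := isRoot_of_mem_roots (Multiset.mem_toFinset.1 hx)
    exact div_pos_iff.2 (mul_pos_iff.1 (h.eval_mul_derivative_pos x hx0))
  · have hB := eq_sum_eval_div_derivative_mul_nodal_erase (hcard ▸ h.degree_lt)
    rwa [← hA] at hB

theorem coeff_natDegree_sub_one_pos (h : IsInterlacingPair A B) :
    0 < B.coeff (A.natDegree - 1) := by
  obtain ⟨s, r, hs, hr, rfl, rfl⟩ := h.exists_partialFractions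
  rw [finsetSum_coeff]
  refine Finset.sum_pos (fun x hx => ?_) hs
  have hlead := (Lagrange.nodal_monic (s := s.erase x) (v := (id : ℝ → ℝ))).coeff_natDegree
  rw [Lagrange.natDegree_nodal, Finset.card_erase_of_mem hx] at hlead
  rw [coeff_C_mul, Lagrange.natDegree_nodal, hlead, mul_one]
  exact hr x hx

theorem natDegree_right (h : IsInterlacingPair A B) : B.natDegree + 1 = A.natDegree := by
  have hle := le_natDegree_of_ne_zero h.coeff_natDegree_sub_one_pos.ne'
  have hlt := natDegree_lt_natDegree
    (fun h0 => by simpa [h0] using h.coeff_natDegree_sub_one_pos) h.degree_lt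
  lia

theorem eval_wronskian_neg (h : IsInterlacingPair A B) (x : ℝ) : (wronskian A B).eval x < 0 := by
  obtain ⟨s, r, hs, hr, rfl, rfl⟩ := h.exists_partialFractions
  have hw : wronskian (Lagrange.nodal s id) (∑ y ∈ s, C (r y) * Lagrange.nodal (s.erase y) id) =
      -∑ y ∈ s, C (r y) * Lagrange.nodal (s.erase y) id ^ 2 := by
    rw [wronskian, derivative_sum, Finset.mul_sum, Finset.mul_sum, ← Finset.sum_sub_distrib,
      ← Finset.sum_neg_distrib]
    refine Finset.sum_congr rfl fun y hy => ?_
    rw [Lagrange.nodal_eq_mul_nodal_erase hy]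
    simp only [derivative_mul, derivative_sub, derivative_X, derivative_C]
    ring
  have hpos : ∀ y ∈ s, x ∉ s.erase y → 0 < r y * (Lagrange.nodal (s.erase y) id).eval x ^ 2 :=
    fun y hy hx => mul_pos (hr y hy) <| sq_pos_of_ne_zero <|
      Lagrange.eval_nodal_not_at_node fun w hw => ne_of_mem_of_not_mem hw hx |>.symm
  rw [hw, eval_neg, neg_lt_zero, eval_finsetSum]
  simp only [eval_mul, eval_C, eval_pow]
  by_cases hx : x ∈ s
  · exact Finset.sum_pos' (fun y hy => mul_nonneg (hr y hy).le (sq_nonneg _))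
      ⟨x, hx, hpos x hx (Finset.notMem_erase x s)⟩
  · exact Finset.sum_pos (fun y hy => hpos y hy fun h => hx (Finset.mem_of_mem_erase h)) hs

theorem im_aeval_mul_conj_neg (h : IsInterlacingPair A B) {z : ℂ} (hz : 0 < z.im) :
    (aeval z B * starRingEnd ℂ (aeval z A)).im < 0 := by
  obtain ⟨s, r, hs, hr, rfl, rfl⟩ := h.exists_partialFractions
  rw [map_sum, Finset.sum_mul, Complex.im_sum]
  refine Finset.sum_neg (fun x hx => ?_) hs
  have hN := aeval_nodal_ne_zero (s.erase x) hz.ne'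
  rw [Lagrange.nodal_eq_mul_nodal_erase hx]
  simp only [map_mul, map_sub, aeval_X, aeval_C, Complex.coe_algebraMap, Complex.conj_ofReal, id]
  set N := aeval z (Lagrange.nodal (s.erase x) id)
  have hfrac : (r x : ℂ) * N * ((starRingEnd ℂ z - x) * starRingEnd ℂ N) =
      ((r x * Complex.normSq N : ℝ) : ℂ) * (starRingEnd ℂ z - x) := by
    rw [Complex.ofReal_mul, ← Complex.mul_conj]; ring
  rw [hfrac, Complex.im_ofReal_mul, Complex.sub_im, Complex.conj_im, Complex.ofReal_im]
  nlinarith [mul_pos (mul_pos (hr x hx) (Complex.normSq_pos.2 hN)) hz]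

theorem aeval_left_ne_zero (h : IsInterlacingPair A B) {z : ℂ} (hz : 0 < z.im) :
    aeval z A ≠ 0 := fun h0 => by
  simpa [h0] using h.im_aeval_mul_conj_neg hz

theorem splits_right (h : IsInterlacingPair A B) : B.Splits :=
  splits_of_aeval_ne_zero fun z hz h0 => by
    simpa [h0] using h.im_aeval_mul_conj_neg hz

theorem eval_mul_eval_neg (h : IsInterlacingPair A B) (hpos : ∀ x, A.eval x = 0 → 0 < x) {x : ℝ}
    (hx : x ≤ 0) : A.eval x * B.eval x < 0 := by
  obtain ⟨s, r, hs, hr, rfl, rfl⟩ := h.exists_partialFractions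
  have hpos' : ∀ y ∈ s, x < y := fun y hy =>
    hx.trans_lt (hpos y (Lagrange.eval_nodal_at_node (v := id) hy))
  rw [eval_finsetSum, Finset.mul_sum]
  refine Finset.sum_neg (fun y hy => ?_) hs
  have hN : (Lagrange.nodal (s.erase y) id).eval x ≠ 0 :=
    Lagrange.eval_nodal_not_at_node fun w hw => (hpos' w (Finset.mem_of_mem_erase hw)).ne
  rw [Lagrange.nodal_eq_mul_nodal_erase hy]
  simp only [eval_mul, eval_sub, eval_X, eval_C, id]
  nlinarith [mul_pos (sub_pos.2 (hpos' y hy)) (mul_pos (hr y hy) (sq_pos_of_ne_zero hN))]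

theorem of_C_mul {v : ℝ} (hv : 0 < v) (h : IsInterlacingPair A (C v * B)) :
    IsInterlacingPair A B where
  monic := h.monic
  splits := h.splits
  natDegree_ne_zero := h.natDegree_ne_zero
  degree_lt := degree_C_mul (p := B) hv.ne' ▸ h.degree_lt
  eval_mul_derivative_pos x hx := by
    have hres := h.eval_mul_derivative_pos x hx
    rw [eval_mul, eval_C, mul_assoc] at hres
    exact pos_of_mul_pos_right hres hv.le

theorem splits_linear_mul_sub (h : IsInterlacingPair A B) (α : ℝ) {v : ℝ} (hv : 0 ≤ v) :
    ((X - C α) * A - C v * B).Splits :=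
  splits_of_aeval_ne_zero fun z hz h0 => by
    -- multiplied by the conjugate of `A z`, both terms have positive imaginary part
    have him : ((z - α) * (Complex.normSq (aeval z A) : ℂ) -
        v * (aeval z B * starRingEnd ℂ (aeval z A))).im = 0 := by
      rw [← Complex.mul_conj, ← Complex.zero_im, ← zero_mul (starRingEnd ℂ (aeval z A)), ← h0]
      simp only [map_mul, map_sub, aeval_X, aeval_C, Complex.coe_algebraMap]
      congr 1; ring
    rw [Complex.sub_im, Complex.im_mul_ofReal, Complex.im_ofReal_mul, Complex.sub_im,
      Complex.ofReal_im, sub_zero] at him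
    nlinarith [h.im_aeval_mul_conj_neg hz,
      mul_pos hz (Complex.normSq_pos.2 (h.aeval_left_ne_zero hz))]

theorem linear_mul_sub (h : IsInterlacingPair A B) (α : ℝ) {v : ℝ} (hv : 0 < v) :
    IsInterlacingPair ((X - C α) * A - C v * B) A := by
  have hXA : ((X - C α) * A).Monic := (monic_X_sub_C α).mul h.monic
  have hdeg : A.degree < ((X - C α) * A).degree := by
    rw [degree_mul, degree_X_sub_C, add_comm, degree_eq_natDegree h.monic.ne_zero]
    exact_mod_cast Nat.lt_succ_self _
  have hlt : (C v * B).degree < ((X - C α) * A).degree := by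
    rw [degree_C_mul hv.ne']
    exact h.degree_lt.trans hdeg
  have hdeg' : A.degree < ((X - C α) * A - C v * B).degree := by
    rwa [degree_sub_eq_left_of_degree_lt hlt]
  refine ⟨hXA.sub_of_left hlt, h.splits_linear_mul_sub α hv.le,
    (Nat.zero_le _ |>.trans_lt (natDegree_lt_natDegree h.monic.ne_zero hdeg')).ne', hdeg',
    fun x hx => ?_⟩
  have hAx : A.eval x ≠ 0 := fun h0 => by
    have hBx : B.eval x = 0 := by simpa [h0, hv.ne'] using hx
    simpa [hBx] using h.eval_mul_derivative_pos x h0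
  have hw := h.eval_wronskian_neg x
  simp only [wronskian, derivative_sub, derivative_mul, derivative_X, derivative_C, eval_sub,
    eval_mul, eval_add, eval_X, eval_C, eval_one, eval_zero] at hx hw ⊢
  have hexpand : A.eval x * ((1 - 0) * A.eval x + (x - α) * (derivative A).eval x -
      (0 * B.eval x + v * (derivative B).eval x)) = A.eval x ^ 2 +
      (derivative A).eval x * ((x - α) * A.eval x - v * B.eval x) -
      v * (A.eval x * (derivative B).eval x - (derivative A).eval x * B.eval x) := by ring
  rw [hexpand, hx]
  nlinarith [sq_pos_of_ne_zero hAx]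

end IsInterlacingPair

/-- A pair of monic polynomials of degrees `d + 1` and `d`, the zeros of the first one being
positive and strictly interlaced by those of the second: the pairs whose quotient `Q / P` is a
Stieltjes continued fraction with positive coefficients. -/
structure IsStieltjesPair (P Q : ℝ[X]) : Prop where
  interlacing : IsInterlacingPair P Q
  monic_right : Q.Monic
  root_pos : ∀ x, P.eval x = 0 → 0 < x

namespace IsStieltjesPair

variable {P Q p q : ℝ[X]}

theorem interlacing_X_mul_sub (h : IsStieltjesPair P Q) : IsInterlacingPair P (X * Q - P) where
  monic := h.interlacing.monic
  splits := h.interlacing.splits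
  natDegree_ne_zero := h.interlacing.natDegree_ne_zero
  degree_lt := by
    rw [← neg_sub, degree_neg]
    refine degree_sub_lt_left ?_ h.interlacing.monic.ne_zero ?_
    · rw [degree_eq_natDegree h.interlacing.monic.ne_zero, ← h.interlacing.natDegree_right,
        degree_mul, degree_X, degree_eq_natDegree h.monic_right.ne_zero, add_comm]
      push_cast; rfl
    · rw [h.interlacing.monic.leadingCoeff, (monic_X.mul h.monic_right).leadingCoeff]
  eval_mul_derivative_pos x hx := by
    rw [eval_sub, hx, eval_mul, eval_X, sub_zero, mul_assoc]
    exact mul_pos (h.root_pos x hx) (h.interlacing.eval_mul_derivative_pos x hx)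

theorem root_pos_step (h : IsStieltjesPair p q) {u v : ℝ} (hu : 0 < u) (hv : 0 < v) {x : ℝ}
    (hx : (X * (p - C v * q) - C u * p).eval x = 0) : 0 < x := by
  by_contra! hx0
  have hpq := h.interlacing.eval_mul_eval_neg h.root_pos hx0
  have hpx : p.eval x ≠ 0 := fun h0 => by simp [h0] at hpq
  simp only [eval_sub, eval_mul, eval_X, eval_C] at hx
  have hxp : x * (p.eval x ^ 2 - v * (p.eval x * q.eval x)) = u * p.eval x ^ 2 := by
    linear_combination p.eval x * hx
  nlinarith [mul_pos hu (sq_pos_of_ne_zero hpx), mul_neg_of_pos_of_neg hv hpq]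

theorem step (h : IsStieltjesPair p q) {u v : ℝ} (hu : 0 < u) (hv : 0 < v) :
    IsStieltjesPair (X * (p - C v * q) - C u * p) (p - C v * q) := by
  have hPp : IsInterlacingPair (X * (p - C v * q) - C u * p) p := by
    have := h.interlacing_X_mul_sub.linear_mul_sub (u + v) hv
    rwa [show (X - C (u + v)) * p - C v * (X * q - p) = X * (p - C v * q) - C u * p by
      rw [C_add]; ring] at this
  have hlt : (C v * q).degree < p.degree := by
    rw [degree_C_mul hv.ne']; exact h.interlacing.degree_lt
  refine ⟨⟨hPp.monic, hPp.splits, hPp.natDegree_ne_zero, ?_, fun x hx => ?_⟩,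
    h.interlacing.monic.sub_of_left hlt, fun x hx => h.root_pos_step hu hv hx⟩
  · rw [degree_sub_eq_left_of_degree_lt hlt]
    exact hPp.degree_lt
  · -- at a zero `x` of the new numerator `x (p - v q) = u p`, so the residues keep their signs
    have hx0 : 0 < x := h.root_pos_step hu hv hx
    have hxQ : x * (p - C v * q).eval x = u * p.eval x := by
      simp only [eval_sub, eval_mul, eval_X, eval_C] at hx ⊢; linarith
    have hres := mul_pos hu (hPp.eval_mul_derivative_pos x hx)
    rw [← mul_assoc, ← hxQ, mul_assoc] at hres
    exact pos_of_mul_pos_right hres hx0.le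

section Inverse

variable (h : IsStieltjesPair P Q) {u : ℝ} (hu : 0 < u) (hM : X * Q - P = C u * p)
include h hM

theorem root_pos_of_X_mul_sub_eq {x : ℝ} (hx : p.eval x = 0) : 0 < x := by
  by_contra! hx0
  have := h.interlacing_X_mul_sub.eval_mul_eval_neg h.root_pos hx0
  simp [hM, hx] at this

include hu

theorem splits_of_X_mul_sub_eq : p.Splits := by
  have hs := (hM ▸ h.interlacing_X_mul_sub.splits_right).C_mul u⁻¹
  rwa [← mul_assoc, ← C_mul, inv_mul_cancel₀ hu.ne', C_1, one_mul] at hs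

theorem interlacing_sub_of_X_mul_sub_eq (hp : p.Monic) (hpd : p.natDegree ≠ 0) :
    IsInterlacingPair p (p - Q) := by
  have hPp : IsInterlacingPair P p := (hM ▸ h.interlacing_X_mul_sub).of_C_mul hu
  have hnd : p.natDegree = Q.natDegree := by
    have h₁ := hPp.natDegree_right
    have h₂ := h.interlacing.natDegree_right
    lia
  refine ⟨hp, h.splits_of_X_mul_sub_eq hu hM, hpd, ?_, fun x hx => ?_⟩
  · refine degree_sub_lt_left ?_ hp.ne_zero ?_
    · rw [degree_eq_natDegree hp.ne_zero, degree_eq_natDegree h.monic_right.ne_zero, hnd]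
    · rw [hp.leadingCoeff, h.monic_right.leadingCoeff]
  · have hx0 : 0 < x := h.root_pos_of_X_mul_sub_eq hM hx
    have hPx : P.eval x = x * Q.eval x := by
      have := congrArg (eval x) hM
      simp only [eval_sub, eval_mul, eval_X, eval_C, hx] at this
      linarith
    have hw := hPp.eval_wronskian_neg x
    simp only [wronskian, eval_sub, eval_mul, hx, mul_zero, sub_zero, hPx, mul_assoc] at hw
    rw [eval_sub, hx, zero_sub, neg_mul, neg_pos]
    exact neg_of_mul_neg_right hw hx0.le

end Inverse

end IsStieltjesPair

/-! ### Stieltjes continued fractions -/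

section MonicOf

variable {R S : Type*} [CommRing R] [CommRing S] {d : ℕ}

/-- The monic polynomial of degree `d` with given non-leading coefficients. -/
def monicOf (c : Fin d → R) : R[X] := X ^ d + ∑ i : Fin d, C (c i) * X ^ (i : ℕ)

theorem monicOf_monic (c : Fin d → R) : (monicOf c).Monic :=
  monic_X_pow_add (degree_sum_fin_lt c)

theorem natDegree_monicOf [Nontrivial R] (c : Fin d → R) : (monicOf c).natDegree = d := by
  rw [monicOf, natDegree_add_eq_left_of_degree_lt, natDegree_X_pow]
  rw [degree_X_pow]
  exact degree_sum_fin_lt c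

theorem coeff_monicOf_self [Nontrivial R] (c : Fin d → R) : (monicOf c).coeff d = 1 := by
  simpa only [natDegree_monicOf] using (monicOf_monic c).coeff_natDegree

@[simp]
theorem coeff_monicOf (c : Fin d → R) (i : Fin d) : (monicOf c).coeff i = c i := by
  rw [monicOf, coeff_add, coeff_X_pow, if_neg i.2.ne, zero_add, finsetSum_coeff,
    Finset.sum_eq_single i]
  · simp
  · intro j _ hj
    rw [coeff_C_mul, coeff_X_pow, if_neg (fun h => hj (Fin.ext h.symm)), mul_zero]
  · simp

theorem monicOf_injective : Function.Injective (monicOf : (Fin d → R) → R[X]) := fun a b h => by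
  funext i
  rw [← coeff_monicOf a i, h, coeff_monicOf]

theorem monicOf_coeff {p : R[X]} (hp : p.Monic) (hd : p.natDegree = d) :
    monicOf (fun i : Fin d => p.coeff i) = p := by
  conv_rhs => rw [hp.as_sum, hd, Finset.sum_range]
  rfl

theorem map_monicOf (f : R →+* S) (c : Fin d → R) : (monicOf c).map f = monicOf (f ∘ c) := by
  simp [monicOf, Polynomial.map_sum]

theorem monicOf_sub_snoc (p : Fin (d + 1) → R) (q : Fin d → R) (v : R) :
    monicOf (p - Fin.snoc (v • q) v) = monicOf p - C v * monicOf q := by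
  simp only [monicOf, Fin.sum_univ_castSucc, Pi.sub_apply, Fin.snoc_castSucc, Fin.snoc_last,
    Pi.smul_apply, smul_eq_mul, C_sub, C_mul, sub_mul, Finset.sum_sub_distrib, Fin.val_castSucc,
    Fin.val_last, mul_add, Finset.mul_sum, mul_assoc]
  ring

theorem monicOf_cons_zero (q : Fin d → R) :
    monicOf (Fin.cons 0 q : Fin (d + 1) → R) = X * monicOf q := by
  simp only [monicOf, Fin.sum_univ_succ, Fin.cons_zero, Fin.cons_succ, C_0, zero_mul, zero_add,
    mul_add, Finset.mul_sum, Fin.val_succ, pow_succ', mul_left_comm]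

end MonicOf

section Stieltjes

variable {d : ℕ}

/-- The space of pairs of vectors of lengths `d + 1` and `d`. Such a pair either holds the
parameters `(u, v)` of a Stieltjes continued fraction or the non-leading coefficients of a pair
`(P, Q)` of monic polynomials of degrees `d + 1` and `d`. -/
abbrev VecPair (d : ℕ) := (Fin (d + 1) → ℝ) × (Fin d → ℝ)

/-- One step of the Stieltjes recursion `(p, q) ↦ (X (p - v q) - u p, p - v q)`, on the
non-leading coefficients of monic polynomials. -/
def stieltjesStep (u v : ℝ) (x : VecPair d) : VecPair (d + 1) :=
  (Fin.cons 0 (x.1 - Fin.snoc (v • x.2) v) - Fin.snoc (u • x.1) u, x.1 - Fin.snoc (v • x.2) v)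

/-- The pair `(P, Q)` for which `Q / P` is the Stieltjes continued fraction with parameters
`(u, v)`. -/
def stieltjesMap : (d : ℕ) → VecPair d → VecPair d
  | 0, x => (fun _ => -x.1 0, Fin.elim0)
  | d + 1, x => stieltjesStep (x.1 0) (x.2 0) (stieltjesMap d (Fin.tail x.1, Fin.tail x.2))

theorem monicOf_stieltjesStep_snd (u v : ℝ) (x : VecPair d) :
    monicOf (stieltjesStep u v x).2 = monicOf x.1 - C v * monicOf x.2 :=
  monicOf_sub_snoc _ _ _

theorem monicOf_stieltjesStep_fst (u v : ℝ) (x : VecPair d) :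
    monicOf (stieltjesStep u v x).1 =
      X * (monicOf x.1 - C v * monicOf x.2) - C u * monicOf x.1 := by
  rw [← monicOf_stieltjesStep_snd u v x, ← monicOf_cons_zero]
  exact monicOf_sub_snoc _ _ _

/-- The set of pairs of coefficient vectors of the Stieltjes pairs of polynomials. -/
def stieltjesRegion (d : ℕ) : Set (VecPair d) :=
  {x | IsStieltjesPair (monicOf x.1) (monicOf x.2)}

theorem mem_stieltjesRegion_zero {x : VecPair 0} : x ∈ stieltjesRegion 0 ↔ x.1 0 < 0 := by
  have h1 : monicOf x.1 = X + C (x.1 0) := by simp [monicOf]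
  have h2 : monicOf x.2 = 1 := by simp [monicOf]
  rw [stieltjesRegion, Set.mem_ofPred_eq, h1, h2]
  refine ⟨fun h => ?_, fun hx => ⟨⟨monic_X_add_C _, .X_add_C _, by simp, by simp, by simp⟩,
    monic_one, fun y hy => ?_⟩⟩
  · linarith [h.root_pos (-x.1 0) (by simp)]
  · rw [eval_add, eval_X, eval_C] at hy
    linarith

/-- The parameter `u` of the last step of the Stieltjes recursion. -/
def unstepU (x : VecPair (d + 1)) : ℝ := x.2 (Fin.last d) - x.1 (Fin.last (d + 1))

/-- The polynomial `p` of the last step of the Stieltjes recursion. -/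
def unstepP (x : VecPair (d + 1)) : Fin (d + 1) → ℝ :=
  fun i => ((Fin.cons 0 x.2 : Fin (d + 2) → ℝ) i.castSucc - x.1 i.castSucc) / unstepU x

/-- The parameter `v` of the last step of the Stieltjes recursion. -/
def unstepV (x : VecPair (d + 1)) : ℝ := unstepP x (Fin.last d) - x.2 (Fin.last d)

/-- The polynomial `q` of the last step of the Stieltjes recursion. -/
def unstepQ (x : VecPair (d + 1)) : Fin d → ℝ :=
  fun i => (unstepP x i.castSucc - x.2 i.castSucc) / unstepV x

section Unstep

variable (u v : ℝ) (x : VecPair d) (y : VecPair (d + 1))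

theorem unstepU_stieltjesStep : unstepU (stieltjesStep u v x) = u := by
  simp only [unstepU, stieltjesStep, Pi.sub_apply]
  rw [← Fin.succ_last, Fin.cons_succ, Fin.succ_last, Fin.snoc_last, Fin.snoc_last, Pi.sub_apply,
    Fin.snoc_last, sub_sub_cancel]

theorem unstepP_stieltjesStep (hu : u ≠ 0) : unstepP (stieltjesStep u v x) = x.1 := by
  funext i
  rw [unstepP, unstepU_stieltjesStep]
  simp only [stieltjesStep, Pi.sub_apply, Fin.snoc_castSucc, Pi.smul_apply, smul_eq_mul]
  field_simp
  ring

theorem unstepV_stieltjesStep (hu : u ≠ 0) : unstepV (stieltjesStep u v x) = v := by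
  rw [unstepV, unstepP_stieltjesStep _ _ _ hu]
  simp [stieltjesStep]

theorem unstepQ_stieltjesStep (hu : u ≠ 0) (hv : v ≠ 0) :
    unstepQ (stieltjesStep u v x) = x.2 := by
  funext i
  rw [unstepQ, unstepV_stieltjesStep _ _ _ hu, unstepP_stieltjesStep _ _ _ hu]
  simp only [stieltjesStep, Pi.sub_apply, Fin.snoc_castSucc, Pi.smul_apply, smul_eq_mul]
  field_simp
  ring

theorem unstepP_sub_snoc_unstepQ (hv : unstepV y ≠ 0) :
    unstepP y - (Fin.snoc (unstepV y • unstepQ y) (unstepV y) : Fin (d + 1) → ℝ) = y.2 := by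
  funext i
  refine Fin.lastCases ?_ (fun i => ?_) i
  · simp [unstepV]
  · simp only [Pi.sub_apply, Fin.snoc_castSucc, Pi.smul_apply, smul_eq_mul, unstepQ]
    field_simp
    ring

theorem cons_sub_snoc_unstepP (hu : unstepU y ≠ 0) :
    (Fin.cons 0 y.2 : Fin (d + 2) → ℝ) - Fin.snoc (unstepU y • unstepP y) (unstepU y) = y.1 := by
  funext i
  refine Fin.lastCases ?_ (fun i => ?_) i
  · rw [Pi.sub_apply, Fin.snoc_last, unstepU, ← Fin.succ_last, Fin.cons_succ]
    ring
  · simp only [Pi.sub_apply, Fin.snoc_castSucc, Pi.smul_apply, smul_eq_mul, unstepP]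
    field_simp
    ring

theorem stieltjesStep_unstep (hu : unstepU y ≠ 0) (hv : unstepV y ≠ 0) :
    stieltjesStep (unstepU y) (unstepV y) (unstepP y, unstepQ y) = y := by
  rw [stieltjesStep, unstepP_sub_snoc_unstepQ y hv, cons_sub_snoc_unstepP y hu]

theorem X_mul_monicOf_sub_eq_C_unstepU_mul (hu : unstepU y ≠ 0) :
    X * monicOf y.2 - monicOf y.1 = C (unstepU y) * monicOf (unstepP y) := by
  conv_lhs => rw [← cons_sub_snoc_unstepP y hu, monicOf_sub_snoc, monicOf_cons_zero]
  ring

theorem monicOf_unstepP_sub_eq_C_unstepV_mul (hv : unstepV y ≠ 0) :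
    monicOf (unstepP y) - monicOf y.2 = C (unstepV y) * monicOf (unstepQ y) := by
  conv_lhs => rw [← unstepP_sub_snoc_unstepQ y hv, monicOf_sub_snoc]
  ring

end Unstep

theorem unstepU_pos {x : VecPair (d + 1)} (h : x ∈ stieltjesRegion (d + 1)) : 0 < unstepU x := by
  have hpos := h.interlacing_X_mul_sub.coeff_natDegree_sub_one_pos
  have hP := coeff_monicOf x.1 (Fin.last (d + 1))
  have hQ := coeff_monicOf (Fin.cons 0 x.2 : Fin (d + 2) → ℝ) (Fin.last d).succ
  rw [Fin.cons_succ] at hQ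
  rw [natDegree_monicOf, ← monicOf_cons_zero, coeff_sub] at hpos
  exact hpos.trans_eq (congrArg₂ (· - ·) hQ hP)

theorem unstepV_pos {x : VecPair (d + 1)}
    (h : IsInterlacingPair (monicOf (unstepP x)) (monicOf (unstepP x) - monicOf x.2)) :
    0 < unstepV x := by
  have hpos := h.coeff_natDegree_sub_one_pos
  rw [natDegree_monicOf, coeff_sub] at hpos
  exact hpos.trans_eq
    (congrArg₂ (· - ·) (coeff_monicOf (unstepP x) (Fin.last d)) (coeff_monicOf x.2 (Fin.last d)))

theorem mem_stieltjesRegion_succ {x : VecPair (d + 1)} : x ∈ stieltjesRegion (d + 1) ↔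
    0 < unstepU x ∧ 0 < unstepV x ∧ (unstepP x, unstepQ x) ∈ stieltjesRegion d := by
  refine ⟨fun h => ?_, fun ⟨hu, hv, hx⟩ => ?_⟩
  · have hu := unstepU_pos h
    have hM := X_mul_monicOf_sub_eq_C_unstepU_mul x hu.ne'
    have hpq := h.interlacing_sub_of_X_mul_sub_eq hu hM (monicOf_monic _)
      (by rw [natDegree_monicOf]; omega)
    have hv := unstepV_pos hpq
    rw [monicOf_unstepP_sub_eq_C_unstepV_mul x hv.ne'] at hpq
    exact ⟨hu, hv, hpq.of_C_mul hv, monicOf_monic _, fun y =>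
      h.root_pos_of_X_mul_sub_eq hM⟩
  · have hstep := IsStieltjesPair.step hx hu hv
    rwa [← monicOf_stieltjesStep_fst, ← monicOf_stieltjesStep_snd,
      stieltjesStep_unstep x hu.ne' hv.ne'] at hstep

theorem stieltjesStep_mem_iff {u v : ℝ} (x : VecPair d) (hu : u ≠ 0) (hv : v ≠ 0) :
    stieltjesStep u v x ∈ stieltjesRegion (d + 1) ↔ 0 < u ∧ 0 < v ∧ x ∈ stieltjesRegion d := by
  rw [mem_stieltjesRegion_succ, unstepU_stieltjesStep, unstepV_stieltjesStep _ _ _ hu,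
    unstepP_stieltjesStep _ _ _ hu, unstepQ_stieltjesStep _ _ _ hu hv]

/-- The set of pairs of vectors with positive entries. -/
def positiveOrthant (d : ℕ) : Set (VecPair d) :=
  (Set.univ.pi fun _ => Set.Ioi 0) ×ˢ (Set.univ.pi fun _ => Set.Ioi 0)

theorem mem_positiveOrthant {x : VecPair d} :
    x ∈ positiveOrthant d ↔ (∀ i, 0 < x.1 i) ∧ ∀ i, 0 < x.2 i := by
  simp [positiveOrthant]

theorem tail_mem_positiveOrthant {x : VecPair (d + 1)} (hx : x ∈ positiveOrthant (d + 1)) :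
    (Fin.tail x.1, Fin.tail x.2) ∈ positiveOrthant d := by
  rw [mem_positiveOrthant] at hx ⊢
  exact ⟨fun i => hx.1 i.succ, fun i => hx.2 i.succ⟩

theorem stieltjesMap_mem_stieltjesRegion {x : VecPair d} (hx : x ∈ positiveOrthant d) :
    stieltjesMap d x ∈ stieltjesRegion d := by
  induction d with
  | zero =>
    rw [mem_stieltjesRegion_zero]
    exact neg_lt_zero.2 ((mem_positiveOrthant.1 hx).1 0)
  | succ d ih =>
    obtain ⟨hu, hv⟩ := mem_positiveOrthant.1 hx
    exact (stieltjesStep_mem_iff _ (hu 0).ne' (hv 0).ne').2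
      ⟨hu 0, hv 0, ih (tail_mem_positiveOrthant hx)⟩

end Stieltjes

section Measurability

variable {d : ℕ} {α : Type*} [MeasurableSpace α]

@[fun_prop]
theorem measurable_snoc {f : α → Fin d → ℝ} {g : α → ℝ} (hf : Measurable f) (hg : Measurable g) :
    Measurable fun a => (Fin.snoc (f a) (g a) : Fin (d + 1) → ℝ) := by
  refine measurable_pi_lambda _ fun i => ?_
  refine Fin.lastCases ?_ (fun i => ?_) i
  · simpa using hg
  · simpa using measurable_pi_iff.1 hf i

@[fun_prop]
theorem measurable_cons {f : α → Fin d → ℝ} {g : α → ℝ} (hf : Measurable f) (hg : Measurable g) :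
    Measurable fun a => (Fin.cons (g a) (f a) : Fin (d + 1) → ℝ) := by
  refine measurable_pi_lambda _ fun i => ?_
  refine Fin.cases ?_ (fun i => ?_) i
  · simpa using hg
  · simpa using measurable_pi_iff.1 hf i

@[fun_prop]
theorem measurable_tail {f : α → Fin (d + 1) → ℝ} (hf : Measurable f) :
    Measurable fun a => Fin.tail (f a) := by
  unfold Fin.tail
  fun_prop

@[fun_prop]
theorem measurable_stieltjesStep {u v : α → ℝ} {x : α → VecPair d} (hu : Measurable u)
    (hv : Measurable v) (hx : Measurable x) :
    Measurable fun a => stieltjesStep (u a) (v a) (x a) := by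
  unfold stieltjesStep
  fun_prop

@[fun_prop]
theorem measurable_stieltjesMap (d : ℕ) : Measurable (stieltjesMap d) := by
  induction d with
  | zero => exact Measurable.prodMk (by fun_prop) measurable_const
  | succ d ih => exact measurable_stieltjesStep (by fun_prop) (by fun_prop) (by fun_prop)

@[fun_prop]
theorem measurable_unstepU : Measurable (unstepU (d := d)) := by
  unfold unstepU
  fun_prop

@[fun_prop]
theorem measurable_unstepP : Measurable (unstepP (d := d)) := by
  refine measurable_pi_lambda _ fun i => Measurable.div ?_ measurable_unstepU
  exact ((measurable_pi_apply _).comp (measurable_cons measurable_snd measurable_const)).sub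
    (by fun_prop)

@[fun_prop]
theorem measurable_unstepV : Measurable (unstepV (d := d)) := by
  unfold unstepV
  fun_prop

@[fun_prop]
theorem measurable_unstepQ : Measurable (unstepQ (d := d)) := by
  unfold unstepQ
  fun_prop

theorem measurableSet_stieltjesRegion (d : ℕ) : MeasurableSet (stieltjesRegion d) := by
  induction d with
  | zero =>
    rw [show stieltjesRegion 0 = {x | x.1 0 < 0} from Set.ext fun _ => mem_stieltjesRegion_zero]
    exact measurableSet_lt (by fun_prop) measurable_const
  | succ d ih =>
    rw [show stieltjesRegion (d + 1) = {x | 0 < unstepU x} ∩ ({x | 0 < unstepV x} ∩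
      (fun x => (unstepP x, unstepQ x)) ⁻¹' stieltjesRegion d) from
        Set.ext fun _ => mem_stieltjesRegion_succ]
    exact (measurableSet_lt measurable_const measurable_unstepU).inter
      ((measurableSet_lt measurable_const measurable_unstepV).inter
        ((measurable_unstepP.prodMk measurable_unstepQ) ih))

theorem measurableSet_positiveOrthant (d : ℕ) : MeasurableSet (positiveOrthant d) :=
  (MeasurableSet.univ_pi fun _ => measurableSet_Ioi).prod
    (MeasurableSet.univ_pi fun _ => measurableSet_Ioi)

end Measurability

section StieltjesIntegral

theorem measurePreserving_prodProdProdComm {α β γ δ : Type*} [MeasurableSpace α]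
    [MeasurableSpace β] [MeasurableSpace γ] [MeasurableSpace δ] (μ : Measure α) (ν : Measure β)
    (ρ : Measure γ) (τ : Measure δ) [SFinite μ] [SFinite ν] [SFinite ρ] [SFinite τ] :
    MeasurePreserving (Equiv.prodProdProdComm α β γ δ) ((μ.prod ν).prod (ρ.prod τ))
      ((μ.prod ρ).prod (ν.prod τ)) :=
  (measurePreserving_prodAssoc μ ρ (ν.prod τ)).symm.comp <|
    ((MeasurePreserving.id μ).prod <|
      (measurePreserving_prodAssoc ρ ν τ).comp <|
        (Measure.measurePreserving_swap.prod (MeasurePreserving.id τ)).comp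
          (measurePreserving_prodAssoc ν ρ τ).symm).comp
      (measurePreserving_prodAssoc μ ν (ρ.prod τ))

theorem lintegral_eq_ofReal_mul_lintegral_smul {E : Type*} [NormedAddCommGroup E]
    [NormedSpace ℝ E] [MeasurableSpace E] [BorelSpace E] [FiniteDimensional ℝ E] (μ : Measure E)
    [μ.IsAddHaarMeasure] {r : ℝ} (hr : r ≠ 0) (f : E → ENNReal) :
    ∫⁻ x, f x ∂μ = ENNReal.ofReal (|r| ^ Module.finrank ℝ E) * ∫⁻ x, f (r • x) ∂μ := by
  have hmap : ∫⁻ x, f (r • x) ∂μ = ∫⁻ x, f x ∂μ.map (r • ·) :=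
    ((MeasurableEquiv.smul₀ r hr).measurableEmbedding.lintegral_map f).symm
  rw [hmap, Measure.map_addHaar_smul μ hr, lintegral_smul_measure, smul_eq_mul,
    ← mul_assoc, ← ENNReal.ofReal_mul (by positivity), abs_inv, abs_pow,
    mul_inv_cancel₀ (by positivity), ENNReal.ofReal_one, one_mul]

variable {d : ℕ}

theorem measurePreserving_cons :
    MeasurePreserving fun a : ℝ × (Fin d → ℝ) => (Fin.cons a.1 a.2 : Fin (d + 1) → ℝ) := by
  have h := (volume_preserving_piFinSuccAbove (fun _ : Fin (d + 1) => ℝ) 0).symm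
  simp only [MeasurableEquiv.piFinSuccAbove_symm_apply, Fin.insertNthEquiv_zero] at h
  exact h

theorem lintegral_eq_lintegral_snoc_smul {f : (Fin (d + 1) → ℝ) → ENNReal} (hf : Measurable f) :
    ∫⁻ x, f x = ∫⁻ a : ℝ × (Fin d → ℝ),
      ENNReal.ofReal (|a.1| ^ d) * f (Fin.snoc (a.1 • a.2) a.1) := by
  have hsnoc := (volume_preserving_piFinSuccAbove (fun _ : Fin (d + 1) => ℝ) (Fin.last d)).symm
  rw [← hsnoc.lintegral_comp hf, Measure.volume_eq_prod, lintegral_prod _ (by fun_prop),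
    lintegral_prod _ (by fun_prop)]
  refine lintegral_congr_ae ?_
  filter_upwards [Measure.ae_ne volume (0 : ℝ)] with a ha
  rw [lintegral_eq_ofReal_mul_lintegral_smul volume ha, Module.finrank_fin_fun,
    lintegral_const_mul _ (by fun_prop)]
  simp only [MeasurableEquiv.piFinSuccAbove_symm_apply, Fin.insertNthEquiv_last]
  rfl

theorem lintegral_stieltjesStep {f : VecPair (d + 1) → ENNReal} (hf : Measurable f) :
    ∫⁻ x, f x = ∫⁻ w : ℝ × ℝ, ENNReal.ofReal (|w.1| ^ (d + 1) * |w.2| ^ d) *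
      ∫⁻ x : VecPair d, f (stieltjesStep w.1 w.2 x) := by
  have hP (Q : Fin (d + 1) → ℝ) : ∫⁻ P, f (P, Q) = ∫⁻ a : ℝ × (Fin (d + 1) → ℝ),
      ENNReal.ofReal (|a.1| ^ (d + 1)) * f (Fin.cons 0 Q - Fin.snoc (a.1 • a.2) a.1, Q) := by
    rw [← lintegral_sub_left_eq_self _ (Fin.cons 0 Q : Fin (d + 2) → ℝ)]
    exact lintegral_eq_lintegral_snoc_smul (by fun_prop)
  have hQ (a : ℝ × (Fin (d + 1) → ℝ)) : ∫⁻ Q : Fin (d + 1) → ℝ, ENNReal.ofReal (|a.1| ^ (d + 1)) *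
        f (Fin.cons 0 Q - Fin.snoc (a.1 • a.2) a.1, Q) = ∫⁻ b : ℝ × (Fin d → ℝ),
      ENNReal.ofReal (|a.1| ^ (d + 1) * |b.1| ^ d) * f (stieltjesStep a.1 b.1 (a.2, b.2)) := by
    rw [← lintegral_sub_left_eq_self _ a.2, lintegral_eq_lintegral_snoc_smul (by fun_prop)]
    refine lintegral_congr fun b => ?_
    rw [mul_comm (|a.1| ^ _), ENNReal.ofReal_mul (by positivity), mul_assoc]
    rfl
  calc
    ∫⁻ x, f x = ∫⁻ Q, ∫⁻ P, f (P, Q) := lintegral_prod_symm' _ hf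
    _ = ∫⁻ a : ℝ × (Fin (d + 1) → ℝ), ∫⁻ b : ℝ × (Fin d → ℝ),
          ENNReal.ofReal (|a.1| ^ (d + 1) * |b.1| ^ d) * f (stieltjesStep a.1 b.1 (a.2, b.2)) := by
      simp_rw [hP]
      rw [lintegral_lintegral_swap (by fun_prop)]
      exact lintegral_congr hQ
    _ = ∫⁻ y : (ℝ × ℝ) × VecPair d, ENNReal.ofReal (|y.1.1| ^ (d + 1) * |y.1.2| ^ d) *
          f (stieltjesStep y.1.1 y.1.2 y.2) := by
      rw [lintegral_lintegral (by fun_prop)]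
      exact (measurePreserving_prodProdProdComm _ _ _ _).lintegral_comp
        (f := fun y : (ℝ × ℝ) × VecPair d => ENNReal.ofReal (|y.1.1| ^ (d + 1) * |y.1.2| ^ d) *
          f (stieltjesStep y.1.1 y.1.2 y.2)) (by fun_prop)
    _ = ∫⁻ w : ℝ × ℝ, ∫⁻ x : VecPair d, ENNReal.ofReal (|w.1| ^ (d + 1) * |w.2| ^ d) *
          f (stieltjesStep w.1 w.2 x) := lintegral_prod _ (by fun_prop)
    _ = _ := lintegral_congr fun w => lintegral_const_mul _ (by fun_prop)

theorem setLIntegral_stieltjesRegion_succ {g : VecPair (d + 1) → ENNReal} (hg : Measurable g) :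
    ∫⁻ x in stieltjesRegion (d + 1), g x = ∫⁻ w in Set.Ioi (0 : ℝ) ×ˢ Set.Ioi (0 : ℝ),
      ENNReal.ofReal (w.1 ^ (d + 1) * w.2 ^ d) *
        ∫⁻ x in stieltjesRegion d, g (stieltjesStep w.1 w.2 x) := by
  rw [← lintegral_indicator (measurableSet_stieltjesRegion _),
    lintegral_stieltjesStep (hg.indicator (measurableSet_stieltjesRegion _)),
    ← lintegral_indicator (measurableSet_Ioi.prod measurableSet_Ioi)]
  have hne1 : ∀ᵐ w : ℝ × ℝ, w.1 ≠ 0 :=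
    Measure.quasiMeasurePreserving_fst.ae (Measure.ae_ne volume (0 : ℝ))
  have hne2 : ∀ᵐ w : ℝ × ℝ, w.2 ≠ 0 :=
    Measure.quasiMeasurePreserving_snd.ae (Measure.ae_ne volume (0 : ℝ))
  refine lintegral_congr_ae ?_
  filter_upwards [hne1, hne2] with w hu hv
  by_cases hw : w ∈ Set.Ioi (0 : ℝ) ×ˢ Set.Ioi (0 : ℝ)
  · rw [Set.indicator_of_mem hw, abs_of_pos hw.1, abs_of_pos hw.2,
      ← lintegral_indicator (measurableSet_stieltjesRegion _)]
    congr 2 with x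
    have hiff : stieltjesStep w.1 w.2 x ∈ stieltjesRegion (d + 1) ↔ x ∈ stieltjesRegion d :=
      (stieltjesStep_mem_iff x hu hv).trans ⟨fun h => h.2.2, fun h => ⟨hw.1, hw.2, h⟩⟩
    by_cases hx : x ∈ stieltjesRegion d
    · rw [Set.indicator_of_mem hx, Set.indicator_of_mem (hiff.2 hx)]
    · rw [Set.indicator_of_notMem hx, Set.indicator_of_notMem (hiff.not.2 hx)]
  · have hnotMem (x : VecPair d) : stieltjesStep w.1 w.2 x ∉ stieltjesRegion (d + 1) := fun h =>
      hw ⟨((stieltjesStep_mem_iff x hu hv).1 h).1, ((stieltjesStep_mem_iff x hu hv).1 h).2.1⟩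
    simp only [Set.indicator_of_notMem hw, Set.indicator_of_notMem (hnotMem _), lintegral_zero,
      mul_zero]

theorem setLIntegral_positiveOrthant_succ {g : VecPair (d + 1) → ENNReal} (hg : Measurable g) :
    ∫⁻ x in positiveOrthant (d + 1), g x = ∫⁻ w in Set.Ioi (0 : ℝ) ×ˢ Set.Ioi (0 : ℝ),
      ∫⁻ x in positiveOrthant d, g (Fin.cons w.1 x.1, Fin.cons w.2 x.2) := by
  have hcons : MeasurePreserving fun y : (ℝ × ℝ) × VecPair d =>
      ((Fin.cons y.1.1 y.2.1, Fin.cons y.1.2 y.2.2) : VecPair (d + 1)) :=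
    (measurePreserving_cons.prod measurePreserving_cons).comp
      (measurePreserving_prodProdProdComm volume volume volume volume)
  have hpre : (fun y : (ℝ × ℝ) × VecPair d => ((Fin.cons y.1.1 y.2.1, Fin.cons y.1.2 y.2.2) :
      VecPair (d + 1))) ⁻¹' positiveOrthant (d + 1) =
        (Set.Ioi 0 ×ˢ Set.Ioi 0) ×ˢ positiveOrthant d := by
    ext y
    simp only [Set.mem_preimage, Set.mem_prod, mem_positiveOrthant,
      Fin.forall_fin_succ (n := d + 1), Fin.forall_fin_succ (n := d), Fin.cons_zero,
      Fin.cons_succ, Set.mem_Ioi]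
    tauto
  rw [← hcons.setLIntegral_comp_preimage (measurableSet_positiveOrthant _) hg, hpre,
    Measure.volume_eq_prod, setLIntegral_prod _ (by fun_prop)]

/-- The Jacobian of `stieltjesMap d` on the positive orthant. -/
def stieltjesJacobian (d : ℕ) (x : VecPair d) : ℝ :=
  (∏ i, x.1 i ^ (d - (i : ℕ))) * ∏ i, x.2 i ^ (d - 1 - (i : ℕ))

theorem stieltjesJacobian_cons (a b : ℝ) (x : VecPair d) :
    stieltjesJacobian (d + 1) (Fin.cons a x.1, Fin.cons b x.2) =
      a ^ (d + 1) * b ^ d * stieltjesJacobian d x := by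
  have h1 : ∀ i : ℕ, d + 1 - (i + 1) = d - i := by omega
  have h2 : ∀ i : Fin d, d - ((i : ℕ) + 1) = d - 1 - i := by omega
  simp only [stieltjesJacobian, Fin.prod_univ_succ, Fin.cons_zero, Fin.cons_succ, Fin.val_zero,
    Fin.val_succ, Nat.sub_zero, h1, h2]
  ring

theorem stieltjesJacobian_pos {x : VecPair d} (hx : x ∈ positiveOrthant d) :
    0 < stieltjesJacobian d x :=
  mul_pos (Finset.prod_pos fun i _ => pow_pos ((mem_positiveOrthant.1 hx).1 i) _)
    (Finset.prod_pos fun i _ => pow_pos ((mem_positiveOrthant.1 hx).2 i) _)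

@[fun_prop]
theorem measurable_stieltjesJacobian (d : ℕ) : Measurable (stieltjesJacobian d) := by
  unfold stieltjesJacobian
  fun_prop

theorem setLIntegral_stieltjesRegion_zero {g : VecPair 0 → ENNReal} (hg : Measurable g) :
    ∫⁻ x in stieltjesRegion 0, g x = ∫⁻ x in positiveOrthant 0, g (stieltjesMap 0 x) := by
  have hneg (x : VecPair 0) : stieltjesMap 0 x = -x :=
    Prod.ext (funext fun i => by rw [Fin.fin_one_eq_zero i]; rfl) (Subsingleton.elim _ _)
  have hpre : Neg.neg ⁻¹' stieltjesRegion 0 = positiveOrthant 0 := by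
    ext x
    simp [mem_stieltjesRegion_zero, mem_positiveOrthant]
  simp only [hneg]
  rw [← hpre]
  exact (((Measure.measurePreserving_neg _).prod
    (Measure.measurePreserving_neg _)).setLIntegral_comp_preimage
      (measurableSet_stieltjesRegion 0) hg).symm

theorem setLIntegral_stieltjesRegion {g : VecPair d → ENNReal} (hg : Measurable g) :
    ∫⁻ x in stieltjesRegion d, g x = ∫⁻ x in positiveOrthant d,
      ENNReal.ofReal (stieltjesJacobian d x) * g (stieltjesMap d x) := by
  induction d with
  | zero => simpa [stieltjesJacobian] using setLIntegral_stieltjesRegion_zero hg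
  | succ d ih =>
    rw [setLIntegral_stieltjesRegion_succ hg, setLIntegral_positiveOrthant_succ (by fun_prop)]
    refine setLIntegral_congr_fun (measurableSet_Ioi.prod measurableSet_Ioi) fun w hw => ?_
    have hpos : 0 ≤ w.1 ^ (d + 1) * w.2 ^ d :=
      mul_nonneg (pow_nonneg (le_of_lt hw.1) _) (pow_nonneg (le_of_lt hw.2) _)
    rw [ih (by fun_prop), ← lintegral_const_mul _ (by fun_prop)]
    refine lintegral_congr fun x => ?_
    rw [stieltjesJacobian_cons, ENNReal.ofReal_mul hpos, mul_assoc]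
    rfl

end StieltjesIntegral

/-! ### Polynomials with zeros in the upper half-plane -/

section UpperHalfPlane

theorem arg_pos {z : ℂ} (hz : 0 < z.im) : 0 < z.arg :=
  (Complex.arg_nonneg_iff.2 hz.le).lt_of_ne' fun h => hz.ne' (Complex.arg_eq_zero_iff.1 h).2

theorem ne_zero_of_im_pos {z : ℂ} (hz : 0 < z.im) : z ≠ 0 := fun h => by simp [h] at hz

theorem im_add_ofReal_pos {z : ℂ} (hz : 0 < z.im) (t : ℝ) : 0 < (z + t).im := by simpa using hz

theorem arg_add_ofReal_le {z : ℂ} (hz : 0 < z.im) {t : ℝ} (ht : 0 ≤ t) :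
    (z + t).arg ≤ z.arg := by
  have him := im_add_ofReal_pos hz t
  have hz0 := ne_zero_of_im_pos hz
  have hzt := ne_zero_of_im_pos him
  have hsin : Real.sin ((z + t).arg - z.arg) = -(t * z.im) / (‖z + t‖ * ‖z‖) := by
    have := norm_pos_iff.2 hz0
    have := norm_pos_iff.2 hzt
    rw [Real.sin_sub, Complex.sin_arg, Complex.sin_arg, Complex.cos_arg hz0, Complex.cos_arg hzt]
    field_simp
    simp only [Complex.add_im, Complex.add_re, Complex.ofReal_im, Complex.ofReal_re]
    ring
  by_contra! h
  refine (Real.sin_pos_of_pos_of_lt_pi (sub_pos.2 h) ?_).not_ge ?_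
  · linarith [arg_pos hz, Complex.arg_le_pi (z + t)]
  · rw [hsin]
    exact div_nonpos_of_nonpos_of_nonneg (neg_nonpos.2 (mul_nonneg ht hz.le)) (by positivity)

theorem continuous_arg_add_ofReal {z : ℂ} (hz : 0 < z.im) :
    Continuous fun t : ℝ => (z + t).arg :=
  continuous_iff_continuousAt.2 fun t =>
    (Complex.continuousAt_arg (Or.inr (im_add_ofReal_pos hz t).ne')).comp
      (f := fun t : ℝ => z + t) (by fun_prop)

theorem tendsto_arg_add_ofReal_atTop (z : ℂ) :
    Filter.Tendsto (fun t : ℝ => (z + t).arg) Filter.atTop (nhds 0) := by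
  have hlim : Filter.Tendsto (fun t : ℝ => z * (t⁻¹ : ℝ) + 1) Filter.atTop (nhds 1) := by
    simpa using ((Complex.continuous_ofReal.tendsto _).comp
      tendsto_inv_atTop_zero).const_mul z |>.add_const 1
  have harg := (Complex.continuousAt_arg (by simp : (1 : ℂ) ∈ Complex.slitPlane)).tendsto.comp hlim
  rw [Complex.arg_one] at harg
  refine harg.congr' ?_
  filter_upwards [Filter.eventually_gt_atTop 0] with t ht
  have : (t : ℂ) ≠ 0 := by exact_mod_cast ht.ne'
  rw [Function.comp, ← Complex.arg_real_mul _ ht]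
  congr 1
  push_cast
  field_simp

section Finset

variable {ι : Type*} (s : Finset ι) (z : ι → ℂ)

theorem prod_eq_norm_mul_exp_sum_arg :
    ∏ j ∈ s, z j = (∏ j ∈ s, ‖z j‖ : ℝ) * Complex.exp ((∑ j ∈ s, (z j).arg : ℝ) * Complex.I) := by
  conv_lhs => enter [2, j]; rw [← Complex.norm_mul_exp_arg_mul_I (z j)]
  rw [Finset.prod_mul_distrib, ← Complex.exp_sum]
  push_cast
  rw [Finset.sum_mul]

theorem re_prod_eq_norm_mul_cos_sum_arg :
    (∏ j ∈ s, z j).re = (∏ j ∈ s, ‖z j‖) * Real.cos (∑ j ∈ s, (z j).arg) := by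
  rw [prod_eq_norm_mul_exp_sum_arg, Complex.re_ofReal_mul, Complex.exp_ofReal_mul_I_re]

theorem tan_sum_arg (hz : ∀ j ∈ s, z j ≠ 0) :
    Real.tan (∑ j ∈ s, (z j).arg) = (∏ j ∈ s, z j).im / (∏ j ∈ s, z j).re := by
  have hpos : 0 < ∏ j ∈ s, ‖z j‖ := Finset.prod_pos fun j hj => norm_pos_iff.2 (hz j hj)
  rw [re_prod_eq_norm_mul_cos_sum_arg, prod_eq_norm_mul_exp_sum_arg, Complex.im_ofReal_mul,
    Complex.exp_ofReal_mul_I_im, mul_div_mul_left _ _ hpos.ne', Real.tan_eq_sin_div_cos]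

end Finset

variable {ι : Type*} [Fintype ι] {z : ι → ℂ}

theorem norm_prod_sub_lt_norm_prod_sub_conj [Nonempty ι] (hz : ∀ j, 0 < (z j).im) {w : ℂ}
    (hw : 0 < w.im) : ‖∏ j, (w - z j)‖ < ‖∏ j, (w - starRingEnd ℂ (z j))‖ := by
  have hlt (j : ι) : ‖w - z j‖ < ‖w - starRingEnd ℂ (z j)‖ := by
    rw [Complex.norm_def, Complex.norm_def]
    refine Real.sqrt_lt_sqrt (Complex.normSq_nonneg _) ?_
    simp only [Complex.normSq_apply, Complex.sub_re, Complex.sub_im, Complex.conj_re,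
      Complex.conj_im]
    nlinarith [mul_pos hw (hz j)]
  rw [norm_prod, norm_prod]
  by_cases h0 : ∃ j, w - z j = 0
  · obtain ⟨j, hj⟩ := h0
    rw [Finset.prod_eq_zero (Finset.mem_univ j) (by rw [hj, norm_zero])]
    exact Finset.prod_pos fun j _ => (norm_nonneg _).trans_lt (hlt j)
  · push Not at h0
    exact Finset.prod_lt_prod_of_nonempty (fun j _ => norm_pos_iff.2 (h0 j)) (fun j _ => hlt j)
      Finset.univ_nonempty

theorem im_eval_derivative_div_eval_pos [Nonempty ι] (hz : ∀ j, 0 < (z j).im) (x : ℝ) :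
    0 < ((derivative (∏ j, (X - C (z j)))).eval (x : ℂ) /
      (∏ j, (X - C (z j))).eval (x : ℂ)).im := by
  have hne (j : ι) : (x : ℂ) - z j ≠ 0 := fun h => (hz j).ne' (by simp [← sub_eq_zero.1 h])
  have hroots : (∏ j, (X - C (z j))).roots = Finset.univ.val.map z := by
    rw [← roots_multiset_prod_X_sub_C (Finset.univ.val.map z), Multiset.map_map]
    rfl
  have h0 : (∏ j, (X - C (z j))).eval (x : ℂ) ≠ 0 := by
    simpa only [eval_prod, eval_sub, eval_X, eval_C] using
      Finset.prod_ne_zero_iff.2 fun j _ => hne j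
  rw [(IsAlgClosed.splits _).eval_derivative_div_eval_of_ne_zero h0, hroots, Multiset.map_map]
  change 0 < (∑ j, 1 / ((x : ℂ) - z j)).im
  rw [Complex.im_sum]
  refine Finset.sum_pos (fun j _ => ?_) Finset.univ_nonempty
  rw [one_div, Complex.inv_im, Complex.sub_im, Complex.ofReal_im, zero_sub, neg_neg]
  exact div_pos (hz j) (Complex.normSq_pos.2 (hne j))

end UpperHalfPlane

theorem aeval_ofReal (p : ℝ[X]) (x : ℝ) : aeval (x : ℂ) p = ((p.eval x : ℝ) : ℂ) := by
  rw [← Complex.coe_algebraMap, aeval_algebraMap_apply, coe_aeval_eq_eval]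

theorem IsInterlacingPair.im_pos_of_aeval_eq {P M : ℝ[X]} (h : IsInterlacingPair P M) {l : ℝ}
    (hl : 0 < l) {w : ℂ} (hw : aeval w P = Complex.I * l * aeval w M) : 0 < w.im := by
  by_contra! hk
  rcases hk.lt_or_eq with hk | hk
  · have him := h.im_aeval_mul_conj_neg (z := starRingEnd ℂ w) (by simpa using hk)
    rw [aeval_conj, aeval_conj, Complex.conj_conj, hw] at him
    have hsq : starRingEnd ℂ (aeval w M) * (Complex.I * l * aeval w M) =
        ((l * Complex.normSq (aeval w M) : ℝ) : ℂ) * Complex.I := by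
      rw [Complex.ofReal_mul, Complex.normSq_eq_conj_mul_self]
      ring
    rw [hsq, Complex.im_ofReal_mul, Complex.I_im, mul_one] at him
    exact him.not_ge (mul_nonneg hl.le (Complex.normSq_nonneg _))
  · have hre : w = (w.re : ℂ) := Complex.ext rfl hk
    rw [hre, aeval_ofReal, aeval_ofReal] at hw
    have hP : P.eval w.re = 0 := by simpa using congrArg Complex.re hw
    have hM : M.eval w.re = 0 := by simpa [hl.ne'] using (congrArg Complex.im hw).symm
    simpa [hM] using h.eval_mul_derivative_pos w.re hP

section ImaginaryPerturbation

variable {ι : Type*} [Fintype ι] {P M : ℝ[X]} {l : ℝ} {z : ι → ℂ}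
  (hprod : ∏ j, (X - C (z j)) =
    P.map (algebraMap ℝ ℂ) - C (Complex.I * l) * M.map (algebraMap ℝ ℂ))

include hprod

theorem prod_sub_eq_aeval (w : ℂ) :
    ∏ j, (w - z j) = aeval w P - Complex.I * l * aeval w M := by
  simpa only [eval_prod, eval_sub, eval_X, eval_C, eval_mul, eval_map_algebraMap] using
    congrArg (eval w) hprod

theorem eval_neg_eq_zero_iff (him : ∀ j, 0 < (z j).im) (t : ℝ) :
    P.eval (-t) = 0 ↔ Real.cos (∑ j, (z j + t).arg) = 0 := by
  have hnorm : ∏ j, ‖z j + t‖ ≠ 0 := Finset.prod_ne_zero_iff.2 fun j _ =>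
    norm_ne_zero_iff.2 (ne_zero_of_im_pos (im_add_ofReal_pos (him j) t))
  have heval : P.eval (-t) = (∏ j, (((-t : ℝ) : ℂ) - z j)).re := by
    simp [prod_sub_eq_aeval hprod, aeval_ofReal, -Complex.ofReal_neg]
  have hneg : ∏ j, (((-t : ℝ) : ℂ) - z j) = (-1) ^ Fintype.card ι * ∏ j, (z j + t) := by
    rw [← Finset.card_univ, ← Finset.prod_neg]
    exact Finset.prod_congr rfl fun j _ => by push_cast; ring
  rw [heval, hneg]
  rcases neg_one_pow_eq_or ℂ (Fintype.card ι) with h | h <;>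
    simp [h, re_prod_eq_norm_mul_cos_sum_arg, hnorm]

theorem sum_arg_lt_pi_div_two (him : ∀ j, 0 < (z j).im) (hpos : ∀ x, P.eval x = 0 → 0 < x) :
    ∑ j, (z j).arg < Real.pi / 2 := by
  by_contra! hge
  have hlim : Filter.Tendsto (fun t : ℝ => ∑ j, (z j + t).arg) Filter.atTop (nhds 0) := by
    simpa using tendsto_finsetSum Finset.univ fun j _ => tendsto_arg_add_ofReal_atTop (z j)
  obtain ⟨t, ht0, ht⟩ := ((Filter.eventually_ge_atTop (0 : ℝ)).and
    (hlim.eventually (gt_mem_nhds Real.pi_div_two_pos))).exists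
  obtain ⟨s, hs, hsum⟩ := intermediate_value_Icc' ht0
    (continuous_finsetSum _ fun j _ => continuous_arg_add_ofReal (him j)).continuousOn
    (Set.mem_Icc.2 ⟨ht.le, by simpa using hge⟩)
  have hroot : P.eval (-s) = 0 := (eval_neg_eq_zero_iff hprod him s).2
    (by simpa only [Real.cos_pi_div_two] using congrArg Real.cos hsum)
  linarith [hpos _ hroot, hs.1]

theorem root_pos_of_sum_arg_lt [Nonempty ι] (him : ∀ j, 0 < (z j).im)
    (hsum : ∑ j, (z j).arg < Real.pi / 2) {x : ℝ} (hx : P.eval x = 0) : 0 < x := by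
  by_contra! hx0
  rw [← neg_neg x, eval_neg_eq_zero_iff hprod him] at hx
  have hpos : 0 < ∑ j, (z j + (-x : ℝ)).arg :=
    Finset.sum_pos (fun j _ => arg_pos (im_add_ofReal_pos (him j) _)) Finset.univ_nonempty
  have hlt : ∑ j, (z j + (-x : ℝ)).arg < Real.pi / 2 :=
    (Finset.sum_le_sum fun j _ => arg_add_ofReal_le (him j) (neg_nonneg.2 hx0)).trans_lt hsum
  exact (Real.cos_pos_of_mem_Ioo ⟨by linarith [Real.pi_pos], hlt⟩).ne' hx

theorem splits_of_im_pos [Nonempty ι] (him : ∀ j, 0 < (z j).im) : P.Splits := by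
  refine splits_of_aeval_ne_zero fun w hw h0 => ?_
  have hlt := norm_prod_sub_lt_norm_prod_sub_conj him hw
  have hconj : ∏ j, (w - starRingEnd ℂ (z j)) = starRingEnd ℂ (∏ j, (starRingEnd ℂ w - z j)) := by
    simp [map_prod]
  rw [hconj, prod_sub_eq_aeval hprod, prod_sub_eq_aeval hprod, aeval_conj, aeval_conj, h0] at hlt
  simp at hlt

theorem mul_eval_mul_derivative_pos [Nonempty ι] (him : ∀ j, 0 < (z j).im) {x : ℝ}
    (hx : P.eval x = 0) : 0 < l * (M.eval x * (derivative P).eval x) := by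
  have hder : (derivative (∏ j, (X - C (z j)))).eval (x : ℂ) =
      ((derivative P).eval x : ℝ) - Complex.I * l * ((derivative M).eval x : ℝ) := by
    simp [hprod, derivative_map, aeval_ofReal]
  have hval : (∏ j, (X - C (z j))).eval (x : ℂ) = -(Complex.I * (l * M.eval x : ℝ)) := by
    simp [hprod, aeval_ofReal, hx, mul_assoc]
  have hpos := im_eval_derivative_div_eval_pos him x
  rw [hder, hval, div_neg, ← div_div, Complex.div_I, neg_div, neg_neg, Complex.div_ofReal_im,
    div_pos_iff] at hpos
  rw [← mul_assoc, mul_comm, mul_pos_iff]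
  simpa using hpos

end ImaginaryPerturbation

section PerturbedCoeffs

variable {d : ℕ} {l : ℝ} {x : VecPair d} {c : Fin (d + 1) → ℂ}

/-- The non-leading coefficients of `P - i l (X Q - P)`, where `x` holds the coefficients of the
pair `(P, Q)`. For `P` and `Q` the characteristic polynomials of a Jacobi matrix and of its lower
right minor, this is the characteristic polynomial of the multiplicative perturbation. -/
def perturbedCoeffs (l : ℝ) (x : VecPair d) : Fin (d + 1) → ℂ :=
  fun i => x.1 i - Complex.I * ((l * ((Fin.cons 0 x.2 : Fin (d + 1) → ℝ) i - x.1 i) : ℝ) : ℂ)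

theorem monicOf_perturbedCoeffs (l : ℝ) (x : VecPair d) :
    monicOf (perturbedCoeffs l x) = (monicOf x.1).map (algebraMap ℝ ℂ) -
      C (Complex.I * l) * (X * monicOf x.2 - monicOf x.1).map (algebraMap ℝ ℂ) := by
  rw [← monicOf_cons_zero, Polynomial.map_sub, map_monicOf, map_monicOf]
  simp only [monicOf, perturbedCoeffs, Function.comp]
  rw [add_sub_add_left_eq_sub, ← Finset.sum_sub_distrib, Finset.mul_sum, add_sub_assoc,
    ← Finset.sum_sub_distrib]
  congr 1
  refine Finset.sum_congr rfl fun i _ => ?_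
  rw [← sub_mul, ← mul_assoc, ← sub_mul, ← C_sub, ← C_mul, ← C_sub]
  simp only [Complex.coe_algebraMap, Complex.ofReal_mul, Complex.ofReal_sub, mul_assoc]

/-- The parameter `l` recovered from the coefficients of the perturbed polynomial. -/
def coeffsL (c : Fin (d + 1) → ℂ) : ℝ := (c 0).im / (c 0).re

/-- The coefficients of `(P, Q)` recovered from those of the perturbed polynomial. -/
def coeffsPair (c : Fin (d + 1) → ℂ) : VecPair d :=
  (fun i => (c i).re, fun i => (c i.succ).re - (c i.succ).im / coeffsL c)

/-- The coefficient vectors of the polynomials `P - i l (X Q - P)` for `0 < l` and Stieltjes pairs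
`(P, Q)`. -/
def coeffsRegion (d : ℕ) : Set (Fin (d + 1) → ℂ) :=
  {c | 0 < coeffsL c ∧ coeffsPair c ∈ stieltjesRegion d}

@[fun_prop]
theorem measurable_coeffsL : Measurable (coeffsL (d := d)) := by
  unfold coeffsL
  fun_prop

@[fun_prop]
theorem measurable_coeffsPair : Measurable (coeffsPair (d := d)) := by
  unfold coeffsPair
  fun_prop

theorem measurableSet_coeffsRegion : MeasurableSet (coeffsRegion d) :=
  (measurableSet_lt measurable_const measurable_coeffsL).inter
    (measurable_coeffsPair (measurableSet_stieltjesRegion d))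

@[fun_prop]
theorem measurable_perturbedCoeffs :
    Measurable fun y : ℝ × VecPair d => perturbedCoeffs y.1 y.2 := by
  unfold perturbedCoeffs
  fun_prop

theorem coeffsL_perturbedCoeffs (hx : x.1 0 ≠ 0) : coeffsL (perturbedCoeffs l x) = l := by
  simp [coeffsL, perturbedCoeffs, hx]

theorem coeffsPair_perturbedCoeffs (hl : l ≠ 0) (hx : x.1 0 ≠ 0) :
    coeffsPair (perturbedCoeffs l x) = x := by
  rw [coeffsPair, coeffsL_perturbedCoeffs hx]
  refine Prod.ext (funext fun i => ?_) (funext fun i => ?_)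
  · simp [perturbedCoeffs]
  · have him : (perturbedCoeffs l x i.succ).im = l * (x.1 i.succ - x.2 i) := by
      simp [perturbedCoeffs]
      ring
    simp only [him, mul_div_cancel_left₀ _ hl]
    simp [perturbedCoeffs]

theorem perturbedCoeffs_coeffs (hc : coeffsL c ≠ 0) :
    perturbedCoeffs (coeffsL c) (coeffsPair c) = c := by
  have h0 : (c 0).re ≠ 0 := fun h => hc (by simp [coeffsL, h])
  funext i
  refine Complex.ext (by simp [perturbedCoeffs, coeffsPair]) ?_
  cases i using Fin.cases with
  | zero => simp [perturbedCoeffs, coeffsPair, coeffsL, h0]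
  | succ i =>
    simp [perturbedCoeffs, coeffsPair]
    field_simp

theorem fst_zero_ne_zero (hx : x ∈ stieltjesRegion d) : x.1 0 ≠ 0 := fun h0 =>
  lt_irrefl 0 <| IsStieltjesPair.root_pos hx 0 <| by
    rw [← coeff_zero_eq_eval_zero, ← h0]
    exact coeff_monicOf x.1 0

theorem perturbedCoeffs_mem (hx : x.1 0 ≠ 0) (hl : l ≠ 0) :
    perturbedCoeffs l x ∈ coeffsRegion d ↔ 0 < l ∧ x ∈ stieltjesRegion d := by
  rw [coeffsRegion, Set.mem_ofPred_eq, coeffsL_perturbedCoeffs hx,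
    coeffsPair_perturbedCoeffs hl hx]

end PerturbedCoeffs

/-- The non-leading coefficients of the monic polynomial with roots `z`. -/
def rootCoeffs {R : Type*} [CommRing R] {n : ℕ} (z : Fin n → R) : Fin n → R :=
  fun i => (∏ j, (X - C (z j))).coeff i

theorem monicOf_rootCoeffs {R : Type*} [CommRing R] {n : ℕ} (z : Fin n → R) :
    monicOf (rootCoeffs z) = ∏ j, (X - C (z j)) := by
  nontriviality R
  exact monicOf_coeff (monic_prod_X_sub_C _ _) (by simp [natDegree_prod_of_monic, monic_X_sub_C])

theorem rootCoeffs_zero {R : Type*} [CommRing R] {d : ℕ} (z : Fin (d + 1) → R) :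
    rootCoeffs z 0 = (-1) ^ (d + 1) * ∏ j, z j := by
  change (∏ j, (X - C (z j))).coeff 0 = _
  rw [coeff_zero_eq_eval_zero, eval_prod]
  simp [Finset.prod_neg]

/-- Configurations of points in the upper half-plane whose arguments add up to an acute angle. -/
def acuteConfigurations (n : ℕ) : Set (Fin n → ℂ) :=
  {z | (∀ j, 0 < (z j).im) ∧ ∑ j, (z j).arg < Real.pi / 2}

section Acute

variable {d : ℕ} {z : Fin (d + 1) → ℂ}

theorem coeffsL_rootCoeffs (hz : ∀ j, 0 < (z j).im) :
    coeffsL (rootCoeffs z) = Real.tan (∑ j, (z j).arg) := by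
  rw [tan_sum_arg _ _ fun j _ => ne_zero_of_im_pos (hz j), coeffsL, rootCoeffs_zero]
  rcases neg_one_pow_eq_or ℂ (d + 1) with h | h <;> simp [h, neg_div_neg_eq]

theorem tan_sum_arg_pos (hz : z ∈ acuteConfigurations (d + 1)) :
    0 < Real.tan (∑ j, (z j).arg) :=
  Real.tan_pos_of_pos_of_lt_pi_div_two
    (Finset.sum_pos (fun j _ => arg_pos (hz.1 j)) Finset.univ_nonempty) hz.2

theorem prod_X_sub_C_eq_of_coeffsL_ne_zero (h : coeffsL (rootCoeffs z) ≠ 0) :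
    ∏ j, (X - C (z j)) =
      (monicOf (coeffsPair (rootCoeffs z)).1).map (algebraMap ℝ ℂ) -
        C (Complex.I * coeffsL (rootCoeffs z)) *
          (X * monicOf (coeffsPair (rootCoeffs z)).2 -
            monicOf (coeffsPair (rootCoeffs z)).1).map (algebraMap ℝ ℂ) := by
  rw [← monicOf_rootCoeffs, ← monicOf_perturbedCoeffs, perturbedCoeffs_coeffs h]

theorem mem_acuteConfigurations_of_mem_coeffsRegion (h : rootCoeffs z ∈ coeffsRegion d) :
    z ∈ acuteConfigurations (d + 1) := by
  obtain ⟨hl, hS⟩ := h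
  have hprod := prod_X_sub_C_eq_of_coeffsL_ne_zero hl.ne'
  have him (k : Fin (d + 1)) : 0 < (z k).im := by
    refine (IsStieltjesPair.interlacing_X_mul_sub hS).im_pos_of_aeval_eq hl (sub_eq_zero.1 ?_)
    rw [← prod_sub_eq_aeval hprod, Finset.prod_eq_zero (Finset.mem_univ k) (sub_self _)]
  exact ⟨him, sum_arg_lt_pi_div_two hprod him (IsStieltjesPair.root_pos hS)⟩

theorem mem_coeffsRegion_of_mem_acuteConfigurations (h : z ∈ acuteConfigurations (d + 1)) :
    rootCoeffs z ∈ coeffsRegion d := by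
  have hl : 0 < coeffsL (rootCoeffs z) := by
    rw [coeffsL_rootCoeffs h.1]
    exact tan_sum_arg_pos h
  have hprod := prod_X_sub_C_eq_of_coeffsL_ne_zero hl.ne'
  have hdeg := natDegree_monicOf (coeffsPair (rootCoeffs z)).1
  refine ⟨hl, ⟨⟨monicOf_monic _, splits_of_im_pos hprod h.1, by simp [hdeg],
    degree_lt_degree (by simp [hdeg, natDegree_monicOf]), fun x hx => ?_⟩, monicOf_monic _,
    fun x => root_pos_of_sum_arg_lt hprod h.1 h.2⟩⟩
  have hx0 := root_pos_of_sum_arg_lt hprod h.1 h.2 hx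
  have hpos := pos_of_mul_pos_right (mul_eval_mul_derivative_pos hprod h.1 hx) hl.le
  rw [eval_sub, eval_mul, eval_X, hx, sub_zero, mul_assoc] at hpos
  exact pos_of_mul_pos_right hpos hx0.le

end Acute

/-! ### Change of variables from roots to coefficients -/

section RootCoeffs

theorem vandermonde_mulVec_rootCoeffs {R : Type*} [CommRing R] {n : ℕ} (a z : Fin n → R) :
    (Matrix.vandermonde a).mulVec (rootCoeffs z) = fun k => ∏ j, (a k - z j) - a k ^ n := by
  funext k
  have h := congrArg (eval (a k)) (monicOf_rootCoeffs z)
  simp only [eval_prod, monicOf, eval_add, eval_finsetSum, eval_sub, eval_X, eval_C, eval_pow,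
    eval_mul] at h
  simp only [← h, add_sub_cancel_left, Matrix.mulVec, dotProduct, Matrix.vandermonde_apply,
    mul_comm]

theorem rootCoeffs_eq_mulVec {K : Type*} [Field K] {n : ℕ} {a : Fin n → K}
    (ha : Function.Injective a) (z : Fin n → K) :
    rootCoeffs z = (Matrix.vandermonde a)⁻¹.mulVec (fun k => ∏ j, (a k - z j) - a k ^ n) := by
  rw [← vandermonde_mulVec_rootCoeffs, Matrix.mulVec_mulVec, Matrix.nonsing_inv_mul,
    Matrix.one_mulVec]
  exact isUnit_iff_ne_zero.2 (Matrix.det_vandermonde_ne_zero_iff.2 ha)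

theorem rootCoeffs_comp_perm {R : Type*} [CommRing R] {n : ℕ} (z : Fin n → R)
    (σ : Equiv.Perm (Fin n)) : rootCoeffs (z ∘ σ) = rootCoeffs z := by
  funext i
  exact congrArg (coeff · i) (Equiv.prod_comp σ fun j => X - C (z j))

theorem roots_monicOf_rootCoeffs {R : Type*} [CommRing R] [IsDomain R] {n : ℕ} (z : Fin n → R) :
    (monicOf (rootCoeffs z)).roots = Finset.univ.val.map z := by
  rw [monicOf_rootCoeffs, ← roots_multiset_prod_X_sub_C (Finset.univ.val.map z), Multiset.map_map]
  rfl

theorem rootCoeffs_eq_iff {K : Type*} [Field K] [IsAlgClosed K] {n : ℕ} {z c : Fin n → K} :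
    rootCoeffs z = c ↔ (monicOf c).roots = Finset.univ.val.map z := by
  refine ⟨fun h => h ▸ roots_monicOf_rootCoeffs z, fun h => monicOf_injective ?_⟩
  rw [(IsAlgClosed.splits _).eq_prod_roots_of_monic (monicOf_monic (rootCoeffs z)),
    (IsAlgClosed.splits _).eq_prod_roots_of_monic (monicOf_monic c), h, roots_monicOf_rootCoeffs]

theorem exists_univ_val_map_eq {α : Type*} {n : ℕ} (s : Multiset α) (hs : s.card = n) :
    ∃ z : Fin n → α, Finset.univ.val.map z = s := by
  subst hs
  induction s using Quotient.inductionOn with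
  | h t => exact ⟨t.get, (Fin.univ_val_map t.get).trans (congrArg _ (List.ofFn_get t))⟩

theorem surjective_rootCoeffs {K : Type*} [Field K] [IsAlgClosed K] {n : ℕ} :
    Function.Surjective (rootCoeffs : (Fin n → K) → Fin n → K) := by
  intro c
  obtain ⟨z, hz⟩ := exists_univ_val_map_eq (n := n) (monicOf c).roots <| by
    rw [← (IsAlgClosed.splits _).natDegree_eq_card_roots, natDegree_monicOf]
  exact ⟨z, rootCoeffs_eq_iff.2 hz.symm⟩

theorem range_eq_of_rootCoeffs_eq {R : Type*} [CommRing R] [IsDomain R] {n : ℕ} {z w : Fin n → R}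
    (h : rootCoeffs z = rootCoeffs w) : Set.range z = Set.range w := by
  ext x
  have hmem := congrArg (fun c => x ∈ (monicOf c).roots) h
  simpa only [roots_monicOf_rootCoeffs, Multiset.mem_map, Finset.mem_val, Finset.mem_univ,
    true_and, eq_iff_iff, ← Set.mem_range] using hmem

variable {n : ℕ}

theorem differentiable_rootCoeffs :
    Differentiable ℝ (rootCoeffs : (Fin n → ℂ) → Fin n → ℂ) := by
  have ha : Function.Injective fun k : Fin n => ((k : ℕ) : ℂ) :=
    Nat.cast_injective.comp Fin.val_injective
  rw [funext (rootCoeffs_eq_mulVec ha)]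
  refine differentiable_pi.2 fun i => ?_
  simp only [Matrix.mulVec, dotProduct]
  fun_prop

@[fun_prop]
theorem measurable_rootCoeffs : Measurable (rootCoeffs : (Fin n → ℂ) → Fin n → ℂ) :=
  differentiable_rootCoeffs.continuous.measurable

/-- The derivative of `rootCoeffs` at a point with distinct entries. -/
def rootCoeffsDeriv (a : Fin n → ℂ) : (Fin n → ℂ) →L[ℂ] (Fin n → ℂ) :=
  (Matrix.toLin' ((Matrix.vandermonde a)⁻¹ *
    Matrix.diagonal fun k => -∏ j ∈ Finset.univ.erase k, (a k - a j))).toContinuousLinearMap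

theorem hasFDerivAt_prod_sub (a : Fin n → ℂ) :
    HasFDerivAt (fun z : Fin n → ℂ => fun k : Fin n => ∏ j, (a k - z j) - a k ^ n)
      (Matrix.toLin' (Matrix.diagonal fun k =>
        -∏ j ∈ Finset.univ.erase k, (a k - a j))).toContinuousLinearMap a := by
  rw [hasFDerivAt_pi']
  intro k
  have hfactor (j : Fin n) : HasFDerivAt (fun z : Fin n → ℂ => a k - z j)
      (-ContinuousLinearMap.proj (R := ℂ) (φ := fun _ : Fin n => ℂ) j) a :=
    (hasFDerivAt_apply j a).const_sub (a k)
  refine ((HasFDerivAt.finsetProd fun j _ => hfactor j).sub_const (a k ^ n)).congr_fderiv ?_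
  ext w
  rw [sum_apply, Finset.sum_eq_single k]
  · simp [Matrix.mulVec_diagonal]
  · intro j _ hj
    rw [smul_apply, Finset.prod_eq_zero
      (Finset.mem_erase.2 ⟨hj.symm, Finset.mem_univ k⟩) (sub_self _), zero_smul]
  · simp

theorem hasFDerivAt_rootCoeffs {a : Fin n → ℂ} (ha : Function.Injective a) :
    HasFDerivAt rootCoeffs (rootCoeffsDeriv a) a := by
  rw [funext (rootCoeffs_eq_mulVec ha)]
  have h := ((Matrix.toLin' (Matrix.vandermonde a)⁻¹).toContinuousLinearMap.hasFDerivAt).comp a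
    (hasFDerivAt_prod_sub a)
  refine h.congr_fderiv ?_
  ext w : 1
  simp [rootCoeffsDeriv, Matrix.toLin'_mul]

/-- The squared modulus of the Vandermonde determinant. -/
def vandermondeSq (z : Fin n → ℂ) : ℝ := ∏ j, ∏ k ∈ Finset.Ioi j, ‖z j - z k‖ ^ 2

theorem vandermondeSq_eq_norm_det_sq (z : Fin n → ℂ) :
    vandermondeSq z = ‖(Matrix.vandermonde z).det‖ ^ 2 := by
  simp only [vandermondeSq, Matrix.det_vandermonde, norm_prod, ← Finset.prod_pow, norm_sub_rev]

@[fun_prop]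
theorem measurable_vandermondeSq : Measurable (vandermondeSq (n := n)) := by
  unfold vandermondeSq
  fun_prop

theorem vandermondeSq_comp_perm (z : Fin n → ℂ) (σ : Equiv.Perm (Fin n)) :
    vandermondeSq (z ∘ σ) = vandermondeSq z := by
  rw [vandermondeSq_eq_norm_det_sq, vandermondeSq_eq_norm_det_sq,
    show Matrix.vandermonde (z ∘ σ) = (Matrix.vandermonde z).submatrix σ id from rfl,
    Matrix.det_permute, norm_mul]
  rcases Int.units_eq_one_or (Equiv.Perm.sign σ) with h | h <;> simp [h]

theorem norm_prod_erase_sub_eq_vandermondeSq (a : Fin n → ℂ) :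
    ‖∏ k, -∏ j ∈ Finset.univ.erase k, (a k - a j)‖ = vandermondeSq a := by
  have h := Finset.prod_prod_Ioi_mul_eq_prod_prod_off_diag fun j i : Fin n => ‖a i - a j‖
  simp only [Finset.compl_singleton] at h
  simp only [norm_prod, norm_neg, vandermondeSq, ← h]
  exact Finset.prod_congr rfl fun i _ => Finset.prod_congr rfl fun j _ => by
    rw [norm_sub_rev (a j), sq]

theorem abs_det_rootCoeffsDeriv {a : Fin n → ℂ} (ha : Function.Injective a) :
    |((rootCoeffsDeriv a).restrictScalars ℝ).det| = vandermondeSq a := by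
  change |LinearMap.det
    ((Matrix.toLin' (_ * _) : (Fin n → ℂ) →ₗ[ℂ] (Fin n → ℂ)).restrictScalars ℝ)| = _
  rw [LinearMap.det_restrictScalars, LinearMap.det_toLin', Algebra.norm_complex_apply,
    Complex.normSq_eq_norm_sq, abs_of_nonneg (by positivity), Matrix.det_mul,
    Matrix.det_diagonal, Matrix.det_nonsing_inv, Ring.inverse_eq_inv', norm_mul, norm_inv,
    norm_prod_erase_sub_eq_vandermondeSq, vandermondeSq_eq_norm_det_sq]
  have hdet := norm_ne_zero_iff.2 (Matrix.det_vandermonde_ne_zero_iff.2 ha)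
  field_simp

/-- Configurations labelled by increasing real part. -/
def sortedConfigurations (n : ℕ) : Set (Fin n → ℂ) := {z | StrictMono fun j => (z j).re}

theorem measurableSet_sortedConfigurations : MeasurableSet (sortedConfigurations n) := by
  simp only [sortedConfigurations, StrictMono, Set.ofPred_forall]
  exact .iInter fun i => .iInter fun j => .iInter fun _ =>
    measurableSet_lt (by fun_prop) (by fun_prop)

theorem injective_of_mem_sorted {z : Fin n → ℂ} (hz : z ∈ sortedConfigurations n) :
    Function.Injective z :=
  Function.Injective.of_comp (f := Complex.re) hz.injective

theorem injOn_rootCoeffs : Set.InjOn rootCoeffs (sortedConfigurations n) := by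
  intro z hz w hw h
  have hrange := range_eq_of_rootCoeffs_eq h
  have hre : (fun j => (z j).re) = fun j => (w j).re := by
    refine (StrictMono.range_inj hz hw).1 ?_
    rw [Set.range_comp' Complex.re z, Set.range_comp' Complex.re w, hrange]
  funext j
  obtain ⟨k, hk⟩ : z j ∈ Set.range w := hrange ▸ Set.mem_range_self j
  have hkj : (w k).re = (w j).re := by rw [hk]; exact congrFun hre j
  rw [← hk, hw.injective hkj]

theorem existsUnique_perm_sorted {z : Fin n → ℂ} (hz : Function.Injective fun j => (z j).re) :
    ∃! σ : Equiv.Perm (Fin n), z ∘ σ ∈ sortedConfigurations n := by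
  refine ⟨Tuple.sort fun j => (z j).re, ?_, fun τ hτ => ?_⟩
  · exact (Tuple.monotone_sort fun j => (z j).re).strictMono_of_injective
      (hz.comp (Equiv.injective _))
  · have := Tuple.unique_monotone (f := fun j => (z j).re) (σ := τ) hτ.monotone
      (Tuple.monotone_sort fun j => (z j).re)
    exact Equiv.ext fun j => hz (congrFun this j)

/-- Configurations in which two points have the same real part. -/
def degenerateConfigurations (n : ℕ) : Set (Fin n → ℂ) :=
  {z | ¬ Function.Injective fun j => (z j).re}

theorem volume_re_eq_re {i j : Fin n} (hij : i ≠ j) :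
    volume {z : Fin n → ℂ | (z i).re = (z j).re} = 0 := by
  let f : (Fin n → ℂ) →ₗ[ℝ] ℝ := Complex.reLm ∘ₗ LinearMap.proj i -
    Complex.reLm ∘ₗ LinearMap.proj j
  have hf : {z : Fin n → ℂ | (z i).re = (z j).re} = (LinearMap.ker f : Set (Fin n → ℂ)) := by
    ext z
    simp [f, sub_eq_zero]
  rw [hf]
  refine Measure.addHaar_submodule _ _ fun h => ?_
  have hmem : (Pi.single i 1 : Fin n → ℂ) ∈ LinearMap.ker f := h ▸ Submodule.mem_top
  simp [f, hij.symm] at hmem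

theorem ae_injective_re : ∀ᵐ z : Fin n → ℂ, Function.Injective fun j => (z j).re := by
  have h : ∀ᵐ z : Fin n → ℂ, ∀ i j : Fin n, i ≠ j → (z i).re ≠ (z j).re := by
    simp only [ae_all_iff]
    exact fun i j hij => compl_mem_ae_iff.2 (volume_re_eq_re hij)
  filter_upwards [h] with z hz i j hij
  by_contra hne
  exact hz i j hne hij

theorem volume_image_degenerateConfigurations :
    volume (rootCoeffs '' degenerateConfigurations n) = 0 :=
  addHaar_image_eq_zero_of_differentiableOn_of_addHaar_eq_zero volume
    differentiable_rootCoeffs.differentiableOn ae_injective_re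

theorem exists_sorted_rootCoeffs_eq {c : Fin n → ℂ}
    (hc : c ∉ rootCoeffs '' degenerateConfigurations n) :
    ∃ z ∈ sortedConfigurations n, rootCoeffs z = c := by
  obtain ⟨z, rfl⟩ := surjective_rootCoeffs c
  have hz : Function.Injective fun j => (z j).re := not_not.1 fun h => hc ⟨z, h, rfl⟩
  obtain ⟨σ, hσ, -⟩ := existsUnique_perm_sorted hz
  exact ⟨_, hσ, rootCoeffs_comp_perm z σ⟩

theorem setLIntegral_sortedConfigurations (g : (Fin n → ℂ) → ENNReal) :
    ∫⁻ z in sortedConfigurations n, ENNReal.ofReal (vandermondeSq z) * g (rootCoeffs z) =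
      ∫⁻ c, g c := by
  have himage : rootCoeffs '' sortedConfigurations n =ᵐ[volume] Set.univ := by
    refine Filter.eventuallyEq_univ.2 (mem_ae_iff.2 ?_)
    refine measure_mono_null (fun c hc => ?_) (volume_image_degenerateConfigurations (n := n))
    by_contra h
    exact hc (exists_sorted_rootCoeffs_eq h)
  rw [← setLIntegral_univ g, ← setLIntegral_congr himage,
    lintegral_image_eq_lintegral_abs_det_fderiv_mul volume measurableSet_sortedConfigurations
      (fun a ha => ((hasFDerivAt_rootCoeffs
        (injective_of_mem_sorted ha)).restrictScalars ℝ).hasFDerivWithinAt) injOn_rootCoeffs g]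
  refine setLIntegral_congr_fun measurableSet_sortedConfigurations fun z hz => ?_
  rw [abs_det_rootCoeffsDeriv (injective_of_mem_sorted hz)]

theorem measurePreserving_comp_perm {ι α : Type*} [Fintype ι] [MeasureSpace α]
    [SigmaFinite (volume : Measure α)] (σ : Equiv.Perm ι) :
    MeasurePreserving (fun z : ι → α => z ∘ σ) := by
  have h : (fun z : ι → α => z ∘ σ) = MeasurableEquiv.piCongrLeft (fun _ : ι => α) σ⁻¹ := by
    funext z j
    simpa [MeasurableEquiv.coe_piCongrLeft] using
      (Equiv.piCongrLeft_apply_apply (fun _ : ι => α) σ⁻¹ z (σ j)).symm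
  exact h ▸ volume_measurePreserving_piCongrLeft (fun _ : ι => α) σ⁻¹

theorem sum_indicator_sorted {z : Fin n → ℂ} (hz : Function.Injective fun j => (z j).re) :
    ∑ σ : Equiv.Perm (Fin n),
      (sortedConfigurations n).indicator (1 : (Fin n → ℂ) → ENNReal) (z ∘ σ) = 1 := by
  obtain ⟨σ, hσ, hu⟩ := existsUnique_perm_sorted hz
  rw [Finset.sum_eq_single σ, Set.indicator_of_mem hσ, Pi.one_apply]
  · intro τ _ hτ
    exact Set.indicator_of_notMem (fun h => hτ (hu τ h)) _
  · simp

theorem lintegral_eq_factorial_mul_setLIntegral_sorted {Φ : (Fin n → ℂ) → ENNReal}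
    (hΦ : Measurable Φ) (hs : ∀ z (σ : Equiv.Perm (Fin n)), Φ (z ∘ σ) = Φ z) :
    ∫⁻ z, Φ z = n.factorial * ∫⁻ z in sortedConfigurations n, Φ z := by
  set I := (sortedConfigurations n).indicator (1 : (Fin n → ℂ) → ENNReal) with hI
  have mI : Measurable I := measurable_one.indicator measurableSet_sortedConfigurations
  have hterm (σ : Equiv.Perm (Fin n)) :
      ∫⁻ z : Fin n → ℂ, I (z ∘ σ) * Φ (z ∘ σ) = ∫⁻ z in sortedConfigurations n, Φ z := by
    rw [(measurePreserving_comp_perm σ).lintegral_comp (f := fun z => I z * Φ z) (mI.mul hΦ),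
      ← lintegral_indicator measurableSet_sortedConfigurations]
    refine lintegral_congr fun z => ?_
    by_cases hz : z ∈ sortedConfigurations n <;> simp [hI, hz]
  calc ∫⁻ z, Φ z = ∫⁻ z : Fin n → ℂ, ∑ σ : Equiv.Perm (Fin n), I (z ∘ σ) * Φ (z ∘ σ) := by
        refine lintegral_congr_ae ?_
        filter_upwards [ae_injective_re] with z hz
        simp_rw [hs]
        rw [← Finset.sum_mul, sum_indicator_sorted hz, one_mul]
    _ = ∑ σ : Equiv.Perm (Fin n), ∫⁻ z : Fin n → ℂ, I (z ∘ σ) * Φ (z ∘ σ) :=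
        lintegral_finsetSum _ fun σ _ =>
          (mI.mul hΦ).comp (measurePreserving_comp_perm σ).measurable
    _ = n.factorial * ∫⁻ z in sortedConfigurations n, Φ z := by
        simp only [hterm, Finset.sum_const, Finset.card_univ, Fintype.card_perm,
          Fintype.card_fin, nsmul_eq_mul]

theorem lintegral_vandermondeSq_mul {g : (Fin n → ℂ) → ENNReal} (hg : Measurable g) :
    ∫⁻ z, ENNReal.ofReal (vandermondeSq z) * g (rootCoeffs z) = n.factorial * ∫⁻ c, g c := by
  rw [lintegral_eq_factorial_mul_setLIntegral_sorted, setLIntegral_sortedConfigurations]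
  · fun_prop
  · intro z σ
    rw [vandermondeSq_comp_perm, rootCoeffs_comp_perm]

end RootCoeffs

section UnorderedLaw

variable {n : ℕ}

theorem exists_measurable_rightInverse_rootCoeffs (n : ℕ) :
    ∃ r : (Fin n → ℂ) → (Fin n → ℂ), Measurable r ∧
      ∀ z ∈ sortedConfigurations n, r (rootCoeffs z) = z := by
  have h := (differentiable_rootCoeffs (n := n)).continuous.continuousOn.measurableEmbedding
    measurableSet_sortedConfigurations injOn_rootCoeffs
  obtain ⟨r, hr, hrz⟩ := h.exists_measurable_extend
    (g := ((↑) : sortedConfigurations n → (Fin n → ℂ))) measurable_subtype_coe fun _ => ⟨0⟩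
  exact ⟨r, hr, fun z hz => congrFun hrz ⟨z, hz⟩⟩

/-- A measurable choice of the roots of a monic polynomial, ordered by increasing real part when
the real parts are distinct; the value is arbitrary otherwise. -/
def sortedRoots : (Fin n → ℂ) → Fin n → ℂ :=
  (exists_measurable_rightInverse_rootCoeffs n).choose

@[fun_prop]
theorem measurable_sortedRoots : Measurable (sortedRoots (n := n)) :=
  (exists_measurable_rightInverse_rootCoeffs n).choose_spec.1

theorem sortedRoots_rootCoeffs {z : Fin n → ℂ} (hz : z ∈ sortedConfigurations n) :
    sortedRoots (rootCoeffs z) = z :=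
  (exists_measurable_rightInverse_rootCoeffs n).choose_spec.2 z hz

theorem rootCoeffs_sortedRoots {c : Fin n → ℂ}
    (hc : c ∉ rootCoeffs '' degenerateConfigurations n) : rootCoeffs (sortedRoots c) = c := by
  obtain ⟨z, hz, rfl⟩ := exists_sorted_rootCoeffs_eq hc
  rw [sortedRoots_rootCoeffs hz]

theorem apply_sortedRoots_rootCoeffs {α : Type*} {Φ : (Fin n → ℂ) → α}
    (hΦ : ∀ z (σ : Equiv.Perm (Fin n)), Φ (z ∘ σ) = Φ z) {z : Fin n → ℂ}
    (hz : Function.Injective fun j => (z j).re) : Φ (sortedRoots (rootCoeffs z)) = Φ z := by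
  obtain ⟨σ, hσ, -⟩ := existsUnique_perm_sorted hz
  rw [← rootCoeffs_comp_perm z σ, sortedRoots_rootCoeffs hσ, hΦ]

variable {Ω Ω' : Type*} [MeasurableSpace Ω] [MeasurableSpace Ω'] {P : Measure Ω} {Q : Measure Ω'}
  {z : Ω → Fin n → ℂ} {w : Ω' → Fin n → ℂ}

theorem unorderedLaw_apply (hz : AEMeasurable z P) {A : Set (Fin n → ℂ)} (hA : MeasurableSet A) :
    unorderedLaw P z A = (n.factorial : ENNReal)⁻¹ *
      ∫⁻ ω, ∑ σ : Equiv.Perm (Fin n), A.indicator 1 (z ω ∘ σ) ∂P := by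
  have hzσ (σ : Equiv.Perm (Fin n)) : AEMeasurable (fun ω => z ω ∘ σ) P :=
    (measurePreserving_comp_perm σ).measurable.comp_aemeasurable hz
  rw [unorderedLaw, Measure.smul_apply, Measure.finsetSum_apply, smul_eq_mul]
  refine congrArg _ (Eq.trans ?_ (lintegral_finsetSum' _ fun σ _ =>
    (measurable_one.indicator hA).comp_aemeasurable (hzσ σ)).symm)
  refine Finset.sum_congr rfl fun σ _ => ?_
  rw [← lintegral_indicator_one hA]
  exact lintegral_map' (measurable_one.indicator hA).aemeasurable (hzσ σ)

theorem ae_of_ae_unorderedLaw (hz : AEMeasurable z P) {p : (Fin n → ℂ) → Prop}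
    (h : ∀ᵐ w ∂unorderedLaw P z, p w) : ∀ᵐ ω ∂P, p (z ω) := by
  refine ae_of_ae_map hz ?_
  rw [ae_iff, unorderedLaw, Measure.smul_apply, smul_eq_mul, mul_eq_zero, or_iff_right
    (ENNReal.inv_ne_zero.2 (ENNReal.natCast_ne_top _)), Measure.finsetSum_apply,
    Finset.sum_eq_zero_iff] at h
  exact h 1 (Finset.mem_univ _)

theorem lintegral_comp_eq_lintegral_map_rootCoeffs (hz : AEMeasurable z P)
    (hzi : ∀ᵐ ω ∂P, Function.Injective fun j => (z ω j).re) {Φ : (Fin n → ℂ) → ENNReal}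
    (hΦ : Measurable Φ) (hs : ∀ z (σ : Equiv.Perm (Fin n)), Φ (z ∘ σ) = Φ z) :
    ∫⁻ ω, Φ (z ω) ∂P = ∫⁻ c, Φ (sortedRoots c) ∂(P.map fun ω => rootCoeffs (z ω)) := by
  refine Eq.trans (lintegral_congr_ae ?_) (lintegral_map'
    (hΦ.comp measurable_sortedRoots).aemeasurable
    (measurable_rootCoeffs.comp_aemeasurable hz)).symm
  filter_upwards [hzi] with ω hω
  exact (apply_sortedRoots_rootCoeffs hs hω).symm

theorem unorderedLaw_congr (hz : AEMeasurable z P) (hw : AEMeasurable w Q)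
    (hzi : ∀ᵐ ω ∂P, Function.Injective fun j => (z ω j).re)
    (hwi : ∀ᵐ ω ∂Q, Function.Injective fun j => (w ω j).re)
    (h : P.map (fun ω => rootCoeffs (z ω)) = Q.map fun ω => rootCoeffs (w ω)) :
    unorderedLaw P z = unorderedLaw Q w := by
  ext A hA
  let N : (Fin n → ℂ) → ENNReal := fun z => ∑ σ : Equiv.Perm (Fin n), A.indicator 1 (z ∘ σ)
  have mN : Measurable N := Finset.measurable_sum _ fun σ _ =>
    (measurable_one.indicator hA).comp (measurePreserving_comp_perm σ).measurable
  have hN (z : Fin n → ℂ) (τ : Equiv.Perm (Fin n)) : N (z ∘ τ) = N z :=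
    Equiv.sum_comp (Equiv.mulLeft τ) fun σ : Equiv.Perm (Fin n) => A.indicator 1 (z ∘ σ)
  rw [unorderedLaw_apply hz hA, unorderedLaw_apply hw hA,
    lintegral_comp_eq_lintegral_map_rootCoeffs hz hzi mN hN,
    lintegral_comp_eq_lintegral_map_rootCoeffs hw hwi mN hN, h]

theorem unorderedLaw_withDensity_id {Φ : (Fin n → ℂ) → ENNReal} (hΦ : Measurable Φ)
    (hs : ∀ z (σ : Equiv.Perm (Fin n)), Φ (z ∘ σ) = Φ z) :
    unorderedLaw (volume.withDensity Φ) id = volume.withDensity Φ := by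
  have hinv (σ : Equiv.Perm (Fin n)) :
      (volume.withDensity Φ).map (fun z => z ∘ σ) = volume.withDensity Φ := by
    have hσ : MeasurePreserving (fun z : Fin n → ℂ => z ∘ σ) := measurePreserving_comp_perm σ
    ext A hA
    rw [Measure.map_apply hσ.measurable hA, withDensity_apply _ (hσ.measurable hA),
      withDensity_apply _ hA, ← hσ.setLIntegral_comp_preimage hA hΦ]
    simp_rw [hs]
  change (n.factorial : ENNReal)⁻¹ •
    ∑ σ : Equiv.Perm (Fin n), (volume.withDensity Φ).map (fun z => z ∘ σ) = _
  simp only [hinv, Finset.sum_const, Finset.card_univ, Fintype.card_perm, Fintype.card_fin]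
  rw [← Nat.cast_smul_eq_nsmul ENNReal, smul_smul, ENNReal.inv_mul_cancel, one_smul]
  · exact_mod_cast n.factorial_ne_zero
  · exact ENNReal.natCast_ne_top _

end UnorderedLaw

section CoordinateChange

theorem lintegral_pi_complex {ι : Type*} [Fintype ι] {f : (ι → ℂ) → ENNReal}
    (hf : Measurable f) :
    ∫⁻ c, f c = ∫⁻ p : ι → ℝ, ∫⁻ q : ι → ℝ, f fun i => p i + q i * Complex.I := by
  have h := (volume_preserving_pi fun _ : ι => Complex.volume_preserving_equiv_real_prod.symm).comp
    (volume_measurePreserving_arrowProdEquivProdArrow ℝ ℝ ι).symm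
  rw [← h.lintegral_comp hf, Measure.volume_eq_prod]
  simp only [← Complex.mk_eq_add_mul_I]
  exact lintegral_prod _ (hf.comp h.measurable).aemeasurable

theorem quasiMeasurePreserving_of_lintegral {α β : Type*} [MeasurableSpace α] [MeasurableSpace β]
    {μ : Measure α} {ν : Measure β} {T : α → β} (hT : Measurable T) {w : α → ENNReal}
    (hw : Measurable w) (hw0 : ∀ᵐ x ∂μ, w x ≠ 0) {c : ENNReal}
    (h : ∀ f : β → ENNReal, Measurable f → ∫⁻ x, w x * f (T x) ∂μ = c * ∫⁻ y, f y ∂ν) :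
    Measure.QuasiMeasurePreserving T μ ν := by
  refine ⟨hT, Measure.AbsolutelyContinuous.mk fun A hA hνA => ?_⟩
  have hfA : Measurable (A.indicator (1 : β → ENNReal)) := measurable_one.indicator hA
  have hint := h _ hfA
  rw [lintegral_indicator_one hA, hνA, mul_zero, lintegral_eq_zero_iff (by fun_prop)] at hint
  rw [Measure.map_apply hT hA]
  refine measure_eq_zero_iff_ae_notMem.2 ?_
  filter_upwards [hint, hw0] with x hx hx0 hxA
  exact hx0 (by simpa [Set.indicator_of_mem (Set.mem_preimage.1 hxA)] using hx)

theorem vandermondeSq_pos {n : ℕ} {z : Fin n → ℂ} (hz : Function.Injective fun j => (z j).re) :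
    0 < vandermondeSq z :=
  Finset.prod_pos fun _ _ => Finset.prod_pos fun _ hk => pow_pos (norm_pos_iff.2 <|
    sub_ne_zero.2 fun h => (Finset.mem_Ioi.1 hk).ne (hz (congrArg Complex.re h))) 2

theorem quasiMeasurePreserving_rootCoeffs (n : ℕ) :
    Measure.QuasiMeasurePreserving (rootCoeffs : (Fin n → ℂ) → Fin n → ℂ) :=
  quasiMeasurePreserving_of_lintegral measurable_rootCoeffs
    measurable_vandermondeSq.ennreal_ofReal
    (ae_injective_re.mono fun _ hz => (ENNReal.ofReal_pos.2 (vandermondeSq_pos hz)).ne')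
    fun _ hg => lintegral_vandermondeSq_mul hg

variable {d : ℕ}

theorem lintegral_perturbedCoeffs_of_fst {p : Fin (d + 1) → ℝ} (hp : p 0 ≠ 0)
    {f : (Fin (d + 1) → ℂ) → ENNReal} (hf : Measurable f) :
    ∫⁻ q : Fin (d + 1) → ℝ, f (fun i => p i + q i * Complex.I) =
      ∫⁻ l : ℝ, ∫⁻ q : Fin d → ℝ, ENNReal.ofReal (|p 0| * |l| ^ d) *
        f (perturbedCoeffs l (p, q)) := by
  rw [← measurePreserving_cons.lintegral_comp (by fun_prop), Measure.volume_eq_prod,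
    lintegral_prod _ (by fun_prop), lintegral_eq_ofReal_mul_lintegral_smul volume hp,
    Module.finrank_self, pow_one, ← lintegral_const_mul _ (by fun_prop)]
  refine lintegral_congr_ae ?_
  filter_upwards [Measure.ae_ne volume (0 : ℝ)] with l hl
  rw [lintegral_eq_ofReal_mul_lintegral_smul volume hl, Module.finrank_fin_fun,
    ← lintegral_sub_left_eq_self _ (Fin.tail p), ← mul_assoc,
    ← ENNReal.ofReal_mul (abs_nonneg _), ← lintegral_const_mul _ (by fun_prop)]
  refine lintegral_congr fun q => congrArg _ (congrArg f (funext fun i => ?_))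
  cases i using Fin.cases <;> simp [perturbedCoeffs, Fin.tail] <;> ring

theorem ae_fst_zero_ne_zero : ∀ᵐ x : VecPair d, x.1 0 ≠ 0 :=
  Measure.quasiMeasurePreserving_fst.ae <|
    (Measure.quasiMeasurePreserving_eval (fun _ : Fin (d + 1) => (volume : Measure ℝ)) 0).ae
      (Measure.ae_ne volume (0 : ℝ))

theorem lintegral_perturbedCoeffs {f : (Fin (d + 1) → ℂ) → ENNReal} (hf : Measurable f) :
    ∫⁻ c, f c = ∫⁻ y : ℝ × VecPair d, ENNReal.ofReal (|y.2.1 0| * |y.1| ^ d) *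
      f (perturbedCoeffs y.1 y.2) := by
  have hne : ∀ᵐ p : Fin (d + 1) → ℝ, p 0 ≠ 0 :=
    (Measure.quasiMeasurePreserving_eval (fun _ : Fin (d + 1) => (volume : Measure ℝ)) 0).ae
      (Measure.ae_ne volume (0 : ℝ))
  calc
    ∫⁻ c, f c = ∫⁻ p : Fin (d + 1) → ℝ, ∫⁻ l : ℝ, ∫⁻ q : Fin d → ℝ,
        ENNReal.ofReal (|p 0| * |l| ^ d) * f (perturbedCoeffs l (p, q)) := by
      rw [lintegral_pi_complex hf]
      exact lintegral_congr_ae (hne.mono fun p hp => lintegral_perturbedCoeffs_of_fst hp hf)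
    _ = ∫⁻ l : ℝ, ∫⁻ p : Fin (d + 1) → ℝ, ∫⁻ q : Fin d → ℝ,
        ENNReal.ofReal (|p 0| * |l| ^ d) * f (perturbedCoeffs l (p, q)) :=
      lintegral_lintegral_swap (Measurable.lintegral_prod_right' (f := fun a :
        ((Fin (d + 1) → ℝ) × ℝ) × (Fin d → ℝ) => ENNReal.ofReal (|a.1.1 0| * |a.1.2| ^ d) *
          f (perturbedCoeffs a.1.2 (a.1.1, a.2))) (by fun_prop)).aemeasurable
    _ = ∫⁻ l : ℝ, ∫⁻ x : VecPair d, ENNReal.ofReal (|x.1 0| * |l| ^ d) *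
        f (perturbedCoeffs l x) :=
      lintegral_congr fun l => (lintegral_prod (fun x : VecPair d =>
        ENNReal.ofReal (|x.1 0| * |l| ^ d) * f (perturbedCoeffs l x)) (by fun_prop)).symm
    _ = _ := (lintegral_prod (fun y : ℝ × VecPair d =>
        ENNReal.ofReal (|y.2.1 0| * |y.1| ^ d) * f (perturbedCoeffs y.1 y.2)) (by fun_prop)).symm

theorem setLIntegral_coeffsRegion_eq {g : (Fin (d + 1) → ℂ) → ENNReal} (hg : Measurable g) :
    ∫⁻ c in coeffsRegion d, g c = ∫⁻ y in Set.Ioi (0 : ℝ) ×ˢ stieltjesRegion d,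
      ENNReal.ofReal (|y.2.1 0| * y.1 ^ d) * g (perturbedCoeffs y.1 y.2) := by
  have hl : ∀ᵐ y : ℝ × VecPair d, y.1 ≠ 0 :=
    Measure.quasiMeasurePreserving_fst.ae (Measure.ae_ne volume (0 : ℝ))
  have hx : ∀ᵐ y : ℝ × VecPair d, y.2.1 0 ≠ 0 :=
    Measure.quasiMeasurePreserving_snd.ae ae_fst_zero_ne_zero
  rw [← lintegral_indicator measurableSet_coeffsRegion,
    lintegral_perturbedCoeffs (hg.indicator measurableSet_coeffsRegion),
    ← lintegral_indicator (measurableSet_Ioi.prod (measurableSet_stieltjesRegion d))]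
  refine lintegral_congr_ae ?_
  filter_upwards [hl, hx] with y hl hx
  have hiff := perturbedCoeffs_mem hx hl
  by_cases hy : y ∈ Set.Ioi (0 : ℝ) ×ˢ stieltjesRegion d
  · rw [Set.indicator_of_mem hy, Set.indicator_of_mem (hiff.2 hy), abs_of_pos (Set.mem_Ioi.1 hy.1)]
  · rw [Set.indicator_of_notMem hy, Set.indicator_of_notMem (mt hiff.1 hy), mul_zero]

/-- The parameter space of `coeffsMap`: a positive perturbation parameter together with positive
continued fraction parameters. -/
def parameterSpace (d : ℕ) : Set (ℝ × VecPair d) := Set.Ioi 0 ×ˢ positiveOrthant d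

/-- The coefficients of `P - i l (X Q - P)` in terms of `l` and of the continued fraction parameters
of the Stieltjes pair `(P, Q)`. -/
def coeffsMap (y : ℝ × VecPair d) : Fin (d + 1) → ℂ := perturbedCoeffs y.1 (stieltjesMap d y.2)

/-- The Jacobian of `coeffsMap` on the parameter space. -/
def coeffsJacobian (y : ℝ × VecPair d) : ℝ :=
  stieltjesJacobian d y.2 * (|(stieltjesMap d y.2).1 0| * y.1 ^ d)

theorem measurableSet_parameterSpace (d : ℕ) : MeasurableSet (parameterSpace d) :=
  measurableSet_Ioi.prod (measurableSet_positiveOrthant d)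

@[fun_prop]
theorem measurable_coeffsMap : Measurable (coeffsMap (d := d)) := by
  unfold coeffsMap
  fun_prop

@[fun_prop]
theorem measurable_coeffsJacobian : Measurable (coeffsJacobian (d := d)) := by
  unfold coeffsJacobian
  fun_prop

theorem coeffsJacobian_pos {y : ℝ × VecPair d} (hy : y ∈ parameterSpace d) :
    0 < coeffsJacobian y :=
  mul_pos (stieltjesJacobian_pos hy.2) (mul_pos (abs_pos.2
    (fst_zero_ne_zero (stieltjesMap_mem_stieltjesRegion hy.2))) (pow_pos hy.1 d))

theorem coeffsL_coeffsMap {y : ℝ × VecPair d} (hy : y ∈ parameterSpace d) :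
    coeffsL (coeffsMap y) = y.1 :=
  coeffsL_perturbedCoeffs (fst_zero_ne_zero (stieltjesMap_mem_stieltjesRegion hy.2))

theorem coeffsMap_mem_coeffsRegion {y : ℝ × VecPair d} (hy : y ∈ parameterSpace d) :
    coeffsMap y ∈ coeffsRegion d :=
  have hS := stieltjesMap_mem_stieltjesRegion hy.2
  (perturbedCoeffs_mem (fst_zero_ne_zero hS) (ne_of_gt hy.1)).2 ⟨hy.1, hS⟩

theorem setLIntegral_coeffsRegion {g : (Fin (d + 1) → ℂ) → ENNReal} (hg : Measurable g) :
    ∫⁻ c in coeffsRegion d, g c = ∫⁻ y in parameterSpace d,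
      ENNReal.ofReal (coeffsJacobian y) * g (coeffsMap y) := by
  rw [setLIntegral_coeffsRegion_eq hg, parameterSpace, Measure.volume_eq_prod,
    setLIntegral_prod _ (by fun_prop), setLIntegral_prod _ (by fun_prop)]
  refine lintegral_congr fun l => ?_
  rw [setLIntegral_stieltjesRegion (by fun_prop)]
  refine setLIntegral_congr_fun (measurableSet_positiveOrthant d) fun x hx => ?_
  rw [coeffsJacobian, ENNReal.ofReal_mul (stieltjesJacobian_pos hx).le, mul_assoc]
  rfl

theorem quasiMeasurePreserving_coeffsMap (d : ℕ) : Measure.QuasiMeasurePreserving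
    (coeffsMap (d := d)) (volume.restrict (parameterSpace d)) (volume.restrict (coeffsRegion d)) :=
  quasiMeasurePreserving_of_lintegral measurable_coeffsMap
    measurable_coeffsJacobian.ennreal_ofReal
    ((ae_restrict_mem (measurableSet_parameterSpace d)).mono fun _ hy =>
      (ENNReal.ofReal_pos.2 (coeffsJacobian_pos hy)).ne')
    fun _ hg => by rw [one_mul, setLIntegral_coeffsRegion hg]

theorem acuteConfigurations_eq_preimage :
    acuteConfigurations (d + 1) = rootCoeffs ⁻¹' coeffsRegion d :=
  Set.ext fun _ =>
    ⟨mem_coeffsRegion_of_mem_acuteConfigurations, mem_acuteConfigurations_of_mem_coeffsRegion⟩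

theorem measurableSet_acuteConfigurations : MeasurableSet (acuteConfigurations (d + 1)) :=
  acuteConfigurations_eq_preimage ▸ measurable_rootCoeffs measurableSet_coeffsRegion

theorem ae_coeffsL_notMem {N : Set ℝ} (hN : volume N = 0) :
    ∀ᵐ c ∂volume.restrict (coeffsRegion d), coeffsL c ∉ N := by
  have hT : MeasurableSet (coeffsL (d := d) ⁻¹' toMeasurable volume N) :=
    measurable_coeffsL (measurableSet_toMeasurable _ _)
  have hae : ∀ᵐ y : ℝ × VecPair d, y.1 ∉ toMeasurable volume N :=
    Measure.quasiMeasurePreserving_fst.ae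
      (measure_eq_zero_iff_ae_notMem.1 (by rwa [measure_toMeasurable]))
  have hzero : volume.restrict (coeffsRegion d) (coeffsL ⁻¹' toMeasurable volume N) = 0 := by
    rw [← lintegral_indicator_one hT, setLIntegral_coeffsRegion (measurable_one.indicator hT)]
    refine lintegral_eq_zero_of_ae_eq_zero ?_
    filter_upwards [ae_restrict_of_ae hae, ae_restrict_mem (measurableSet_parameterSpace d)]
      with y hy hmem
    rw [Set.indicator_of_notMem (by rwa [Set.mem_preimage, coeffsL_coeffsMap hmem]), mul_zero,
      Pi.zero_apply]
  filter_upwards [measure_eq_zero_iff_ae_notMem.1 hzero] with c hc hcN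
  exact hc (subset_toMeasurable _ _ hcN)

theorem ae_tan_sum_arg_notMem {N : Set ℝ} (hN : volume N = 0) :
    ∀ᵐ z ∂volume.restrict (acuteConfigurations (d + 1)), Real.tan (∑ j, (z j).arg) ∉ N := by
  have h := (ae_restrict_iff' measurableSet_coeffsRegion).1 (ae_coeffsL_notMem (d := d) hN)
  rw [ae_restrict_iff' measurableSet_acuteConfigurations]
  filter_upwards [(quasiMeasurePreserving_rootCoeffs (d + 1)).ae h] with z hz hza
  rw [← coeffsL_rootCoeffs hza.1]
  exact hz (mem_coeffsRegion_of_mem_acuteConfigurations hza)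

end CoordinateChange

/-! ### Characteristic polynomials of Jacobi matrices -/

section Determinants

variable {R : Type*} [CommRing R] {d : ℕ}

theorem det_tridiagonal_corner (M : Matrix (Fin (d + 2)) (Fin (d + 2)) R)
    (hrow : ∀ j : Fin d, M 0 j.succ.succ = 0) (hcol : ∀ i : Fin d, M i.succ.succ 0 = 0) :
    M.det = M 0 0 * (M.submatrix Fin.succ Fin.succ).det -
      M 0 1 * M 1 0 * ((M.submatrix Fin.succ Fin.succ).submatrix Fin.succ Fin.succ).det := by
  have hsucc : Fin.succAbove (1 : Fin (d + 2)) ∘ Fin.succ = Fin.succ ∘ Fin.succ := by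
    ext j : 1
    rw [← Fin.succ_zero_eq_one]
    exact Fin.succ_succAbove_succ 0 j
  have hminor : (M.submatrix Fin.succ (Fin.succAbove 1)).det =
      M 1 0 * ((M.submatrix Fin.succ Fin.succ).submatrix Fin.succ Fin.succ).det := by
    rw [Matrix.det_succ_column_zero, Fin.sum_univ_succ]
    simp [hcol, hsucc]
  rw [Matrix.det_succ_row_zero, Fin.sum_univ_succ, Fin.sum_univ_succ]
  simp [hrow, hminor]
  ring

theorem det_update_corner (M N : Matrix (Fin (d + 1)) (Fin (d + 1)) R) (a b : R)
    (hsucc : ∀ (i : Fin d) j, N i.succ j = M i.succ j) (hzero : N 0 0 = a * M 0 0 + b)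
    (hrow : ∀ j : Fin d, N 0 j.succ = a * M 0 j.succ) :
    N.det = a * M.det + b * (M.submatrix Fin.succ Fin.succ).det := by
  have hminor (f : Fin d → Fin (d + 1)) : N.submatrix Fin.succ f = M.submatrix Fin.succ f :=
    Matrix.ext fun i j => hsucc i (f j)
  rw [Matrix.det_succ_row_zero N, Matrix.det_succ_row_zero M, Fin.sum_univ_succ, Fin.sum_univ_succ]
  simp only [hminor, hzero, hrow, Fin.succAbove_zero, Fin.val_zero, pow_zero, one_mul, mul_add,
    Finset.mul_sum, add_mul, mul_left_comm _ a, mul_assoc a]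
  rw [add_right_comm]

theorem det_submatrix_charmatrix (A : Matrix (Fin (d + 1)) (Fin (d + 1)) R) :
    (A.charmatrix.submatrix Fin.succ Fin.succ).det = (A.submatrix Fin.succ Fin.succ).charpoly := by
  rw [Matrix.charpoly]
  congr 1
  ext i j : 2
  simp only [Matrix.submatrix_apply, Matrix.charmatrix_apply, Matrix.diagonal_apply, Fin.succ_inj]

end Determinants

section Gram

variable {d : ℕ}

/-- The Jacobi matrix `Bᵀ B`, where `B` is bidiagonal with coefficients `x`. -/
def gram (x : VecPair d) : Matrix (Fin (d + 1)) (Fin (d + 1)) ℝ :=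
  (bidiagonal x.1 x.2).transpose * bidiagonal x.1 x.2

theorem bidiagonal_succ_succ (x : VecPair (d + 1)) (i j : Fin (d + 1)) :
    bidiagonal x.1 x.2 i.succ j.succ = bidiagonal (Fin.tail x.1) (Fin.tail x.2) i j := by
  simp only [bidiagonal, Matrix.of_apply, Fin.succ_inj, Fin.val_succ, Nat.add_right_cancel_iff]
  split_ifs <;> rfl

theorem bidiagonal_succ_zero (x : VecPair (d + 1)) (i : Fin (d + 1)) :
    bidiagonal x.1 x.2 i.succ 0 = 0 := by
  simp [bidiagonal]

theorem bidiagonal_zero_zero (x : VecPair d) : bidiagonal x.1 x.2 0 0 = x.1 0 := by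
  simp [bidiagonal]

theorem bidiagonal_zero_one (x : VecPair (d + 1)) : bidiagonal x.1 x.2 0 1 = x.2 0 := by
  simp [bidiagonal]

theorem bidiagonal_zero_succ_succ (x : VecPair (d + 1)) (j : Fin d) :
    bidiagonal x.1 x.2 0 j.succ.succ = 0 := by
  simp only [bidiagonal, Matrix.of_apply]
  rw [if_neg (Fin.succ_ne_zero _).symm, dif_neg (by simp)]

theorem gram_zero_left (x : VecPair (d + 1)) (j : Fin (d + 2)) :
    gram x 0 j = x.1 0 * bidiagonal x.1 x.2 0 j := by
  rw [gram, Matrix.mul_apply, Fin.sum_univ_succ]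
  simp only [Matrix.transpose_apply, bidiagonal_succ_zero, zero_mul, Finset.sum_const_zero,
    add_zero, bidiagonal_zero_zero]

theorem gram_comm (x : VecPair d) (i j : Fin (d + 1)) : gram x i j = gram x j i := by
  simp only [gram, Matrix.mul_apply, Matrix.transpose_apply, mul_comm]

theorem gram_succ_succ (x : VecPair (d + 1)) (i j : Fin (d + 1)) :
    gram x i.succ j.succ = bidiagonal x.1 x.2 0 i.succ * bidiagonal x.1 x.2 0 j.succ +
      gram (Fin.tail x.1, Fin.tail x.2) i j := by
  simp only [gram]
  rw [Matrix.mul_apply, Fin.sum_univ_succ, Matrix.mul_apply]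
  simp only [Matrix.transpose_apply, bidiagonal_succ_succ]

theorem submatrix_submatrix_gram (x : VecPair (d + 1)) :
    ((gram x).submatrix Fin.succ Fin.succ).submatrix Fin.succ Fin.succ =
      (gram (Fin.tail x.1, Fin.tail x.2)).submatrix Fin.succ Fin.succ := by
  ext i j
  simp only [Matrix.submatrix_apply]
  rw [gram_succ_succ, bidiagonal_zero_succ_succ, zero_mul, zero_add]

theorem charpoly_submatrix_gram (x : VecPair (d + 1)) :
    ((gram x).submatrix Fin.succ Fin.succ).charpoly =
      (gram (Fin.tail x.1, Fin.tail x.2)).charpoly - C (x.2 0 ^ 2) *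
        ((gram (Fin.tail x.1, Fin.tail x.2)).submatrix Fin.succ Fin.succ).charpoly := by
  set G := gram (Fin.tail x.1, Fin.tail x.2)
  rw [Matrix.charpoly, det_update_corner G.charmatrix _ 1 (-C (x.2 0 ^ 2)),
    det_submatrix_charmatrix, ← Matrix.charpoly, one_mul, neg_mul, sub_eq_add_neg]
  · intro i j
    have : gram x i.succ.succ j.succ = G i.succ j := by
      rw [gram_succ_succ, bidiagonal_zero_succ_succ, zero_mul, zero_add]
    simp only [Matrix.charmatrix_apply, Matrix.submatrix_apply, this]
  · have : gram x (Fin.succ 0) (Fin.succ 0) = x.2 0 * x.2 0 + G 0 0 := by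
      rw [gram_succ_succ, Fin.succ_zero_eq_one, bidiagonal_zero_one]
    simp only [Matrix.charmatrix_apply_eq, Matrix.submatrix_apply, this, C_add, sq]
    ring
  · intro j
    have : gram x (Fin.succ 0) j.succ.succ = G 0 j.succ := by
      rw [gram_succ_succ, bidiagonal_zero_succ_succ, mul_zero, zero_add]
    simp only [Matrix.charmatrix_apply, Matrix.submatrix_apply, this, one_mul]

theorem charpoly_gram_succ (x : VecPair (d + 1)) :
    (gram x).charpoly = X * ((gram x).submatrix Fin.succ Fin.succ).charpoly -
      C (x.1 0 ^ 2) * (gram (Fin.tail x.1, Fin.tail x.2)).charpoly := by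
  have hrow (j : Fin d) : gram x 0 j.succ.succ = 0 := by
    rw [gram_zero_left, bidiagonal_zero_succ_succ, mul_zero]
  have h00 : gram x 0 0 = x.1 0 ^ 2 := by rw [gram_zero_left, bidiagonal_zero_zero, sq]
  have h01 : gram x 0 1 = x.1 0 * x.2 0 := by rw [gram_zero_left, bidiagonal_zero_one]
  have hminor : ((gram x).charmatrix.submatrix Fin.succ Fin.succ).submatrix Fin.succ Fin.succ =
      ((gram x).submatrix Fin.succ Fin.succ).charmatrix.submatrix Fin.succ Fin.succ := by
    ext i j : 2
    simp only [Matrix.submatrix_apply, Matrix.charmatrix_apply, Matrix.diagonal_apply,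
      Fin.succ_inj]
  rw [Matrix.charpoly, det_tridiagonal_corner, hminor, det_submatrix_charmatrix,
    det_submatrix_charmatrix, submatrix_submatrix_gram, charpoly_submatrix_gram,
    Matrix.charmatrix_apply_eq, Matrix.charmatrix_apply_ne _ _ _ (by simp),
    Matrix.charmatrix_apply_ne _ _ _ (by simp), gram_comm x 1 0, h00, h01]
  · simp only [C_mul, C_pow]
    ring
  · intro j
    rw [Matrix.charmatrix_apply_ne _ _ _ (Fin.succ_ne_zero _).symm, hrow, C_0, neg_zero]
  · intro j
    rw [Matrix.charmatrix_apply_ne _ _ _ (Fin.succ_ne_zero _), gram_comm, hrow, C_0, neg_zero]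

theorem charpoly_gram_zero (x : VecPair 0) : (gram x).charpoly = X - C (x.1 0 ^ 2) := by
  rw [Matrix.charpoly, Matrix.det_fin_one, Matrix.charmatrix_apply_eq]
  simp [gram, Matrix.mul_apply, bidiagonal, sq]

theorem charpoly_gram_and_submatrix : ∀ {d : ℕ} (x : VecPair d),
    (gram x).charpoly = monicOf (stieltjesMap d (x ^ 2)).1 ∧
      ((gram x).submatrix Fin.succ Fin.succ).charpoly = monicOf (stieltjesMap d (x ^ 2)).2
  | 0, x => by
    refine ⟨?_, by simp [Matrix.charpoly, monicOf]⟩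
    rw [charpoly_gram_zero]
    simp [monicOf, stieltjesMap, sub_eq_add_neg]
  | d + 1, x => by
    obtain ⟨hP, hQ⟩ := charpoly_gram_and_submatrix (Fin.tail x.1, Fin.tail x.2)
    have hQ' := charpoly_submatrix_gram x
    have hP' := charpoly_gram_succ x
    rw [hQ', hP, hQ] at hP'
    rw [hP, hQ] at hQ'
    exact ⟨hP'.trans (monicOf_stieltjesStep_fst _ _ _).symm,
      hQ'.trans (monicOf_stieltjesStep_snd _ _ _).symm⟩

end Gram

section CharCoeffs

variable {d : ℕ}

theorem perturbed_apply (l : ℝ) (J : Matrix (Fin (d + 1)) (Fin (d + 1)) ℝ) (i j : Fin (d + 1)) :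
    perturbed l J i j = (J i j : ℂ) + if i = 0 then Complex.I * l * J 0 j else 0 := by
  rw [perturbed, add_mul, one_mul, Matrix.add_apply, Matrix.map_apply, Matrix.mul_apply,
    Finset.sum_eq_single 0 (fun k _ hk => by simp [hk, e₁, Matrix.vecMulVec_apply]) (by simp)]
  by_cases hi : i = 0 <;> simp [hi, e₁, Matrix.vecMulVec_apply]

theorem charpoly_perturbed (l : ℝ) (J : Matrix (Fin (d + 1)) (Fin (d + 1)) ℝ) :
    (perturbed l J).charpoly = J.charpoly.map (algebraMap ℝ ℂ) - C (Complex.I * l) *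
      (X * (J.submatrix Fin.succ Fin.succ).charpoly - J.charpoly).map (algebraMap ℝ ℂ) := by
  rw [Matrix.charpoly, det_update_corner (J.map (algebraMap ℝ ℂ)).charmatrix _
    (1 + C (Complex.I * l)) (-(C (Complex.I * l) * X)), ← Matrix.charpoly, Matrix.charpoly_map,
    det_submatrix_charmatrix, Matrix.submatrix_map, Matrix.charpoly_map, Polynomial.map_sub,
    Polynomial.map_mul, map_X]
  · ring
  · intro i j
    simp [Matrix.charmatrix_apply, perturbed_apply]
  · simp only [Matrix.charmatrix_apply_eq, perturbed_apply, Matrix.map_apply, if_true, C_add, C_mul,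
      Complex.coe_algebraMap]
    ring
  · intro j
    rw [Matrix.charmatrix_apply_ne _ _ _ (Fin.succ_ne_zero j).symm,
      Matrix.charmatrix_apply_ne _ _ _ (Fin.succ_ne_zero j).symm]
    simp only [perturbed_apply, Matrix.map_apply, if_true, C_add, C_mul, Complex.coe_algebraMap]
    ring

/-- The non-leading coefficients of the characteristic polynomial of `(I + i l e₁ e₁*) J`. -/
def charCoeffs {n : ℕ} [NeZero n] (l : ℝ) (J : Matrix (Fin n) (Fin n) ℝ) : Fin n → ℂ :=
  fun i => (perturbed l J).charpoly.coeff i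

theorem monicOf_charCoeffs {n : ℕ} [NeZero n] (l : ℝ) (J : Matrix (Fin n) (Fin n) ℝ) :
    monicOf (charCoeffs l J) = (perturbed l J).charpoly :=
  monicOf_coeff (Matrix.charpoly_monic _) (by simp [Matrix.charpoly_natDegree_eq_dim])

theorem listsEigenvalues_perturbed_iff {n : ℕ} [NeZero n] {l : ℝ} {J : Matrix (Fin n) (Fin n) ℝ}
    {z : Fin n → ℂ} : ListsEigenvalues (perturbed l J) z ↔ rootCoeffs z = charCoeffs l J := by
  rw [rootCoeffs_eq_iff, monicOf_charCoeffs, ListsEigenvalues]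

theorem charCoeffs_gram (l : ℝ) (x : VecPair d) : charCoeffs l (gram x) = coeffsMap (l, x ^ 2) := by
  obtain ⟨hP, hQ⟩ := charpoly_gram_and_submatrix x
  refine monicOf_injective ?_
  rw [monicOf_charCoeffs, charpoly_perturbed, hP, hQ, coeffsMap, monicOf_perturbedCoeffs]

theorem measurable_charCoeffs (d : ℕ) :
    Measurable fun a : ℝ × Matrix (Fin (d + 1)) (Fin (d + 1)) ℝ => charCoeffs a.1 a.2 := by
  refine measurable_pi_lambda _ fun i => ?_
  have hperturbed (i j : Fin (d + 1)) :
      Measurable fun a : ℝ × Matrix (Fin (d + 1)) (Fin (d + 1)) ℝ => perturbed a.1 a.2 i j := by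
    simp only [perturbed_apply]
    split_ifs <;> fun_prop
  have huniv (a : ℝ × Matrix (Fin (d + 1)) (Fin (d + 1)) ℝ) : charCoeffs a.1 a.2 i =
      MvPolynomial.eval (fun ij : Fin (d + 1) × Fin (d + 1) => perturbed a.1 a.2 ij.1 ij.2)
        ((Matrix.charpoly.univ ℂ (Fin (d + 1))).coeff i) :=
    (Matrix.charpoly.univ_coeff_eval₂Hom (n := Fin (d + 1)) (RingHom.id ℂ)
      (fun ij => perturbed a.1 a.2 ij.1 ij.2) i).symm
  simp_rw [huniv]
  exact (MvPolynomial.continuous_eval _).measurable.comp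
    (measurable_pi_lambda _ fun ij => hperturbed ij.1 ij.2)

theorem measurable_gram (d : ℕ) : Measurable (gram : VecPair d → _) := by
  refine measurable_pi_lambda _ fun i => measurable_pi_lambda _ fun j => ?_
  have hentry (i j : Fin (d + 1)) : Measurable fun x : VecPair d => bidiagonal x.1 x.2 i j := by
    simp only [bidiagonal, Matrix.of_apply]
    split_ifs <;> fun_prop
  simp only [gram, Matrix.mul_apply, Matrix.transpose_apply]
  fun_prop

end CharCoeffs

/-! ### Squares of chi variables -/

section ChiLaw

/-- The density of the square of a chi variable with `k` degrees of freedom. -/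
def chiSqDensity (k t : ℝ) : ℝ :=
  2 ^ (-(k / 2)) / Real.Gamma (k / 2) * t ^ (k / 2 - 1) * Real.exp (-t / 2)

@[fun_prop]
theorem measurable_chiSqDensity (k : ℝ) : Measurable (chiSqDensity k) := by
  unfold chiSqDensity; fun_prop

theorem chiSqDensity_nonneg {k t : ℝ} (hk : 0 < k) (ht : 0 < t) : 0 ≤ chiSqDensity k t := by
  have := Real.Gamma_pos_of_pos (half_pos hk)
  unfold chiSqDensity; positivity

theorem two_mul_mul_chiSqDensity_sq (k : ℝ) {t : ℝ} (ht : 0 < t) :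
    2 * t * chiSqDensity k (t ^ 2) =
      2 ^ (1 - k / 2) / Real.Gamma (k / 2) * t ^ (k - 1) * Real.exp (-t ^ 2 / 2) := by
  have hpow : t ^ (k - 1) = (t ^ 2) ^ (k / 2 - 1) * t := by
    rw [← Real.rpow_natCast t 2, ← Real.rpow_mul ht.le, ← Real.rpow_add_one ht.ne']
    congr 1; push_cast; ring
  have htwo : (2 : ℝ) ^ (1 - k / 2) = 2 * 2 ^ (-(k / 2)) := by
    rw [sub_eq_add_neg, Real.rpow_add two_pos, Real.rpow_one]
  rw [chiSqDensity, hpow, htwo]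
  ring

theorem image_sq_Ioi : (fun t : ℝ => t ^ 2) '' Set.Ioi 0 = Set.Ioi 0 := by
  refine Set.Subset.antisymm ?_ fun t ht => ⟨√t, Real.sqrt_pos.2 ht, Real.sq_sqrt (le_of_lt ht)⟩
  rintro _ ⟨s, hs, rfl⟩
  exact pow_pos (Set.mem_Ioi.1 hs) 2

theorem map_sq_chiLaw (k : ℝ) : (chiLaw k).map (fun t => t ^ 2) =
    (volume.restrict (Set.Ioi 0)).withDensity fun t => ENNReal.ofReal (chiSqDensity k t) := by
  have hder (t : ℝ) (_ : t ∈ Set.Ioi (0 : ℝ)) :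
      HasDerivWithinAt (fun t : ℝ => t ^ 2) (2 * t) (Set.Ioi 0) t := by
    simpa using (hasDerivAt_pow 2 t).hasDerivWithinAt
  have hinj : Set.InjOn (fun t : ℝ => t ^ 2) (Set.Ioi 0) := fun a ha b hb h =>
    (pow_left_inj₀ (le_of_lt ha) (le_of_lt hb) two_ne_zero).1 h
  refine Measure.ext_of_lintegral _ fun f hf => ?_
  rw [lintegral_map hf (by fun_prop), chiLaw,
    lintegral_withDensity_eq_lintegral_mul _ (by fun_prop) (by fun_prop),
    lintegral_withDensity_eq_lintegral_mul _ (by fun_prop) hf]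
  conv_rhs => rw [← image_sq_Ioi]
  rw [lintegral_image_eq_lintegral_abs_deriv_mul measurableSet_Ioi hder hinj]
  refine setLIntegral_congr_fun measurableSet_Ioi fun t ht => ?_
  have ht0 : 0 < t := ht
  simp only [Pi.mul_apply]
  rw [← two_mul_mul_chiSqDensity_sq k ht0, ENNReal.ofReal_mul (by positivity),
    abs_of_pos (by positivity), mul_assoc]

instance sigmaFinite_withDensity_ofReal {α : Type*} [MeasurableSpace α] (μ : Measure α)
    [SigmaFinite μ] (f : α → ℝ) : SigmaFinite (μ.withDensity fun x => ENNReal.ofReal (f x)) :=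
  SigmaFinite.withDensity_of_ne_top (ae_of_all _ fun _ => ENNReal.ofReal_ne_top)

instance sigmaFinite_chiLaw (k : ℝ) : SigmaFinite (chiLaw k) :=
  sigmaFinite_withDensity_ofReal _ _

end ChiLaw

section PiWithDensity

variable {d : ℕ} {α : Fin d → Type*} [∀ i, MeasurableSpace (α i)] (μ : ∀ i, Measure (α i))
  [∀ i, SigmaFinite (μ i)] {f : ∀ i, α i → ENNReal}

theorem lintegral_pi_prod (hf : ∀ i, Measurable (f i)) :
    ∫⁻ x, ∏ i, f i (x i) ∂(Measure.pi μ) = ∏ i, ∫⁻ t, f i t ∂(μ i) := by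
  induction d with
  | zero => rw [Measure.pi_of_empty, lintegral_dirac]; simp
  | succ d ih =>
    have hcons := (measurePreserving_piFinSuccAbove μ 0).symm
    have hprod : Measurable fun x : ∀ i, α i => ∏ i, f i (x i) := by fun_prop
    have htail : Measurable fun x : ∀ i : Fin d, α i.succ => ∏ i, f i.succ (x i) := by fun_prop
    rw [← hcons.lintegral_comp hprod, Fin.prod_univ_succ,
      ← ih (fun i => μ i.succ) fun i => hf i.succ,
      ← lintegral_prod_mul (hf 0).aemeasurable htail.aemeasurable]
    simp only [MeasurableEquiv.piFinSuccAbove_symm_apply, Fin.insertNthEquiv_zero,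
      Fin.prod_univ_succ]
    rfl

theorem pi_withDensity [∀ i, SigmaFinite ((μ i).withDensity (f i))]
    (hf : ∀ i, Measurable (f i)) :
    Measure.pi (fun i => (μ i).withDensity (f i)) =
      (Measure.pi μ).withDensity fun x => ∏ i, f i (x i) := by
  refine Measure.pi_eq fun s hs => ?_
  rw [withDensity_apply _ (.univ_pi hs), Measure.restrict_pi_pi, lintegral_pi_prod _ hf]
  exact Finset.prod_congr rfl fun i _ => (withDensity_apply _ (hs i)).symm

end PiWithDensity

section CoefficientLaw

variable {d m : ℕ} {β : ℝ}

theorem map_sq_pi_chiLaw (k : Fin d → ℝ) :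
    (Measure.pi fun i => chiLaw (k i)).map (fun x => x ^ 2) =
      (volume.restrict (Set.univ.pi fun _ => Set.Ioi 0)).withDensity
        fun u => ∏ i, ENNReal.ofReal (chiSqDensity (k i) (u i)) := by
  have hsf (i : Fin d) : SigmaFinite ((chiLaw (k i)).map fun t => t ^ 2) := by
    rw [map_sq_chiLaw]; infer_instance
  have hpi := Measure.pi_map_pi (μ := fun i => chiLaw (k i)) (f := fun _ t => t ^ 2)
    fun i => by fun_prop
  simp only [map_sq_chiLaw] at hpi
  rw [volume_pi, Measure.restrict_pi_pi,
    ← pi_withDensity _ (f := fun i t => ENNReal.ofReal (chiSqDensity (k i) t))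
      fun i => by fun_prop]
  exact hpi

/-- The density of the squared coefficients of the Laguerre `β`-ensemble. -/
def squaredDensity (β : ℝ) (m : ℕ) (x : VecPair d) : ℝ :=
  (∏ i : Fin (d + 1), chiSqDensity (β * ((m : ℝ) - (i : ℕ))) (x.1 i)) *
    ∏ j : Fin d, chiSqDensity (β * (((d + 1 : ℕ) : ℝ) - ((j : ℕ) + 1))) (x.2 j)

@[fun_prop]
theorem measurable_squaredDensity : Measurable (squaredDensity β m : VecPair d → ℝ) := by
  unfold squaredDensity; fun_prop

theorem degrees_fst_pos (hβ : 0 < β) (hm : d + 1 ≤ m) (i : Fin (d + 1)) :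
    0 < β * ((m : ℝ) - (i : ℕ)) :=
  mul_pos hβ (sub_pos.2 (by exact_mod_cast i.2.trans_le hm))

theorem degrees_snd_pos (hβ : 0 < β) (j : Fin d) :
    0 < β * (((d + 1 : ℕ) : ℝ) - ((j : ℕ) + 1)) :=
  mul_pos hβ (sub_pos.2 (by exact_mod_cast Nat.succ_lt_succ j.2))

theorem squaredDensity_nonneg (hβ : 0 < β) (hm : d + 1 ≤ m) {x : VecPair d}
    (hx : x ∈ positiveOrthant d) : 0 ≤ squaredDensity β m x :=
  mul_nonneg
    (Finset.prod_nonneg fun i _ =>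
      chiSqDensity_nonneg (degrees_fst_pos hβ hm i) ((mem_positiveOrthant.1 hx).1 i))
    (Finset.prod_nonneg fun j _ =>
      chiSqDensity_nonneg (degrees_snd_pos hβ j) ((mem_positiveOrthant.1 hx).2 j))

theorem map_sq_coefficientLaw (hβ : 0 < β) (hm : d + 1 ≤ m) :
    (coefficientLaw β m (d + 1)).map (fun x : VecPair d => x ^ 2) =
      (volume.restrict (positiveOrthant d)).withDensity
        fun x => ENNReal.ofReal (squaredDensity β m x) := by
  have hprod := Measure.map_prod_map
    (Measure.pi fun j : Fin (d + 1) => chiLaw (β * ((m : ℝ) - (j : ℕ))))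
    (Measure.pi fun j : Fin d => chiLaw (β * (((d + 1 : ℕ) : ℝ) - ((j : ℕ) + 1))))
    (f := fun x => x ^ 2) (g := fun x => x ^ 2) (by fun_prop) (by fun_prop)
  rw [map_sq_pi_chiLaw, map_sq_pi_chiLaw, prod_withDensity (by fun_prop) (by fun_prop),
    Measure.prod_restrict, ← Measure.volume_eq_prod] at hprod
  refine hprod.symm.trans (withDensity_congr_ae ?_)
  filter_upwards [ae_restrict_mem (measurableSet_positiveOrthant d)] with x hx
  obtain ⟨hfst_pos, hsnd_pos⟩ := mem_positiveOrthant.1 hx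
  have hfst (i : Fin (d + 1)) := chiSqDensity_nonneg (degrees_fst_pos hβ hm i) (hfst_pos i)
  have hsnd (j : Fin d) := chiSqDensity_nonneg (degrees_snd_pos hβ j) (hsnd_pos j)
  rw [squaredDensity, ENNReal.ofReal_mul (Finset.prod_nonneg fun i _ => hfst i),
    ENNReal.ofReal_prod_of_nonneg fun i _ => hfst i,
    ENNReal.ofReal_prod_of_nonneg fun j _ => hsnd j]

end CoefficientLaw

/-! ### Resultants and the joint density -/

section Resultant

variable {d : ℕ}

theorem resultant_stieltjesStep (u v : ℝ) (x : VecPair d) :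
    (monicOf (stieltjesStep u v x).1).resultant (monicOf (stieltjesStep u v x).2) (d + 2) (d + 1) =
      (u * -v) ^ (d + 1) * (monicOf x.1).resultant (monicOf x.2) (d + 1) d := by
  have hfst : monicOf (stieltjesStep u v x).1 =
      C (-u) * monicOf x.1 + monicOf (stieltjesStep u v x).2 * X := by
    rw [monicOf_stieltjesStep_fst, monicOf_stieltjesStep_snd, C_neg]
    ring
  have hsnd : monicOf (stieltjesStep u v x).2 = C (-v) * monicOf x.2 + monicOf x.1 * 1 := by
    rw [monicOf_stieltjesStep_snd, C_neg]
    ring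
  have hP := (natDegree_monicOf x.1).le
  have hQ := (natDegree_monicOf x.2).le
  have hQ' := natDegree_monicOf (stieltjesStep u v x).2
  have hcoeff : (monicOf (stieltjesStep u v x).2).coeff (d + 1) = 1 :=
    coeff_monicOf_self _
  have hcoeffP : (monicOf x.1).coeff (d + 1) = 1 := coeff_monicOf_self _
  calc (monicOf (stieltjesStep u v x).1).resultant
        (monicOf (stieltjesStep u v x).2) (d + 2) (d + 1)
      = (C (-u) * monicOf x.1 + monicOf (stieltjesStep u v x).2 * X).resultant
          (monicOf (stieltjesStep u v x).2) (d + 2) (d + 1) := by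
        rw [hfst]
    _ = u ^ (d + 1) * (monicOf x.1).resultant (monicOf (stieltjesStep u v x).2)
          (d + 1) (d + 1) := by
        rw [resultant_add_mul_left _ _ _ _ _ (by rw [natDegree_X]; omega) hQ'.le,
          resultant_C_mul_left, resultant_succ_left_deg _ _ _ _ hP, hcoeff, mul_one, ← mul_assoc,
          ← mul_pow, neg_mul_neg, mul_one]
    _ = u ^ (d + 1) * (monicOf x.1).resultant (C (-v) * monicOf x.2 + monicOf x.1 * 1)
          (d + 1) (d + 1) := by
        rw [hsnd]
    _ = (u * -v) ^ (d + 1) * (monicOf x.1).resultant (monicOf x.2) (d + 1) d := by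
        rw [resultant_add_mul_right _ _ _ _ _ (by simp) hP, resultant_C_mul_right,
          resultant_add_right_deg _ _ _ _ 1 hQ, hcoeffP, one_pow, one_mul, mul_pow, mul_assoc]

theorem resultant_stieltjesMap (x : VecPair d) :
    (monicOf (stieltjesMap d x).1).resultant (monicOf (stieltjesMap d x).2) (d + 1) d =
      (∏ i, x.1 i ^ (d - (i : ℕ))) * ∏ i, (-x.2 i) ^ (d - (i : ℕ)) := by
  induction d with
  | zero => simp [monicOf]
  | succ d ih =>
    rw [stieltjesMap, resultant_stieltjesStep, ih, Fin.prod_univ_succ fun i => x.1 i ^ _,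
      Fin.prod_univ_succ fun i => (-x.2 i) ^ _]
    simp only [Fin.tail, Fin.val_succ, Nat.add_sub_add_right, Fin.val_zero, Nat.sub_zero]
    ring

theorem stieltjesMap_fst_zero (x : VecPair d) :
    (stieltjesMap d x).1 0 = (-1) ^ (d + 1) * ∏ i, x.1 i := by
  induction d with
  | zero => simp [stieltjesMap]
  | succ d ih =>
    have hstep : (stieltjesMap (d + 1) x).1 0 =
        -(x.1 0 * (stieltjesMap d (Fin.tail x.1, Fin.tail x.2)).1 0) := by
      rw [stieltjesMap, stieltjesStep]
      dsimp only
      rw [Pi.sub_apply, Fin.cons_zero, ← Fin.castSucc_zero,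
        Fin.snoc_castSucc, zero_sub, Pi.smul_apply, smul_eq_mul]
    rw [hstep, ih, Fin.prod_univ_succ x.1]
    simp only [Fin.tail]
    ring

theorem stieltjesMap_fst_last (x : VecPair d) :
    (stieltjesMap d x).1 (Fin.last d) = -(∑ i, x.1 i + ∑ i, x.2 i) := by
  induction d with
  | zero => simp [stieltjesMap]
  | succ d ih =>
    have hstep : (stieltjesMap (d + 1) x).1 (Fin.last (d + 1)) =
        (stieltjesMap d (Fin.tail x.1, Fin.tail x.2)).1 (Fin.last d) - x.2 0 - x.1 0 := by
      rw [stieltjesMap, stieltjesStep]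
      dsimp only
      rw [Pi.sub_apply, Fin.snoc_last, ← Fin.succ_last,
        Fin.cons_succ, Pi.sub_apply, Fin.snoc_last]
    rw [hstep, ih, Fin.sum_univ_succ x.1, Fin.sum_univ_succ x.2]
    simp only [Fin.tail]
    ring

theorem star_perturbedCoeffs (l : ℝ) (x : VecPair d) :
    star (perturbedCoeffs l x) = perturbedCoeffs (-l) x := by
  ext1 i
  simp [perturbedCoeffs]

theorem resultant_X_mul_right (P Q : ℝ[X]) (hP : P.natDegree ≤ d + 1) (hQ : Q.natDegree = d) :
    P.resultant (X * Q) (d + 1) (d + 1) = (-1) ^ (d + 1) * P.coeff 0 * P.resultant Q (d + 1) d := by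
  have h := resultant_mul_right P X Q (d + 1) hP
  have hX := resultant_X_sub_C_right P (d + 1) 0 hP
  rw [C_0, sub_zero, ← coeff_zero_eq_eval_zero] at hX
  rwa [natDegree_X, hQ, add_comm 1 d, hX] at h

theorem resultant_monicOf_perturbedCoeffs (l : ℝ) (x : VecPair d) :
    (monicOf (perturbedCoeffs l x)).resultant (monicOf (star (perturbedCoeffs l x)))
        (d + 1) (d + 1) =
      (2 * Complex.I * l) ^ (d + 1) * ((-1) ^ (d + 1) * x.1 0 *
        (monicOf x.1).resultant (monicOf x.2) (d + 1) d : ℝ) := by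
  have hP := (natDegree_monicOf x.1).le
  set M := X * monicOf x.2 - monicOf x.1 with hM
  have hM_deg : M.natDegree ≤ d + 1 := by
    rw [hM, ← monicOf_cons_zero]
    exact (natDegree_sub_le_of_le (natDegree_monicOf _).le hP).trans (max_self _).le
  have hPM : (monicOf x.1).resultant M (d + 1) (d + 1) =
      (-1) ^ (d + 1) * x.1 0 * (monicOf x.1).resultant (monicOf x.2) (d + 1) d := by
    rw [hM, show X * monicOf x.2 - monicOf x.1 = X * monicOf x.2 + monicOf x.1 * (-1) by ring,
      resultant_add_mul_right _ _ _ _ _ (by simp) hP,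
      resultant_X_mul_right _ _ hP (natDegree_monicOf _), ← coeff_monicOf x.1 0, Fin.val_zero]
  calc (monicOf (perturbedCoeffs l x)).resultant (monicOf (star (perturbedCoeffs l x)))
        (d + 1) (d + 1)
      = (monicOf (perturbedCoeffs l x)).resultant
          (C (2 * Complex.I * l) * M.map (algebraMap ℝ ℂ) + monicOf (perturbedCoeffs l x) * 1)
          (d + 1) (d + 1) := by
        rw [star_perturbedCoeffs, monicOf_perturbedCoeffs (-l), monicOf_perturbedCoeffs l]
        congr 1
        push_cast
        simp only [C_mul, C_neg, ← hM, show C (2 : ℂ) = 2 from rfl]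
        ring
    _ = (2 * Complex.I * l) ^ (d + 1) * ((monicOf x.1).map (algebraMap ℝ ℂ) +
          M.map (algebraMap ℝ ℂ) * C (-(Complex.I * l))).resultant (M.map (algebraMap ℝ ℂ))
          (d + 1) (d + 1) := by
        rw [resultant_add_mul_right _ _ _ _ _ (by simp) (natDegree_monicOf _).le,
          resultant_C_mul_right, monicOf_perturbedCoeffs, C_neg]
        congr 2
        ring
    _ = _ := by
        rw [resultant_add_mul_left _ _ _ _ _ (by rw [natDegree_C]; omega)
          (natDegree_map_le.trans hM_deg), resultant_map_map, hPM]
        rfl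

theorem resultant_monicOf_rootCoeffs {R : Type*} [CommRing R] [Nontrivial R] {n : ℕ}
    (z w : Fin n → R) :
    (monicOf (rootCoeffs z)).resultant (monicOf (rootCoeffs w)) n n = ∏ j, ∏ k, (z j - w k) := by
  have hw : (∏ k, (X - C (w k))).natDegree ≤ n := by
    rw [← monicOf_rootCoeffs, natDegree_monicOf]
  have h := resultant_prod_left Finset.univ (fun j => X - C (z j)) (∏ k, (X - C (w k))) n
    (by simp) hw
  rw [← monicOf_rootCoeffs, natDegree_monicOf, monicOf_rootCoeffs z] at h
  rw [monicOf_rootCoeffs, monicOf_rootCoeffs, h]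
  refine Finset.prod_congr rfl fun j _ => ?_
  rw [natDegree_X_sub_C, resultant_X_sub_C_left _ _ _ hw, eval_prod]
  simp

theorem rootCoeffs_comp {R S : Type*} [CommRing R] [CommRing S] (f : R →+* S) {n : ℕ}
    (z : Fin n → R) : rootCoeffs (f ∘ z) = f ∘ rootCoeffs z := by
  funext i
  rw [Function.comp_apply, rootCoeffs, rootCoeffs, ← coeff_map, Polynomial.map_prod]
  simp

end Resultant

section Roots

variable {d : ℕ} {l : ℝ} {x : VecPair d} {z : Fin (d + 1) → ℂ}

theorem abs_re_prod (hz : rootCoeffs z = perturbedCoeffs l x) : |(∏ j, z j).re| = |x.1 0| := by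
  have h := congrArg Complex.re (congrFun hz 0)
  rw [rootCoeffs_zero, show ((-1 : ℂ) ^ (d + 1)) = (((-1 : ℝ) ^ (d + 1) : ℝ) : ℂ) by simp,
    Complex.re_ofReal_mul] at h
  have habs := congrArg abs h
  rw [abs_mul, abs_pow, abs_neg, abs_one, one_pow, one_mul] at habs
  rw [habs]
  simp [perturbedCoeffs]

theorem sum_re (hz : rootCoeffs z = perturbedCoeffs l x) :
    ∑ j, (z j).re = -x.1 (Fin.last d) := by
  have hlast : rootCoeffs z (Fin.last d) = -∑ j, z j := by
    rw [← prod_X_sub_C_nextCoeff, nextCoeff, if_neg] <;>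
      simp [natDegree_prod_of_monic, monic_X_sub_C, rootCoeffs]
  have h := congrArg Complex.re (congrFun hz (Fin.last d))
  simp only [hlast, Complex.neg_re, Complex.re_sum, perturbedCoeffs, Complex.sub_re,
    Complex.ofReal_re, Complex.I_mul_re, Complex.ofReal_im, neg_zero, sub_zero] at h
  rw [← h, neg_neg]

theorem prod_norm_sub_conj (hx : x ∈ positiveOrthant d) (hl : 0 < l)
    (hz : rootCoeffs z = perturbedCoeffs l (stieltjesMap d x)) :
    ∏ j, ∏ k, ‖z j - starRingEnd ℂ (z k)‖ =
      (2 * l) ^ (d + 1) * ((∏ i, x.1 i ^ (d - (i : ℕ) + 1)) * ∏ i, x.2 i ^ (d - (i : ℕ))) := by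
  obtain ⟨hu, hv⟩ := mem_positiveOrthant.1 hx
  have hstar : rootCoeffs (fun k => starRingEnd ℂ (z k)) = star (rootCoeffs z) :=
    rootCoeffs_comp (starRingEnd ℂ) z
  have h := resultant_monicOf_perturbedCoeffs l (stieltjesMap d x)
  rw [← hz, ← hstar, resultant_monicOf_rootCoeffs, resultant_stieltjesMap, stieltjesMap_fst_zero]
    at h
  have hnorm := congrArg norm h
  simp only [norm_prod, norm_mul, norm_pow, Complex.norm_real, Complex.norm_I, norm_neg, norm_one,
    one_pow, one_mul, mul_one, Complex.norm_two, Real.norm_of_nonneg hl.le,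
    Real.norm_of_nonneg (hu _).le, Real.norm_of_nonneg (hv _).le] at hnorm
  rw [hnorm, ← mul_assoc (∏ i, x.1 i), ← Finset.prod_mul_distrib]
  simp only [pow_succ']

end Roots

section Normalization

variable {β : ℝ} {m d : ℕ}

theorem prod_Gamma_degrees_fst (hβ : 0 < β) :
    ∏ i : Fin (d + 1), Real.Gamma (β * ((m : ℝ) - (i : ℕ)) / 2) =
      ∏ j : Fin (d + 1), Real.Gamma (1 + β * aParam β m (d + 1) / 2 + β * (j : ℕ) / 2) := by
  rw [← Equiv.prod_comp Fin.revPerm]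
  refine Finset.prod_congr rfl fun j _ => ?_
  rw [Fin.revPerm_apply, Fin.val_rev, Nat.cast_sub (by omega), aParam]
  congr 1
  field_simp
  push_cast
  ring

theorem prod_Gamma_degrees_snd :
    Real.Gamma (β * (d + 1) / 2) *
        ∏ j : Fin d, Real.Gamma (β * (((d + 1 : ℕ) : ℝ) - ((j : ℕ) + 1)) / 2) =
      ∏ j : Fin (d + 1), Real.Gamma (β * ((j : ℕ) + 1) / 2) := by
  rw [Fin.prod_univ_castSucc, mul_comm, ← Equiv.prod_comp Fin.revPerm]
  simp only [Fin.val_castSucc, Fin.val_last]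
  congr 1
  refine Finset.prod_congr rfl fun j _ => ?_
  rw [Fin.revPerm_apply, Fin.val_rev, Nat.cast_sub (by omega)]
  congr 1
  push_cast
  ring

theorem prod_Gamma_one_add_div (hβ : 0 < β) (n : ℕ) :
    ∏ j : Fin n, Real.Gamma (1 + β * ((j : ℕ) + 1) / 2) / Real.Gamma (1 + β / 2) =
      n.factorial * (∏ j : Fin n, Real.Gamma (β * ((j : ℕ) + 1) / 2)) / Real.Gamma (β / 2) ^ n := by
  have hfactorial : ∏ j : Fin n, (((j : ℕ) : ℝ) + 1) = n.factorial := by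
    rw [← Finset.prod_range_add_one_eq_factorial, Finset.prod_range]
    push_cast
    rfl
  have hterm (j : ℕ) : Real.Gamma (1 + β * (j + 1) / 2) / Real.Gamma (1 + β / 2) =
      (j + 1) * Real.Gamma (β * (j + 1) / 2) / Real.Gamma (β / 2) := by
    have hG : Real.Gamma (β / 2) ≠ 0 := (Real.Gamma_pos_of_pos (half_pos hβ)).ne'
    rw [add_comm 1 (β * _ / 2), Real.Gamma_add_one (by positivity), add_comm 1 (β / 2),
      Real.Gamma_add_one (by positivity)]
    field_simp
  simp only [hterm, Finset.prod_div_distrib, Finset.prod_mul_distrib, hfactorial,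
    Finset.prod_const, Finset.card_univ, Fintype.card_fin]

theorem sConst_eq (hβ : 0 < β) :
    sConst β m (d + 1) = (d + 1).factorial * 2 ^ (β * ((d + 1) * m) / 2) *
      (∏ i : Fin (d + 1), Real.Gamma (β * ((m : ℝ) - (i : ℕ)) / 2)) *
      ∏ j : Fin d, Real.Gamma (β * (((d + 1 : ℕ) : ℝ) - ((j : ℕ) + 1)) / 2) := by
  have hexponent : ((d + 1 : ℕ) : ℝ) *
      (aParam β m (d + 1) * β / 2 + 1 + (((d + 1 : ℕ) : ℝ) - 1) * β / 2) =
      β * ((d + 1) * m) / 2 := by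
    rw [aParam]
    field_simp
    push_cast
    ring
  have hG : Real.Gamma (β * (d + 1) / 2) ≠ 0 := (Real.Gamma_pos_of_pos (by positivity)).ne'
  rw [sConst, hexponent, prod_Gamma_degrees_fst hβ]
  simp only [mul_div_right_comm _ _ (Real.Gamma (1 + β / 2))]
  rw [Finset.prod_mul_distrib, prod_Gamma_one_add_div hβ, ← prod_Gamma_degrees_snd]
  push_cast
  field_simp

theorem sum_degrees :
    ∑ i : Fin (d + 1), β * ((m : ℝ) - (i : ℕ)) +
      ∑ j : Fin d, β * (((d + 1 : ℕ) : ℝ) - ((j : ℕ) + 1)) = β * ((d + 1) * m) := by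
  have hrev : ∑ j : Fin d, (((d + 1 : ℕ) : ℝ) - ((j : ℕ) + 1)) =
      ∑ j : Fin d, (((j : ℕ) : ℝ) + 1) := by
    rw [← Equiv.sum_comp Fin.revPerm]
    refine Finset.sum_congr rfl fun j _ => ?_
    rw [Fin.revPerm_apply, Fin.val_rev, Nat.cast_sub (by omega)]
    push_cast
    ring
  rw [← Finset.mul_sum, ← Finset.mul_sum, ← mul_add, hrev, Finset.sum_sub_distrib,
    Fin.sum_univ_succ fun i : Fin (d + 1) => ((i : ℕ) : ℝ)]
  simp

theorem prod_two_rpow_neg_degrees :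
    (∏ i : Fin (d + 1), (2 : ℝ) ^ (-(β * ((m : ℝ) - (i : ℕ)) / 2))) *
      ∏ j : Fin d, (2 : ℝ) ^ (-(β * (((d + 1 : ℕ) : ℝ) - ((j : ℕ) + 1)) / 2)) =
      (2 ^ (β * ((d + 1) * m) / 2))⁻¹ := by
  rw [← Real.rpow_sum_of_pos two_pos, ← Real.rpow_sum_of_pos two_pos, ← Real.rpow_add two_pos,
    ← Real.rpow_neg two_pos.le, ← sum_degrees]
  simp only [Finset.sum_neg_distrib, ← Finset.sum_div]
  congr 1
  ring

theorem squaredDensity_eq (hβ : 0 < β) (x : VecPair d) :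
    squaredDensity β m x = (d + 1).factorial / sConst β m (d + 1) *
      ((∏ i : Fin (d + 1), x.1 i ^ (β * ((m : ℝ) - (i : ℕ)) / 2 - 1)) *
        ∏ j : Fin d, x.2 j ^ (β * (((d + 1 : ℕ) : ℝ) - ((j : ℕ) + 1)) / 2 - 1)) *
      Real.exp (-(∑ i, x.1 i + ∑ j, x.2 j) / 2) := by
  have hexp : Real.exp (-(∑ i, x.1 i + ∑ j, x.2 j) / 2) =
      (∏ i, Real.exp (-x.1 i / 2)) * ∏ j, Real.exp (-x.2 j / 2) := by
    rw [← Real.exp_sum, ← Real.exp_sum, ← Real.exp_add, ← Finset.sum_div, ← Finset.sum_div,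
      Finset.sum_neg_distrib, Finset.sum_neg_distrib, ← add_div, ← neg_add]
  have hfactorial : ((d + 1).factorial : ℝ) ≠ 0 := Nat.cast_ne_zero.2 (Nat.factorial_ne_zero _)
  rw [squaredDensity, hexp, sConst_eq hβ]
  simp only [chiSqDensity, Finset.prod_mul_distrib, Finset.prod_div_distrib]
  rw [mul_assoc ((d + 1).factorial : ℝ), mul_assoc ((d + 1).factorial : ℝ),
    div_mul_cancel_left₀ hfactorial, mul_inv, mul_inv, ← prod_two_rpow_neg_degrees]
  ring

end Normalization

/-- The joint density without its Vandermonde factor. -/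
def reducedDensity (β : ℝ) (m n : ℕ) (F : ℝ → ℝ) (z : Fin n → ℂ) : ℝ :=
  (cConst β m n)⁻¹ * Real.exp (-(∑ j, (z j).re) / 2) *
    |(∏ j, z j).re| ^ (aParam β m n * β / 2 - β / 2) *
    (∏ j, ∏ k, ‖z j - starRingEnd ℂ (z k)‖ ^ (β / 2 - 1)) *
    (F (Real.tan (∑ j, (z j).arg)) / Real.tan (∑ j, (z j).arg) ^ (β * n / 2 - 1))

section ReducedDensity

variable {β : ℝ} {m n : ℕ} {F : ℝ → ℝ}

theorem jointDensity_eq (z : Fin n → ℂ) :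
    jointDensity β m n F z = vandermondeSq z * reducedDensity β m n F z := by
  rw [jointDensity, reducedDensity, vandermondeSq]
  ring

@[fun_prop]
theorem measurable_tan : Measurable Real.tan := by
  rw [show Real.tan = fun x => Real.sin x / Real.cos x from funext Real.tan_eq_sin_div_cos]
  fun_prop

theorem measurable_reducedDensity (hF : Measurable F) : Measurable (reducedDensity β m n F) := by
  unfold reducedDensity
  fun_prop

theorem reducedDensity_comp_perm (z : Fin n → ℂ) (σ : Equiv.Perm (Fin n)) :
    reducedDensity β m n F (z ∘ σ) = reducedDensity β m n F z := by
  have hconj (j : Fin n) : ∏ k, ‖z j - starRingEnd ℂ (z (σ k))‖ ^ (β / 2 - 1) =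
      ∏ k, ‖z j - starRingEnd ℂ (z k)‖ ^ (β / 2 - 1) :=
    Equiv.prod_comp σ fun k => ‖z j - starRingEnd ℂ (z k)‖ ^ (β / 2 - 1)
  simp only [reducedDensity, Function.comp_apply]
  rw [Equiv.sum_comp σ fun j => (z j).re, Equiv.sum_comp σ fun j => (z j).arg, Equiv.prod_comp σ z,
    Equiv.prod_comp σ fun j => ∏ k, ‖z j - starRingEnd ℂ (z (σ k))‖ ^ (β / 2 - 1)]
  simp only [hconj]

end ReducedDensity

section DensityIdentity

variable {β : ℝ} {m d : ℕ} {F : ℝ → ℝ} {y : ℝ × VecPair d} {z : Fin (d + 1) → ℂ}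

theorem prod_norm_sub_conj_rpow (e : ℝ) (hy : y ∈ parameterSpace d)
    (hz : rootCoeffs z = coeffsMap y) :
    ∏ j, ∏ k, ‖z j - starRingEnd ℂ (z k)‖ ^ e = 2 ^ (((d + 1 : ℕ) : ℝ) * e) *
      y.1 ^ (((d + 1 : ℕ) : ℝ) * e) * ((∏ i, (y.2.1 i ^ (d - (i : ℕ) + 1)) ^ e) *
          ∏ i, (y.2.2 i ^ (d - (i : ℕ))) ^ e) := by
  obtain ⟨hl, hx⟩ := hy
  obtain ⟨hu, hv⟩ := mem_positiveOrthant.1 hx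
  have hl : 0 < y.1 := hl
  have hu' (i : Fin (d + 1)) : 0 ≤ y.2.1 i ^ (d - (i : ℕ) + 1) := (pow_pos (hu i) _).le
  have hv' (i : Fin d) : 0 ≤ y.2.2 i ^ (d - (i : ℕ)) := (pow_pos (hv i) _).le
  have hinner (j : Fin (d + 1)) : ∏ k, ‖z j - starRingEnd ℂ (z k)‖ ^ e =
      (∏ k, ‖z j - starRingEnd ℂ (z k)‖) ^ e :=
    Real.finsetProd_rpow _ _ (fun k _ => norm_nonneg _) _
  simp only [hinner]
  rw [Real.finsetProd_rpow _ _ fun j _ => Finset.prod_nonneg fun k _ => norm_nonneg _,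
    prod_norm_sub_conj hx hl hz, Real.finsetProd_rpow _ _ fun i _ => hu' i,
    Real.finsetProd_rpow _ _ fun i _ => hv' i,
    Real.mul_rpow (by positivity) (mul_nonneg (Finset.prod_nonneg fun i _ => hu' i)
      (Finset.prod_nonneg fun i _ => hv' i)),
    Real.mul_rpow (Finset.prod_nonneg fun i _ => hu' i) (Finset.prod_nonneg fun i _ => hv' i),
    mul_pow, Real.mul_rpow (by positivity) (by positivity), ← Real.rpow_natCast_mul two_pos.le,
    ← Real.rpow_natCast_mul hl.le]

theorem rpow_degrees_fst (hβ : 0 < β) {t : ℝ} (ht : 0 < t) {i : ℕ} (hi : i ≤ d) :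
    t ^ (β * ((m : ℝ) - i) / 2 - 1) = t ^ (d - i) *
      (t * t ^ (aParam β m (d + 1) * β / 2 - β / 2)) * (t ^ (d - i + 1)) ^ (β / 2 - 1) := by
  nth_rw 3 [← Real.rpow_one t]
  rw [← Real.rpow_natCast_mul ht.le, ← Real.rpow_natCast t (d - i), ← Real.rpow_add ht,
    ← Real.rpow_add ht, ← Real.rpow_add ht, aParam]
  congr 1
  push_cast [Nat.cast_sub hi]
  field_simp
  ring

theorem rpow_degrees_snd {t : ℝ} (ht : 0 < t) {j : ℕ} (hj : j < d) :
    t ^ (β * (((d + 1 : ℕ) : ℝ) - (j + 1)) / 2 - 1) =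
      t ^ (d - 1 - j) * (t ^ (d - j)) ^ (β / 2 - 1) := by
  have hcast : ((d - 1 - j : ℕ) : ℝ) = d - 1 - j := by
    rw [Nat.cast_sub (by omega), Nat.cast_sub (by omega), Nat.cast_one]
  rw [← Real.rpow_natCast_mul ht.le, ← Real.rpow_natCast t (d - 1 - j), ← Real.rpow_add ht, hcast,
    Nat.cast_sub hj.le]
  congr 1
  push_cast
  ring

theorem coeffsJacobian_eq (hy : y ∈ parameterSpace d) :
    coeffsJacobian y =
      (∏ i, y.2.1 i ^ (d - (i : ℕ)) * y.2.1 i) * (∏ i, y.2.2 i ^ (d - 1 - (i : ℕ))) * y.1 ^ d := by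
  have hu := (mem_positiveOrthant.1 hy.2).1
  rw [coeffsJacobian, stieltjesJacobian, stieltjesMap_fst_zero, abs_mul, abs_pow, abs_neg, abs_one,
    one_pow, one_mul, abs_of_pos (Finset.prod_pos fun i _ => hu i), Finset.prod_mul_distrib]
  ring

theorem reducedDensity_eq (hy : y ∈ parameterSpace d) (him : ∀ j, 0 < (z j).im)
    (hz : rootCoeffs z = coeffsMap y) :
    reducedDensity β m (d + 1) F z = (sConst β m (d + 1))⁻¹ *
      Real.exp (-(∑ i, y.2.1 i + ∑ j, y.2.2 j) / 2) *
      (∏ i, y.2.1 i ^ (aParam β m (d + 1) * β / 2 - β / 2)) *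
      ((∏ i, (y.2.1 i ^ (d - (i : ℕ) + 1)) ^ (β / 2 - 1)) *
        ∏ i, (y.2.2 i ^ (d - (i : ℕ))) ^ (β / 2 - 1)) * (F y.1 / y.1 ^ d) := by
  have hl : 0 < y.1 := hy.1
  have hu := (mem_positiveOrthant.1 hy.2).1
  have htan : Real.tan (∑ j, (z j).arg) = y.1 := by
    rw [← coeffsL_rootCoeffs him, hz, coeffsL_coeffsMap hy]
  have hre : |(∏ j, z j).re| = ∏ i, y.2.1 i := by
    rw [abs_re_prod hz, stieltjesMap_fst_zero, abs_mul, abs_pow, abs_neg, abs_one, one_pow,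
      one_mul, abs_of_pos (Finset.prod_pos fun i _ => hu i)]
  have hlpow : y.1 ^ (β * ((d + 1 : ℕ) : ℝ) / 2 - 1) =
      y.1 ^ d * y.1 ^ (((d + 1 : ℕ) : ℝ) * (β / 2 - 1)) := by
    rw [← Real.rpow_natCast, ← Real.rpow_add hl]
    congr 1
    push_cast
    ring
  have hlpos : 0 < y.1 ^ (((d + 1 : ℕ) : ℝ) * (β / 2 - 1)) := Real.rpow_pos_of_pos hl _
  have htwo : 0 < (2 : ℝ) ^ (((d + 1 : ℕ) : ℝ) * (β / 2 - 1)) := Real.rpow_pos_of_pos two_pos _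
  rw [reducedDensity, cConst, htan, hre, sum_re hz, stieltjesMap_fst_last,
    prod_norm_sub_conj_rpow _ hy hz, hlpow, ← Real.finsetProd_rpow _ _ fun i _ => (hu i).le,
    neg_neg]
  generalize (2 : ℝ) ^ (((d + 1 : ℕ) : ℝ) * (β / 2 - 1)) = c at *
  generalize y.1 ^ (((d + 1 : ℕ) : ℝ) * (β / 2 - 1)) = b at *
  field_simp

theorem squaredDensity_mul (hβ : 0 < β) (hy : y ∈ parameterSpace d) (him : ∀ j, 0 < (z j).im)
    (hz : rootCoeffs z = coeffsMap y) :
    squaredDensity β m y.2 * F y.1 =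
      (d + 1).factorial * (coeffsJacobian y * reducedDensity β m (d + 1) F z) := by
  have hl : 0 < y.1 := hy.1
  obtain ⟨hu, hv⟩ := mem_positiveOrthant.1 hy.2
  rw [squaredDensity_eq hβ, coeffsJacobian_eq hy, reducedDensity_eq hy him hz,
    Finset.prod_congr rfl fun i _ => rpow_degrees_fst hβ (hu i) (Nat.lt_succ_iff.1 i.2),
    Finset.prod_congr rfl fun j _ => rpow_degrees_snd (hv j) j.2]
  simp only [Finset.prod_mul_distrib]
  field_simp

end DensityIdentity

/-! ### The law of the eigenvalues -/

section CharCoeffsLaw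

variable {β : ℝ} {m d : ℕ} {F : ℝ → ℝ}

instance sFinite_densityMeasure : SFinite (densityMeasure F) := by
  unfold densityMeasure; infer_instance

instance sFinite_coefficientLaw : @SFinite (VecPair d) _ (coefficientLaw β m (d + 1)) := by
  unfold coefficientLaw; infer_instance

theorem densityMeasure_eq_restrict (hF0 : ∀ t ≤ 0, F t = 0) :
    densityMeasure F = (volume.restrict (Set.Ioi 0)).withDensity fun t => ENNReal.ofReal (F t) := by
  rw [← withDensity_indicator measurableSet_Ioi, densityMeasure]
  congr 1
  ext t
  by_cases ht : 0 < t
  · rw [Set.indicator_of_mem (Set.mem_Ioi.2 ht)]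
  · rw [Set.indicator_of_notMem (by simpa using ht), hF0 t (not_lt.1 ht), ENNReal.ofReal_zero]

theorem map_charCoeffs_prod (hβ : 0 < β) (hm : d + 1 ≤ m) (hF : Measurable F)
    (hF0 : ∀ t ≤ 0, F t = 0) :
    ((densityMeasure F).prod (laguerreLaw β m (d + 1))).map (fun a => charCoeffs a.1 a.2) =
      ((volume.restrict (parameterSpace d)).withDensity fun y =>
        ENNReal.ofReal (squaredDensity β m y.2 * F y.1)).map coeffsMap := by
  have hsq : Measurable fun x : VecPair d => x ^ 2 := by fun_prop
  have hgram : (densityMeasure F).prod (laguerreLaw β m (d + 1)) =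
      ((densityMeasure F).prod (coefficientLaw β m (d + 1))).map (Prod.map id gram) := by
    rw [← Measure.map_prod_map _ _ measurable_id (measurable_gram d), Measure.map_id]
    rfl
  have hcomp : (fun a => charCoeffs a.1 a.2) ∘ Prod.map id gram =
      coeffsMap ∘ Prod.map id fun x : VecPair d => x ^ 2 :=
    funext fun a => charCoeffs_gram a.1 a.2
  rw [hgram, Measure.map_map (measurable_charCoeffs d) (measurable_id.prodMap (measurable_gram d)),
    hcomp, ← Measure.map_map measurable_coeffsMap (measurable_id.prodMap hsq)]
  congr 1
  rw [← Measure.map_prod_map _ _ measurable_id hsq, Measure.map_id, map_sq_coefficientLaw hβ hm,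
    densityMeasure_eq_restrict hF0, prod_withDensity (by fun_prop) (by fun_prop),
    Measure.prod_restrict, ← Measure.volume_eq_prod]
  refine withDensity_congr_ae ?_
  filter_upwards [ae_restrict_mem (measurableSet_parameterSpace d)] with y hy
  rw [mul_comm, ENNReal.ofReal_mul (squaredDensity_nonneg hβ hm hy.2)]

/-- The joint density, extended by zero outside of the acute configurations. -/
def acuteDensity (β : ℝ) (m d : ℕ) (F : ℝ → ℝ) : (Fin (d + 1) → ℂ) → ENNReal :=
  (acuteConfigurations (d + 1)).indicator fun z => ENNReal.ofReal (jointDensity β m (d + 1) F z)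

theorem measurable_acuteDensity (hF : Measurable F) : Measurable (acuteDensity β m d F) := by
  refine Measurable.indicator ?_ measurableSet_acuteConfigurations
  simp only [jointDensity_eq]
  exact (measurable_vandermondeSq.mul (measurable_reducedDensity hF)).ennreal_ofReal

theorem acuteDensity_comp_perm (z : Fin (d + 1) → ℂ) (σ : Equiv.Perm (Fin (d + 1))) :
    acuteDensity β m d F (z ∘ σ) = acuteDensity β m d F z := by
  have hmem : z ∘ σ ∈ acuteConfigurations (d + 1) ↔ z ∈ acuteConfigurations (d + 1) := by
    simp only [acuteConfigurations_eq_preimage, Set.mem_preimage, rootCoeffs_comp_perm]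
  by_cases hz : z ∈ acuteConfigurations (d + 1)
  · simp only [acuteDensity, Set.indicator_of_mem (hmem.2 hz), Set.indicator_of_mem hz,
      jointDensity_eq, vandermondeSq_comp_perm, reducedDensity_comp_perm]
  · rw [acuteDensity, Set.indicator_of_notMem (hmem.not.2 hz), Set.indicator_of_notMem hz]

/-- The density of the coefficients of the characteristic polynomial of the perturbed matrix, on
`coeffsRegion d`; the factor `(d + 1)!` counts the orderings of the eigenvalues. -/
def coeffsDensity (β : ℝ) (m d : ℕ) (F : ℝ → ℝ) (c : Fin (d + 1) → ℂ) : ENNReal :=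
  (d + 1).factorial * ENNReal.ofReal (reducedDensity β m (d + 1) F (sortedRoots c))

theorem measurable_coeffsDensity (hF : Measurable F) : Measurable (coeffsDensity β m d F) :=
  ((measurable_reducedDensity hF).comp measurable_sortedRoots).ennreal_ofReal.const_mul _

theorem factorial_mul_acuteDensity {z : Fin (d + 1) → ℂ}
    (hz : Function.Injective fun j => (z j).re) :
    (d + 1).factorial * acuteDensity β m d F z = ENNReal.ofReal (vandermondeSq z) *
      (coeffsRegion d).indicator (coeffsDensity β m d F) (rootCoeffs z) := by
  rw [acuteDensity, acuteConfigurations_eq_preimage]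
  by_cases hmem : rootCoeffs z ∈ coeffsRegion d
  · rw [Set.indicator_of_mem (Set.mem_preimage.2 hmem), Set.indicator_of_mem hmem, jointDensity_eq,
      ENNReal.ofReal_mul (vandermondeSq_pos hz).le, coeffsDensity,
      apply_sortedRoots_rootCoeffs reducedDensity_comp_perm hz, mul_left_comm]
  · rw [Set.indicator_of_notMem (Set.mem_preimage.not.2 hmem), Set.indicator_of_notMem hmem,
      mul_zero, mul_zero]

theorem map_rootCoeffs_withDensity_acuteDensity (hF : Measurable F) :
    (volume.withDensity (acuteDensity β m d F)).map rootCoeffs =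
      (volume.restrict (coeffsRegion d)).withDensity (coeffsDensity β m d F) := by
  refine Measure.ext_of_lintegral _ fun f hf => ?_
  have hfr : Measurable fun z : Fin (d + 1) → ℂ => f (rootCoeffs z) := hf.comp measurable_rootCoeffs
  have hg := ((measurable_coeffsDensity (β := β) (m := m) (d := d) hF).indicator
    measurableSet_coeffsRegion).mul hf
  rw [← withDensity_indicator measurableSet_coeffsRegion, lintegral_map hf measurable_rootCoeffs,
    lintegral_withDensity_eq_lintegral_mul _ (measurable_acuteDensity hF) hfr,
    lintegral_withDensity_eq_lintegral_mul _
      ((measurable_coeffsDensity hF).indicator measurableSet_coeffsRegion) hf,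
    ← ENNReal.mul_right_inj (Nat.cast_ne_zero.2 (d + 1).factorial_ne_zero)
      (ENNReal.natCast_ne_top _), ← lintegral_vandermondeSq_mul hg,
    ← lintegral_const_mul _ ((measurable_acuteDensity hF).mul hfr)]
  refine lintegral_congr_ae (ae_injective_re.mono fun z hz => ?_)
  simp only [Pi.mul_apply]
  rw [← mul_assoc, factorial_mul_acuteDensity hz, mul_assoc]

theorem map_coeffsMap_withDensity {g : (Fin (d + 1) → ℂ) → ENNReal} (hg : Measurable g) :
    ((volume.restrict (parameterSpace d)).withDensity fun y =>
      ENNReal.ofReal (coeffsJacobian y) * g (coeffsMap y)).map coeffsMap =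
        (volume.restrict (coeffsRegion d)).withDensity g := by
  refine Measure.ext_of_lintegral _ fun f hf => ?_
  have hw : Measurable fun y : ℝ × VecPair d =>
      ENNReal.ofReal (coeffsJacobian y) * g (coeffsMap y) :=
    measurable_coeffsJacobian.ennreal_ofReal.mul (hg.comp measurable_coeffsMap)
  have hfm : Measurable fun y : ℝ × VecPair d => f (coeffsMap y) := hf.comp measurable_coeffsMap
  rw [lintegral_map hf measurable_coeffsMap, lintegral_withDensity_eq_lintegral_mul _ hw hfm,
    lintegral_withDensity_eq_lintegral_mul _ hg hf, setLIntegral_coeffsRegion (hg.mul hf)]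
  simp only [Pi.mul_apply, mul_assoc]

theorem ae_notMem_image_degenerateConfigurations (n : ℕ) :
    ∀ᵐ c : Fin n → ℂ, c ∉ rootCoeffs '' degenerateConfigurations n :=
  measure_eq_zero_iff_ae_notMem.1 volume_image_degenerateConfigurations

theorem ofReal_squaredDensity_mul (hβ : 0 < β) {y : ℝ × VecPair d} (hy : y ∈ parameterSpace d)
    (hc : coeffsMap y ∉ rootCoeffs '' degenerateConfigurations (d + 1)) :
    ENNReal.ofReal (squaredDensity β m y.2 * F y.1) = ENNReal.ofReal (coeffsJacobian y) *
      coeffsDensity β m d F (coeffsMap y) := by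
  have hroots := rootCoeffs_sortedRoots hc
  have hmem : rootCoeffs (sortedRoots (coeffsMap y)) ∈ coeffsRegion d :=
    hroots.symm ▸ coeffsMap_mem_coeffsRegion hy
  rw [squaredDensity_mul hβ hy (mem_acuteConfigurations_of_mem_coeffsRegion hmem).1 hroots,
    ENNReal.ofReal_mul (by positivity), ENNReal.ofReal_mul (coeffsJacobian_pos hy).le,
    ENNReal.ofReal_natCast, coeffsDensity, mul_left_comm]

theorem map_charCoeffs_prod_eq_map_rootCoeffs (hβ : 0 < β) (hm : d + 1 ≤ m) (hF : Measurable F)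
    (hF0 : ∀ t ≤ 0, F t = 0) :
    ((densityMeasure F).prod (laguerreLaw β m (d + 1))).map (fun a => charCoeffs a.1 a.2) =
      (volume.withDensity (acuteDensity β m d F)).map rootCoeffs := by
  rw [map_charCoeffs_prod hβ hm hF hF0, map_rootCoeffs_withDensity_acuteDensity hF,
    ← map_coeffsMap_withDensity (measurable_coeffsDensity hF)]
  congr 1
  refine withDensity_congr_ae ?_
  filter_upwards [ae_restrict_mem (measurableSet_parameterSpace d),
    (quasiMeasurePreserving_coeffsMap d).ae
      (ae_restrict_of_ae (ae_notMem_image_degenerateConfigurations (d + 1)))] with y hy hc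
  exact ofReal_squaredDensity_mul hβ hy hc

end CharCoeffsLaw

section Support

variable {β : ℝ} {m d : ℕ} {F : ℝ → ℝ}

theorem exists_measurable_density (hF : AEMeasurable F volume) (hF_nonneg : ∀ t, 0 ≤ F t)
    (h0 : densityMeasure F (Set.Iic 0) = 0) :
    ∃ G : ℝ → ℝ, Measurable G ∧ (∀ t ≤ 0, G t = 0) ∧ (∀ t ∉ (densityMeasure F).support, G t = 0) ∧
      F =ᵐ[volume] G := by
  set s := (densityMeasure F).support ∩ Set.Ioi 0 with hs
  have hs_meas : MeasurableSet s :=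
    Measure.isClosed_support.measurableSet.inter measurableSet_Ioi
  have hs_compl : densityMeasure F sᶜ = 0 := by
    rw [hs, Set.compl_inter, Set.compl_Ioi]
    exact measure_union_null Measure.measure_compl_support h0
  refine ⟨s.indicator (hF.mk F), hF.measurable_mk.indicator hs_meas, fun t ht =>
    Set.indicator_of_notMem (fun h => (not_lt.2 ht) h.2) _, fun t ht =>
    Set.indicator_of_notMem (fun h => ht h.1) _, ?_⟩
  rw [densityMeasure, withDensity_apply _ hs_meas.compl, lintegral_eq_zero_iff'
    hF.ennreal_ofReal.restrict, Filter.EventuallyEq, ae_restrict_iff' hs_meas.compl] at hs_compl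
  filter_upwards [hs_compl, hF.ae_eq_mk] with t ht hmk
  by_cases hts : t ∈ s
  · rw [Set.indicator_of_mem hts, hmk]
  · rw [Set.indicator_of_notMem hts]
    exact le_antisymm (ENNReal.ofReal_eq_zero.1 (ht hts)) (hF_nonneg t)

theorem configurations_eq_inter {n : ℕ} (ν : Measure ℝ) :
    configurations n ν = acuteConfigurations n ∩
      {z | Real.tan (∑ j, (z j).arg) ∈ ν.support} := by
  ext z; simp [configurations, acuteConfigurations, and_assoc]

theorem measurableSet_configurations (ν : Measure ℝ) :
    MeasurableSet (configurations (d + 1) ν) := by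
  have htan : Measurable fun z : Fin (d + 1) → ℂ => Real.tan (∑ j, (z j).arg) := by fun_prop
  exact configurations_eq_inter ν ▸ measurableSet_acuteConfigurations.inter
    (htan Measure.isClosed_support.measurableSet)

theorem restrict_configurations_withDensity {G : ℝ → ℝ}
    (hG : ∀ t ∉ (densityMeasure F).support, G t = 0) (hFG : F =ᵐ[volume] G) :
    (volume.restrict (configurations (d + 1) (densityMeasure F))).withDensity
        (fun w => ENNReal.ofReal (jointDensity β m (d + 1) F w)) =
      volume.withDensity (acuteDensity β m d G) := by
  have hF_eq_G := ae_tan_sum_arg_notMem (d := d) hFG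
  rw [ae_restrict_iff' measurableSet_acuteConfigurations] at hF_eq_G
  rw [← withDensity_indicator (measurableSet_configurations _), configurations_eq_inter,
    ← Set.indicator_indicator]
  refine withDensity_congr_ae ?_
  filter_upwards [hF_eq_G] with z hz
  by_cases hza : z ∉ acuteConfigurations (d + 1)
  · rw [Set.indicator_of_notMem hza, acuteDensity, Set.indicator_of_notMem hza]
  rw [not_not] at hza
  rw [Set.indicator_of_mem hza, acuteDensity, Set.indicator_of_mem hza]
  have hz' : F _ = G _ := not_not.1 (hz hza)
  by_cases ht : z ∈ {z : Fin (d + 1) → ℂ | Real.tan (∑ j, (z j).arg) ∈ (densityMeasure F).support}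
  · simp only [Set.indicator_of_mem ht, jointDensity, hz']
  · simp only [Set.indicator_of_notMem ht, jointDensity, hG _ ht, zero_div, mul_zero,
      ENNReal.ofReal_zero]

end Support

section EigenvalueLaw

variable {β : ℝ} {m d : ℕ} {G : ℝ → ℝ} {Ω : Type*} [MeasurableSpace Ω] {P : Measure Ω}
  {J : Ω → Matrix (Fin (d + 1)) (Fin (d + 1)) ℝ} {l : Ω → ℝ}

theorem aemeasurable_charCoeffs (hl : AEMeasurable l P) (hJ : AEMeasurable J P) :
    AEMeasurable (fun ω => charCoeffs (l ω) (J ω)) P :=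
  (measurable_charCoeffs d).comp_aemeasurable (f := fun ω => (l ω, J ω)) (hl.prodMk hJ)

theorem map_charCoeffs [IsProbabilityMeasure P] (hβ : 0 < β) (hm : d + 1 ≤ m)
    (hJ : HasLaw J (laguerreLaw β m (d + 1)) P) (hl : HasLaw l (densityMeasure G) P)
    (hindep : IndepFun J l P) (hG : Measurable G) (hG0 : ∀ t ≤ 0, G t = 0) :
    P.map (fun ω => charCoeffs (l ω) (J ω)) =
      (volume.withDensity (acuteDensity β m d G)).map rootCoeffs := by
  rw [← map_charCoeffs_prod_eq_map_rootCoeffs hβ hm hG hG0, ← hJ.map_eq, ← hl.map_eq,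
    ← (indepFun_iff_map_prod_eq_prod_map_map hl.aemeasurable hJ.aemeasurable).1 hindep.symm,
    AEMeasurable.map_map_of_aemeasurable (measurable_charCoeffs d).aemeasurable
      (hl.aemeasurable.prodMk hJ.aemeasurable)]
  rfl

theorem ae_charCoeffs_notMem (hl : AEMeasurable l P) (hJ : AEMeasurable J P)
    {Φ : (Fin (d + 1) → ℂ) → ENNReal}
    (hlaw : P.map (fun ω => charCoeffs (l ω) (J ω)) = (volume.withDensity Φ).map rootCoeffs) :
    ∀ᵐ ω ∂P, charCoeffs (l ω) (J ω) ∉ rootCoeffs '' degenerateConfigurations (d + 1) := by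
  refine ae_of_ae_map (p := fun c => c ∉ rootCoeffs '' degenerateConfigurations (d + 1))
    (aemeasurable_charCoeffs hl hJ) (hlaw ▸ ?_)
  exact (((withDensity_absolutelyContinuous _ _).map measurable_rootCoeffs).trans
    (quasiMeasurePreserving_rootCoeffs _).absolutelyContinuous).ae_le
      (ae_notMem_image_degenerateConfigurations _)

theorem exists_listsEigenvalues (hl : AEMeasurable l P) (hJ : AEMeasurable J P)
    (hsimple : ∀ᵐ ω ∂P, charCoeffs (l ω) (J ω) ∉ rootCoeffs '' degenerateConfigurations (d + 1)) :
    ∃ z : Ω → Fin (d + 1) → ℂ, AEMeasurable z P ∧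
      ∀ᵐ ω ∂P, ListsEigenvalues (perturbed (l ω) (J ω)) (z ω) :=
  ⟨fun ω => sortedRoots (charCoeffs (l ω) (J ω)),
    measurable_sortedRoots.comp_aemeasurable (aemeasurable_charCoeffs hl hJ),
    hsimple.mono fun _ hω => listsEigenvalues_perturbed_iff.2 (rootCoeffs_sortedRoots hω)⟩

theorem unorderedLaw_eq_withDensity {Φ : (Fin (d + 1) → ℂ) → ENNReal} (hΦ : Measurable Φ)
    (hΦs : ∀ z (σ : Equiv.Perm (Fin (d + 1))), Φ (z ∘ σ) = Φ z)
    (hlaw : P.map (fun ω => charCoeffs (l ω) (J ω)) = (volume.withDensity Φ).map rootCoeffs)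
    (hsimple : ∀ᵐ ω ∂P, charCoeffs (l ω) (J ω) ∉ rootCoeffs '' degenerateConfigurations (d + 1))
    {z : Ω → Fin (d + 1) → ℂ} (hz : AEMeasurable z P)
    (hzJ : ∀ᵐ ω ∂P, ListsEigenvalues (perturbed (l ω) (J ω)) (z ω)) :
    unorderedLaw P z = volume.withDensity Φ := by
  have hroots : ∀ᵐ ω ∂P, rootCoeffs (z ω) = charCoeffs (l ω) (J ω) :=
    hzJ.mono fun _ => listsEigenvalues_perturbed_iff.1
  have hinj : ∀ᵐ ω ∂P, Function.Injective fun j => (z ω j).re := by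
    filter_upwards [hroots, hsimple] with ω hω hωs
    exact not_not.1 fun h => hωs ⟨z ω, h, hω⟩
  rw [← unorderedLaw_withDensity_id hΦ hΦs]
  exact unorderedLaw_congr hz aemeasurable_id hinj
    ((withDensity_absolutelyContinuous _ _).ae_le ae_injective_re)
    ((Measure.map_congr hroots).trans hlaw)

end EigenvalueLaw

end LaguerrePerturbation

end

theorem theorem3p1 (β : ℝ) (hβ : 0 < β) (m n : ℕ) [NeZero n] (hmn : n ≤ m)
    {Ω : Type*} [MeasurableSpace Ω] (P : Measure Ω) [IsProbabilityMeasure P]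
    (J : Ω → Matrix (Fin n) (Fin n) ℝ)
    (hJ : HasLaw J (LaguerrePerturbation.laguerreLaw β m n) P)
    (F : ℝ → ℝ) (hF : AEMeasurable F volume) (hF_nonneg : ∀ t, 0 ≤ F t)
    (l : Ω → ℝ) (hl : HasLaw l (LaguerrePerturbation.densityMeasure F) P)
    (hl_pos : ∀ᵐ ω ∂P, 0 < l ω) (hindep : IndepFun J l P) :
    (∃ z : Ω → Fin n → ℂ, AEMeasurable z P ∧
      ∀ᵐ ω ∂P, LaguerrePerturbation.ListsEigenvalues
        (LaguerrePerturbation.perturbed (l ω) (J ω)) (z ω)) ∧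
    ∀ z : Ω → Fin n → ℂ, AEMeasurable z P →
      (∀ᵐ ω ∂P, LaguerrePerturbation.ListsEigenvalues
        (LaguerrePerturbation.perturbed (l ω) (J ω)) (z ω)) →
      (∀ᵐ ω ∂P, z ω ∈ LaguerrePerturbation.configurations n
        (LaguerrePerturbation.densityMeasure F)) ∧
      LaguerrePerturbation.unorderedLaw P z =
        (volume.restrict (LaguerrePerturbation.configurations n
          (LaguerrePerturbation.densityMeasure F))).withDensity
            (fun w => ENNReal.ofReal (LaguerrePerturbation.jointDensity β m n F w)) := by
  obtain ⟨d, rfl⟩ := Nat.exists_eq_add_one_of_ne_zero (NeZero.ne n)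
  open LaguerrePerturbation in
  have h0 : densityMeasure F (Set.Iic 0) = 0 := by
    rw [← hl.map_eq, Measure.map_apply_of_aemeasurable hl.aemeasurable measurableSet_Iic]
    exact measure_eq_zero_iff_ae_notMem.2 (hl_pos.mono fun _ => not_le.2)
  obtain ⟨G, hG, hG0, hG_support, hFG⟩ := exists_measurable_density hF hF_nonneg h0
  have hν : densityMeasure F = densityMeasure G :=
    withDensity_congr_ae (hFG.fun_comp ENNReal.ofReal)
  have hlaw := map_charCoeffs hβ hmn hJ (hν ▸ hl) hindep hG hG0
  have hsimple := ae_charCoeffs_notMem hl.aemeasurable hJ.aemeasurable hlaw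
  refine ⟨exists_listsEigenvalues hl.aemeasurable hJ.aemeasurable hsimple, fun z hz hzJ => ?_⟩
  have hunordered := unorderedLaw_eq_withDensity (measurable_acuteDensity hG)
    acuteDensity_comp_perm hlaw hsimple hz hzJ
  rw [← restrict_configurations_withDensity hG_support hFG] at hunordered
  refine ⟨ae_of_ae_unorderedLaw hz (hunordered ▸ ?_), hunordered⟩
  exact (withDensity_absolutelyContinuous _ _).ae_le
    (ae_restrict_mem (measurableSet_configurations _))
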